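/- **Theorem (Hilbert-space representability of the $N=2$ hyper-multiplet).** Let $m\ge 0$, $\alpha\in\mathbb{C}$, $\beta\in\mathbb{R}$. The hyper-multiplet of mass $m$ with parameters $\alpha,\beta$ has a representation in a Hilbert space if and only if $$|\alpha|^2+\beta^2\le m^2 .$$ Here the notions are as follows. Conventions: the metric is $\mathrm{diag}(1,-1,-1,-1)$, $\sigma^0=\mathbf 1$ and $\sigma^1,\sigma^2,\sigma^3$ are the Pauli matrices, $\epsilon_{12}=1=-\epsilon_{21}$, $\epsilon^{ab}=-\epsilon_{ab}$, $\psi^a=\epsilon^{ab}\psi_b$, $\partial^2=\partial_\mu\partial^\mu$, and $$D_m(x)=\frac{i}{(2\pi)^3}\int_{\mathbb{R}^3}\frac{d^3p}{2\omega(p)}\left(e^{-ip\cdot x}-e^{ip\cdot x}\right),\qquad \omega(p)=\sqrt{m^2+|p|^2},\quad p\cdot x=\omega(p)x^0-\vec p\cdot\vec x .$$ The multiplet consists of complex scalar Bose fields $\phi_j,f_j$ ($j=1,2$; $SU(2)$ doublets) and Dirac (two-component Weyl pairs) Fermi fields $\psi_a,\chi_a$ ($a=1,2$; $SU(2)$ scalars).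 A *representation in a Hilbert space* consists of a Hilbert space $\mathcal H$, a dense domain $\mathcal D$, a unit vector $\Omega\in\mathcal D$, tempered operator-valued distributions $\phi_j,f_j,\psi_a,\chi_a$ and their adjoints $\phi_j^*,f_j^*,\bar\psi_{\bar a},\bar\chi_{\bar a}$ that leave $\mathcal D$ invariant and satisfy the Klein–Gordon equation of mass $m$, such that $\Omega$ is a Fock vacuum (the annihilation parts of all fields annihilate $\Omega$) and is cyclic ($\mathcal D$ is spanned by the products of smeared fields applied to $\Omega$), such that the following hold. 1. *Causal relations.* $$[\phi_j(x),\phi_k(y)]=0,\quad [\phi_j(x),\phi_k^*(y)]=-i\delta_{jk}D_m(x-y),\quad [f_j(x),f_k^*(y)]=-im^2\delta_{jk}D_m(x-y),$$ $$[\phi_j(x),f_k(y)]=\alpha\,\epsilon_{jk}D_m(x-y),\qquad [\phi_j(x),f_k^*(y)]=\beta\,\delta_{jk}D_m(x-y),$$ $$\{\psi_a(x),\psi_b(y)\}=-2i\alpha\,\epsilon_{ab}D_m(x-y),\qquad \{\chi_a(x),\chi_b(y)\}=2i\bar\alpha\,\epsilon_{ab}D_m(x-y),$$ $$\{\psi_a(x),\bar\psi_{\bar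 b}(y)\}=\{\chi_a(x),\bar\chi_{\bar b}(y)\}=2\sigma^\mu_{a\bar b}\partial_\mu D_m(x-y),\qquad \{\psi_a(x),\chi_b(y)\}=-2i\beta\,\epsilon_{ab}D_m(x-y),$$ and all (anti)commutators that do not follow from these by taking adjoints or exchanging the fields vanish (Bose fields commute with Fermi fields). 2. *Covariance.* There are strongly continuous unitary representations of the translations and of $SL(2,\mathbb{C})$ (together, of the universal cover of the Poincaré group), and of $SU(2)$, commuting with the former, which fix $\Omega$, leave $\mathcal D$ invariant and satisfy $U_a\,c(x)\,U_a^{-1}=c(x+a)$ for every field $c$, $U_A^{-1}\psi_a(\Lambda(A)x)U_A={A_a}^b\psi_b(x)$ (likewise for $\chi_a$), $U_A^{-1}\phi_j(\Lambda(A)x)U_A=\phi_j(x)$ (likewise for $f_j$), and $V_U^{-1}\phi_jV_U=U_{jk}\phi_k$, $V_U^{-1}f_jV_U=U_{jk}f_k$, $V_U^{-1}\psi_aV_U=\psi_a$, $V_U^{-1}\chi_aV_U=\chi_a$. Here $\sigma^\mu(\Lambda(A)x)_\mu=A\,(\sigma^\mu x_\mu)A^*$. 3. *Supersymmetry.* On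 $\mathcal D$ there are operators $Q_{ja}$ with adjoints $\bar Q_{j\bar a}$, and symmetric operators $Z$ and $P_\mu$, such that $Q_{ja},\bar Q_{j\bar a},P_\mu$ annihilate $\Omega$, $[P_\mu,c]=-i\partial_\mu c$ for every field $c$, $Q_{ja}$ commutes with $P_\mu$, $Z$ commutes with $Q_{ja},\bar Q_{j\bar a},P_\mu$, $U_A^{-1}Q_{ja}U_A={A_a}^bQ_{jb}$, $V_U^{-1}Q_{ja}V_U=U_{jk}Q_{ka}$, $$\{Q_{ja},Q_{kb}\}=2\epsilon_{ab}\epsilon_{jk}Z,\qquad \{Q_{ja},\bar Q_{k\bar b}\}=2\delta_{jk}\sigma^\mu_{a\bar b}P_\mu ,$$ $$i[Q_{ja},\phi_k]=\epsilon_{jk}\psi_a,\quad i[\bar Q_{j\bar a},\phi_k]=\delta_{jk}\bar\chi_{\bar a},\quad [Q_{ja},f_k]=i\epsilon_{jk}\sigma^\mu_{a\bar b}\partial_\mu\bar\chi^{\bar b},\quad [\bar Q_{j\bar a},f_k]=-i\delta_{jk}\sigma^\mu_{b\bar a}\partial_\mu\psi^b,$$ $$\{Q_{ja},\psi_b\}=-2\epsilon_{ab}f_j,\quad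 \{Q_{ja},\bar\psi_{\bar b}\}=2\epsilon_{jk}\sigma^\mu_{a\bar b}\partial_\mu\phi_k^*,\quad \{Q_{ja},\chi_b\}=2\epsilon_{jk}\epsilon_{ab}f_k^*,\quad \{Q_{ja},\bar\chi_{\bar b}\}=2\sigma^\mu_{a\bar b}\partial_\mu\phi_j,$$ $$i[Z,\phi_j]=f_j,\quad i[Z,f_j]=\partial^2\phi_j,\quad [Z,\psi_a]=i\sigma^\mu_{a\bar b}\partial_\mu\bar\chi^{\bar b},\quad [Z,\chi_a]=-i\sigma^\mu_{a\bar b}\partial_\mu\bar\psi^{\bar b}.$$ -/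

import Mathlib

open Complex MeasureTheory SchwartzMap LineDeriv

namespace Hyper

noncomputable section

/-! ## Conventions: Minkowski space, Pauli matrices, the invariant tensors -/

/-- Minkowski space-time with its contravariant coordinates `x 0, x 1, x 2, x 3`. -/
abbrev Spacetime : Type := EuclideanSpace ℝ (Fin 4)

/-- Complex test functions on space-time. -/
abbrev TestFn : Type := 𝓢(Spacetime, ℂ)

/-- The partial derivative `∂_μ = ∂ / ∂ x^μ` of a test function. -/
def pd (μ : Fin 4) (F : TestFn) : TestFn :=
  ∂_{(EuclideanSpace.single μ (1 : ℝ) : Spacetime)} F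

/-- The d'Alembert operator `∂² = ∂_0² - ∂_1² - ∂_2² - ∂_3²`. -/
def dAlembert (F : TestFn) : TestFn :=
  pd 0 (pd 0 F) - ∑ i : Fin 3, pd i.succ (pd i.succ F)

/-- The matrices `σ^μ`: the identity and the three Pauli matrices. -/
def pauli : Fin 4 → Matrix (Fin 2) (Fin 2) ℂ :=
  ![1, !![0, 1; 1, 0], !![0, -I; I, 0], !![1, 0; 0, -1]]

/-- The antisymmetric tensor with lower indices, `ε_{12} = 1`. It is used both for spinor indices
and for `SU(2)` indices. -/
def eps : Matrix (Fin 2) (Fin 2) ℂ := !![0, 1; -1, 0]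

/-- The Kronecker symbol. -/
def kron : Matrix (Fin 2) (Fin 2) ℂ := 1

/-! ## The Pauli-Jordan distribution -/

/-- The energy `ω(p) = √(m² + |p|²)`. -/
def energy (m : ℝ) (p : EuclideanSpace ℝ (Fin 3)) : ℝ := Real.sqrt (m ^ 2 + ‖p‖ ^ 2)

/-- The Minkowski product `p · x = ω(p) x^0 - ∑ p^i x^i` of the four-momentum `(ω(p), p)` on the
upper hyperboloid of mass `m` with `x`. -/
def shellDot (m : ℝ) (p : EuclideanSpace ℝ (Fin 3)) (x : Spacetime) : ℝ :=
  energy m p * x 0 - ∑ i : Fin 3, p i * x i.succ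

/-- The mass-shell transform `∫ e^{i s (p · x)} F(x) dx`, with `s = 1` or `s = -1`. -/
def shellTransform (m s : ℝ) (F : TestFn) (p : EuclideanSpace ℝ (Fin 3)) : ℂ :=
  ∫ x : Spacetime, cexp (I * ((s * shellDot m p x : ℝ) : ℂ)) * F x

/-- The Pauli-Jordan causal distribution `D_m(x - y)` smeared with `F(x) G(y)`, where
`D_m(x) = i (2π)⁻³ ∫ (e^{-i p·x} - e^{i p·x}) d³p / (2 ω(p))`. -/
def pauliJordan (m : ℝ) (F G : TestFn) : ℂ :=
  I / ((2 * Real.pi : ℝ) : ℂ) ^ 3 * ∫ p : EuclideanSpace ℝ (Fin 3),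
    ((1 / (2 * energy m p) : ℝ) : ℂ) *
      (shellTransform m (-1) F p * shellTransform m 1 G p
        - shellTransform m 1 F p * shellTransform m (-1) G p)

/-- The distribution `σ^μ_{a b̄} ∂_μ D_m (x - y)` smeared with `F(x) G(y)`; the derivative acts on
the variable `x`, that is on `F` by integration by parts. -/
def sigmaPauliJordan (m : ℝ) (a b : Fin 2) (F G : TestFn) : ℂ :=
  ∑ μ : Fin 4, pauli μ a b * pauliJordan m (-(pd μ F)) G

/-! ## The fields of the multiplet -/

/-- The components of the multiplet: `φ_j`, `f_j`, `ψ_a`, `χ_a` and their adjoints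
`φ_j*`, `f_j*`, `ψ̄_ā`, `χ̄_ā`. -/
inductive Comp : Type
  | phi (j : Fin 2)
  | phiStar (j : Fin 2)
  | f (j : Fin 2)
  | fStar (j : Fin 2)
  | psi (a : Fin 2)
  | psiBar (a : Fin 2)
  | chi (a : Fin 2)
  | chiBar (a : Fin 2)

/-- The adjoint component. -/
def Comp.adj : Comp → Comp
  | .phi j => .phiStar j
  | .phiStar j => .phi j
  | .f j => .fStar j
  | .fStar j => .f j
  | .psi a => .psiBar a
  | .psiBar a => .psi a
  | .chi a => .chiBar a
  | .chiBar a => .chi a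

/-- The Fermi components; the others are Bose components. -/
def Comp.IsFermi : Comp → Prop
  | .psi _ | .psiBar _ | .chi _ | .chiBar _ => True
  | _ => False

/-- Operator-valued distributions on a common invariant domain. -/
abbrev OpDist (E : Type) [AddCommGroup E] [Module ℂ E] : Type := TestFn →ₗ[ℂ] Module.End ℂ E

section Operators

variable {E : Type} [AddCommGroup E] [Module ℂ E]

/-- The commutator. -/
def comm (A B : Module.End ℂ E) : Module.End ℂ E := A * B - B * A

/-- The anticommutator. -/
def acomm (A B : Module.End ℂ E) : Module.End ℂ E := A * B + B * A

/-- `∂_μ A` smeared with `F`, by integration by parts. -/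
def dField (μ : Fin 4) (A : OpDist E) (F : TestFn) : Module.End ℂ E := A (-(pd μ F))

/-- Raising a spinor index: `A^b = ε^{bc} A_c` with `ε^{bc} = - ε_{bc}`. -/
def raise (A : Fin 2 → OpDist E) (b : Fin 2) : OpDist E := ∑ c : Fin 2, (-(eps b c)) • A c

/-- `σ^μ_{a b̄} ∂_μ A^{b̄}` smeared with `F`. -/
def diracBar (A : Fin 2 → OpDist E) (a : Fin 2) (F : TestFn) : Module.End ℂ E :=
  ∑ μ : Fin 4, ∑ b : Fin 2, pauli μ a b • dField μ (raise A b) F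

/-- `σ^μ_{b ā} ∂_μ A^b` smeared with `F`. -/
def diracUnbar (A : Fin 2 → OpDist E) (a : Fin 2) (F : TestFn) : Module.End ℂ E :=
  ∑ μ : Fin 4, ∑ b : Fin 2, pauli μ b a • dField μ (raise A b) F

/-- `σ^μ_{a b̄} ∂_μ A` smeared with `F`, for a scalar field `A`. -/
def sigmaD (a b : Fin 2) (A : OpDist E) (F : TestFn) : Module.End ℂ E :=
  ∑ μ : Fin 4, pauli μ a b • dField μ A F

end Operators

/-! ## Covariance data -/

/-- The universal covering group of the proper orthochronous Lorentz group. -/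
abbrev SL2C : Type := Matrix.SpecialLinearGroup (Fin 2) ℂ

/-- The internal symmetry group. -/
abbrev SU2 : Type := Matrix.specialUnitaryGroup (Fin 2) ℂ

/-- The matrix `σ^μ x_μ = x^0 - ∑ σ^i x^i`. -/
def slash (x : Spacetime) : Matrix (Fin 2) (Fin 2) ℂ :=
  (x 0 : ℂ) • pauli 0 - ∑ i : Fin 3, (x i.succ : ℂ) • pauli i.succ

/-- The Lorentz transformation `Λ(A)`, determined by `σ^μ (Λ(A) x)_μ = A (σ^μ x_μ) Aᴴ`. -/
def lorentz (A : SL2C) (x : Spacetime) : Spacetime :=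
  let X : Matrix (Fin 2) (Fin 2) ℂ := A.1 * slash x * A.1.conjTranspose
  WithLp.toLp 2 fun μ =>
    (if μ = 0 then 1 else -1 : ℝ) * ((pauli μ * X).trace).re / 2

/-- The spinor action of `SL(2, ℂ)` on the components, for a family of vectors indexed by them:
`U_A ψ_a(x) U_A⁻¹ = (A⁻¹)_a^b ψ_b(Λ(A) x)`, likewise for `χ_a`, with the conjugate matrices for the
adjoint spinors; the Bose fields are scalars. -/
def lorentzMix {W : Type} [AddCommGroup W] [Module ℂ W] (A : SL2C) (X : Comp → W) : Comp → W
  | .psi a => ∑ b : Fin 2, (A⁻¹).1 a b • X (.psi b)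
  | .chi a => ∑ b : Fin 2, (A⁻¹).1 a b • X (.chi b)
  | .psiBar a => ∑ b : Fin 2, (starRingEnd ℂ) ((A⁻¹).1 a b) • X (.psiBar b)
  | .chiBar a => ∑ b : Fin 2, (starRingEnd ℂ) ((A⁻¹).1 a b) • X (.chiBar b)
  | c => X c

/-- The action of `SU(2)` on the components: `V_U φ_j V_U⁻¹ = (U⁻¹)_{jk} φ_k`, likewise for `f_j`,
with the conjugate matrices for the adjoint fields; the Fermi fields are invariant. -/
def su2Mix {W : Type} [AddCommGroup W] [Module ℂ W] (U : SU2) (X : Comp → W) : Comp → W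
  | .phi j => ∑ k : Fin 2, (U⁻¹).1 j k • X (.phi k)
  | .f j => ∑ k : Fin 2, (U⁻¹).1 j k • X (.f k)
  | .phiStar j => ∑ k : Fin 2, (starRingEnd ℂ) ((U⁻¹).1 j k) • X (.phiStar k)
  | .fStar j => ∑ k : Fin 2, (starRingEnd ℂ) ((U⁻¹).1 j k) • X (.fStar k)
  | c => X c

/-! ## Quantum free fields -/

/-- A system of free fields of mass `m` with the field content of the hyper-multiplet, acting in
the Hilbert space `H` with a cyclic Fock vacuum. -/
structure FreeFields (m : ℝ) (H : Type) [NormedAddCommGroup H] [InnerProductSpace ℂ H] where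
  /-- the common invariant domain -/
  dom : Submodule ℂ H
  dom_dense : Dense (dom : Set H)
  /-- the vacuum -/
  vac : dom
  vac_norm : ‖(vac : H)‖ = 1
  /-- the fields, as operator-valued distributions -/
  field : Comp → OpDist dom
  /-- matrix elements of the fields are tempered distributions -/
  tempered : ∀ (c : Comp) (u v : dom), Continuous fun F : TestFn => inner ℂ (u : H) (field c F v : H)
  /-- the adjoint of the field `c` smeared with `F` is the field `c.adj` smeared with the complex
  conjugate of `F` -/
  field_adj : ∀ (c : Comp) (F G : TestFn), (∀ x, G x = (starRingEnd ℂ) (F x)) → ∀ u v : dom,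
    inner ℂ (field c F u : H) (v : H) = inner ℂ (u : H) (field c.adj G v : H)
  /-- the Klein-Gordon equation -/
  klein_gordon : ∀ (c : Comp) (F : TestFn), field c (dAlembert F + ((m : ℂ) ^ 2) • F) = 0
  /-- the vacuum is a Fock vacuum: the annihilation parts (frequencies `e^{-i p·x}`) of the fields
  annihilate it, so that a field acts on it only through its creation part -/
  fock : ∀ (c : Comp) (F : TestFn), (∀ p, shellTransform m 1 F p = 0) → field c F vac = 0
  /-- the domain consists of the linear combinations of products of fields applied to the vacuum -/
  cyclic : ∀ W : Submodule ℂ dom, vac ∈ W → (∀ c F, ∀ u ∈ W, field c F u ∈ W) → W = ⊤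
  /-- the unitary representation of the translations -/
  transl : Multiplicative Spacetime →* (H ≃ₗᵢ[ℂ] H)
  /-- the unitary representation of `SL(2, ℂ)` -/
  lor : SL2C →* (H ≃ₗᵢ[ℂ] H)
  /-- the unitary representation of the internal symmetry group -/
  su2 : SU2 →* (H ≃ₗᵢ[ℂ] H)
  transl_cont : ∀ v : H, Continuous fun a : Spacetime => transl (Multiplicative.ofAdd a) v
  lor_cont : ∀ v : H, Continuous fun A : SL2C => lor A v
  su2_cont : ∀ v : H, Continuous fun U : SU2 => su2 U v
  lor_transl : ∀ (A : SL2C) (a : Spacetime),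
    lor A * transl (Multiplicative.ofAdd a) = transl (Multiplicative.ofAdd (lorentz A a)) * lor A
  su2_transl : ∀ (U : SU2) (a : Spacetime),
    su2 U * transl (Multiplicative.ofAdd a) = transl (Multiplicative.ofAdd a) * su2 U
  su2_lor : ∀ (U : SU2) (A : SL2C), su2 U * lor A = lor A * su2 U
  transl_dom : ∀ (a : Multiplicative Spacetime) (u : dom), transl a u ∈ dom
  lor_dom : ∀ (A : SL2C) (u : dom), lor A u ∈ dom
  su2_dom : ∀ (U : SU2) (u : dom), su2 U u ∈ dom
  transl_vac : ∀ a : Multiplicative Spacetime, transl a (vac : H) = vac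
  lor_vac : ∀ A : SL2C, lor A (vac : H) = vac
  su2_vac : ∀ U : SU2, su2 U (vac : H) = vac
  /-- `U_a c(x) U_a⁻¹ = c(x + a)` -/
  transl_field : ∀ (a : Spacetime) (c : Comp) (F G : TestFn), (∀ x, G (x + a) = F x) →
    ∀ u : dom, transl (Multiplicative.ofAdd a) (field c F u : H)
      = (field c G ⟨_, transl_dom (Multiplicative.ofAdd a) u⟩ : H)
  /-- `U_A c(x) U_A⁻¹` is the spinor transform of `c(Λ(A) x)` -/
  lor_field : ∀ (A : SL2C) (c : Comp) (F G : TestFn), (∀ x, G (lorentz A x) = F x) →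
    ∀ u : dom, lor A (field c F u : H)
      = (lorentzMix A (fun d => field d G ⟨_, lor_dom A u⟩) c : H)
  /-- `V_U c(x) V_U⁻¹` is the `SU(2)` transform of `c(x)` -/
  su2_field : ∀ (U : SU2) (c : Comp) (F : TestFn),
    ∀ u : dom, su2 U (field c F u : H)
      = (su2Mix U (fun d => field d F ⟨_, su2_dom U u⟩) c : H)

namespace FreeFields

variable {m : ℝ} {H : Type} [NormedAddCommGroup H] [InnerProductSpace ℂ H]

/-- The causal (anti)commutation relations of the hyper-multiplet with parameters `α`, `β`.
Those which are not listed follow by taking adjoints and by exchanging the two fields. -/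
structure Causal (S : FreeFields m H) (α : ℂ) (β : ℝ) : Prop where
  phi_phi : ∀ j k F G, comm (S.field (.phi j) F) (S.field (.phi k) G) = 0
  phi_phiStar : ∀ j k F G, comm (S.field (.phi j) F) (S.field (.phiStar k) G)
    = (-I * kron j k * pauliJordan m F G) • (1 : Module.End ℂ S.dom)
  f_f : ∀ j k F G, comm (S.field (.f j) F) (S.field (.f k) G) = 0
  f_fStar : ∀ j k F G, comm (S.field (.f j) F) (S.field (.fStar k) G)
    = (-I * (m : ℂ) ^ 2 * kron j k * pauliJordan m F G) • (1 : Module.End ℂ S.dom)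
  phi_f : ∀ j k F G, comm (S.field (.phi j) F) (S.field (.f k) G)
    = (α * eps j k * pauliJordan m F G) • (1 : Module.End ℂ S.dom)
  phi_fStar : ∀ j k F G, comm (S.field (.phi j) F) (S.field (.fStar k) G)
    = ((β : ℂ) * kron j k * pauliJordan m F G) • (1 : Module.End ℂ S.dom)
  psi_psi : ∀ a b F G, acomm (S.field (.psi a) F) (S.field (.psi b) G)
    = (-2 * I * α * eps a b * pauliJordan m F G) • (1 : Module.End ℂ S.dom)
  psi_psiBar : ∀ a b F G, acomm (S.field (.psi a) F) (S.field (.psiBar b) G)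
    = (2 * sigmaPauliJordan m a b F G) • (1 : Module.End ℂ S.dom)
  chi_chi : ∀ a b F G, acomm (S.field (.chi a) F) (S.field (.chi b) G)
    = (2 * I * (starRingEnd ℂ) α * eps a b * pauliJordan m F G) • (1 : Module.End ℂ S.dom)
  chi_chiBar : ∀ a b F G, acomm (S.field (.chi a) F) (S.field (.chiBar b) G)
    = (2 * sigmaPauliJordan m a b F G) • (1 : Module.End ℂ S.dom)
  psi_chi : ∀ a b F G, acomm (S.field (.psi a) F) (S.field (.chi b) G)
    = (-2 * I * (β : ℂ) * eps a b * pauliJordan m F G) • (1 : Module.End ℂ S.dom)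
  psi_chiBar : ∀ a b F G, acomm (S.field (.psi a) F) (S.field (.chiBar b) G) = 0
  bose_fermi : ∀ (c d : Comp), ¬ c.IsFermi → d.IsFermi → ∀ F G,
    comm (S.field c F) (S.field d G) = 0

/-- The supercharges `Q_{ja}`, their adjoints, the central charge `Z` and the generators `P_μ` of
the translations, with the extended supersymmetry algebra and their action on the fields of the
hyper-multiplet. -/
structure Susy (S : FreeFields m H) where
  Q : Fin 2 → Fin 2 → Module.End ℂ S.dom
  Qbar : Fin 2 → Fin 2 → Module.End ℂ S.dom
  Z : Module.End ℂ S.dom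
  P : Fin 4 → Module.End ℂ S.dom
  Q_adj : ∀ j a (u v : S.dom), inner ℂ (Q j a u : H) (v : H) = inner ℂ (u : H) (Qbar j a v : H)
  Z_adj : ∀ u v : S.dom, inner ℂ (Z u : H) (v : H) = inner ℂ (u : H) (Z v : H)
  P_adj : ∀ μ (u v : S.dom), inner ℂ (P μ u : H) (v : H) = inner ℂ (u : H) (P μ v : H)
  Q_vac : ∀ j a, Q j a S.vac = 0
  Qbar_vac : ∀ j a, Qbar j a S.vac = 0
  P_vac : ∀ μ, P μ S.vac = 0
  /-- `[P_μ, c(x)] = - i ∂_μ c(x)` -/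
  P_field : ∀ μ c F, comm (P μ) (S.field c F) = (-I) • dField μ (S.field c) F
  Q_P : ∀ j a μ, comm (Q j a) (P μ) = 0
  Z_Q : ∀ j a, comm Z (Q j a) = 0
  Z_Qbar : ∀ j a, comm Z (Qbar j a) = 0
  Z_P : ∀ μ, comm Z (P μ) = 0
  Q_Q : ∀ j a k b, acomm (Q j a) (Q k b) = (2 * eps a b * eps j k) • Z
  Q_Qbar : ∀ j a k b, acomm (Q j a) (Qbar k b) = (2 * kron j k) • ∑ μ : Fin 4, pauli μ a b • P μ
  /-- `U_A⁻¹ Q_{ja} U_A = A_a^b Q_{jb}` -/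
  Q_lor : ∀ (A : SL2C) j a (u : S.dom), S.lor A (Q j a u : H)
    = ((∑ b : Fin 2, (A⁻¹).1 a b • Q j b ⟨_, S.lor_dom A u⟩ : S.dom) : H)
  /-- `V_U⁻¹ Q_{ja} V_U = U_{jk} Q_{ka}` -/
  Q_su2 : ∀ (U : SU2) j a (u : S.dom), S.su2 U (Q j a u : H)
    = ((∑ k : Fin 2, (U⁻¹).1 j k • Q k a ⟨_, S.su2_dom U u⟩ : S.dom) : H)
  Q_phi : ∀ j a k F, I • comm (Q j a) (S.field (.phi k) F) = eps j k • S.field (.psi a) F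
  Qbar_phi : ∀ j a k F, I • comm (Qbar j a) (S.field (.phi k) F) = kron j k • S.field (.chiBar a) F
  Q_f : ∀ j a k F, comm (Q j a) (S.field (.f k) F)
    = (I * eps j k) • diracBar (fun b => S.field (.chiBar b)) a F
  Qbar_f : ∀ j a k F, comm (Qbar j a) (S.field (.f k) F)
    = (-I * kron j k) • diracUnbar (fun b => S.field (.psi b)) a F
  Q_psi : ∀ j a b F, acomm (Q j a) (S.field (.psi b) F) = (-2 * eps a b) • S.field (.f j) F
  Q_psiBar : ∀ j a b F, acomm (Q j a) (S.field (.psiBar b) F)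
    = ∑ k : Fin 2, (2 * eps j k) • sigmaD a b (S.field (.phiStar k)) F
  Q_chi : ∀ j a b F, acomm (Q j a) (S.field (.chi b) F)
    = ∑ k : Fin 2, (2 * eps j k * eps a b) • S.field (.fStar k) F
  Q_chiBar : ∀ j a b F, acomm (Q j a) (S.field (.chiBar b) F)
    = (2 : ℂ) • sigmaD a b (S.field (.phi j)) F
  Z_phi : ∀ j F, I • comm Z (S.field (.phi j) F) = S.field (.f j) F
  Z_f : ∀ j F, I • comm Z (S.field (.f j) F) = S.field (.phi j) (dAlembert F)
  Z_psi : ∀ a F, comm Z (S.field (.psi a) F) = I • diracBar (fun b => S.field (.chiBar b)) a F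
  Z_chi : ∀ a F, comm Z (S.field (.chi a) F) = (-I) • diracBar (fun b => S.field (.psiBar b)) a F

end FreeFields

/-- The hyper-multiplet of mass `m` with parameters `α`, `β` has a representation in a Hilbert
space. -/
def HasHilbertSpaceRepresentation (m : ℝ) (α : ℂ) (β : ℝ) : Prop :=
  ∃ (H : Type) (_ : NormedAddCommGroup H) (_ : InnerProductSpace ℂ H) (_ : CompleteSpace H)
    (S : FreeFields m H), S.Causal α β ∧ Nonempty S.Susy

end

end Hyper

/-! A system of free fields is determined by its two-point function, so the question is when the
two-point function dictated by the causal relations is positive.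

Necessity. Smear with a test function `G` whose transform vanishes on the negative mass shell. The
adjoint of a field smeared with `G` then annihilates the vacuum, so inner products of one-field
vectors are values of commutators (`FreeFields.inner_field_vac`). For `u`, `v`, `w` obtained from `f
0`, `phi 0`, `phiStar 1` acting on the vacuum, the Gram matrix is `n` times `[[m², iβ, i ᾱ], [-iβ,
1, 0], [-iα, 0, 1]]` with `n > 0`. Hence `0 ≤ ‖u + iβ v + iα w‖² = n (m² - |α|² - β²)`. Only Bose
relations are used, and no supersymmetry.

Sufficiency, one particle. The states are 16-component functions on the mass shell, restrictions of
Fourier transforms of test functions. Their inner product integrates `gram`, a Hermitian form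
depending on the matrix `M = σ^μ p_μ`, against `d³p / 2ω`; its entries are read off from the causal
relations. Under the bound it is positive (`gram_self_nonneg`): on the Bose components by completing
squares, on the Fermi components by a Schur complement with respect to `M`, which is positive
semidefinite with determinant `m²`. The charges act on the 16 components, and their algebra and
adjointness are polynomial identities in the entries of `M` with `det M` in place of `m²`. Lorentz
invariance combines the covariance of `M` with the invariance of `d³p / 2ω`
(`measurePreserving_shellAct`), which is checked on unipotent elements in light-cone coordinates and
on the Weyl element.

Sufficiency, second quantization. The Fock space is built from the full tensor algebra without
symmetrizers. Creation is left multiplication, annihilation is a superderivation, and the form is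
defined so that they are adjoint. Annihilation operators commute or anticommute on the tensor
algebra itself; creation operators therefore do so modulo null vectors of the form, which the
Hausdorff completion removes. Positivity (`GradedForm.form_nonneg`) follows by induction on the
degree from the expression `∑ a(e_i)* a(e_i)` of the number operator. One-particle identities then
lift through `der` (charges) and `second` (symmetries). -/

namespace SuperFock

open TensorAlgebra
open scoped ComplexConjugate

noncomputable section

/-! ### Superderivations of the tensor algebra, annihilation operators and the Fock form. -/

/-- A `ℤ/2`-graded complex vector space with a positive semidefinite even Hermitian form; the
grading is given by the involution `γ`. -/
structure GradedForm (W : Type) [AddCommGroup W] [Module ℂ W] where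
  s : W →ₗ⋆[ℂ] W →ₗ[ℂ] ℂ
  γ : W →ₗ[ℂ] W
  γ_γ : ∀ w, γ (γ w) = w
  symm : ∀ u v, conj (s u v) = s v u
  nonneg : ∀ u, 0 ≤ (s u u).re
  γ_s : ∀ u v, s (γ u) v = s u (γ v)

variable {W : Type} [AddCommGroup W] [Module ℂ W]

/-- The tensor algebra of the one-particle space. -/
abbrev T (W : Type) [AddCommGroup W] [Module ℂ W] : Type := TensorAlgebra ℂ W

/-- The sign of the exchange of two homogeneous objects. -/
def sgn (e d : Bool) : ℂ := if e && d then -1 else 1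

theorem sgn_comm (e d : Bool) : sgn e d = sgn d e := by simp [sgn, Bool.and_comm]

theorem sgn_mul_self (e d : Bool) : sgn e d * sgn e d = 1 := by
  unfold sgn; split_ifs <;> norm_num

theorem conj_sgn (e d : Bool) : conj (sgn e d) = sgn e d := by
  unfold sgn; split_ifs <;> simp

theorem sgn_xor (e d c : Bool) : sgn (xor e d) c = sgn e c * sgn d c := by
  cases e <;> cases d <;> cases c <;> simp [sgn]

/-- The operator `D` with `D 1 = 0` and `D (w ⊗ x) = A w ⊗ x + τ w ⊗ D x`. -/
def skewDer (A : W →ₗ[ℂ] T W) (τ : W →ₗ[ℂ] W) : T W →ₗ[ℂ] T W :=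
  (LinearMap.snd ℂ (T W) (T W)).comp <| LinearMap.flip
    (lift ℂ (A := Module.End ℂ (T W × T W))
      { toFun := fun w => LinearMap.prod ((LinearMap.mulLeft ℂ (ι ℂ w)).comp (LinearMap.fst ℂ _ _))
          ((LinearMap.mulLeft ℂ (A w)).comp (LinearMap.fst ℂ _ _)
            + (LinearMap.mulLeft ℂ (ι ℂ (τ w))).comp (LinearMap.snd ℂ _ _))
        map_add' := fun u v => by
          refine LinearMap.ext fun x => ?_
          ext <;> simp [add_mul]; abel
        map_smul' := fun c v => by
          refine LinearMap.ext fun x => ?_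
          ext <;> simp [smul_add] }).toLinearMap ((1 : T W), (0 : T W))

theorem skewDer_one (A : W →ₗ[ℂ] T W) (τ : W →ₗ[ℂ] W) : skewDer A τ 1 = 0 := by
  simp [skewDer]

/-- Induction on the tensor algebra by multiplication from the left. -/
theorem induction_left {p : T W → Prop} (h1 : p 1) (hadd : ∀ x y, p x → p y → p (x + y))
    (hsmul : ∀ (c : ℂ) x, p x → p (c • x)) (hmul : ∀ w x, p x → p (ι ℂ w * x)) (x : T W) : p x := by
  suffices h : ∀ y, p y → p (x * y) by simpa using h 1 h1
  induction x using TensorAlgebra.induction with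
  | algebraMap r => intro y hy; simpa [Algebra.algebraMap_eq_smul_one] using hsmul r y hy
  | ι w => exact fun y hy => hmul w y hy
  | mul a b ha hb => intro y hy; rw [mul_assoc]; exact ha _ (hb _ hy)
  | add a b ha hb => intro y hy; rw [add_mul]; exact hadd _ _ (ha _ hy) (hb _ hy)

/-- The operators `(x, y) ↦ (w x, A w x + τ w y)` make pairs a module over the tensor algebra, and
the orbit of `(1, 0)` consists of the pairs `(x, D x)`. The recursion is the second component of
this action; `key` identifies the first. -/
theorem skewDer_mul (A : W →ₗ[ℂ] T W) (τ : W →ₗ[ℂ] W) (w : W) (x : T W) :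
    skewDer A τ (ι ℂ w * x) = A w * x + ι ℂ (τ w) * skewDer A τ x := by
  have key : ∀ x : T W, ((lift ℂ (A := Module.End ℂ (T W × T W))
      { toFun := fun w => LinearMap.prod ((LinearMap.mulLeft ℂ (ι ℂ w)).comp (LinearMap.fst ℂ _ _))
          ((LinearMap.mulLeft ℂ (A w)).comp (LinearMap.fst ℂ _ _)
            + (LinearMap.mulLeft ℂ (ι ℂ (τ w))).comp (LinearMap.snd ℂ _ _))
        map_add' := fun u v => by
          refine LinearMap.ext fun x => ?_
          ext <;> simp [add_mul]; abel
        map_smul' := fun c v => by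
          refine LinearMap.ext fun x => ?_
          ext <;> simp [smul_add] }) x ((1 : T W), (0 : T W))).1 = x := by
    intro x
    induction x using induction_left with
    | h1 => simp
    | hadd x y hx hy => rw [map_add, LinearMap.add_apply, Prod.fst_add, hx, hy]
    | hsmul c x hx => rw [map_smul, LinearMap.smul_apply, Prod.smul_fst, hx]
    | hmul w x hx => rw [map_mul, Module.End.mul_apply, lift_ι_apply]; simp [hx]
  simp only [skewDer, LinearMap.comp_apply, LinearMap.flip_apply, AlgHom.toLinearMap_apply,
    map_mul, Module.End.mul_apply, lift_ι_apply]
  simp [key]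

theorem ext_left {N : Type*} [AddCommGroup N] [Module ℂ N] {f g : T W →ₗ[ℂ] N} (h1 : f 1 = g 1)
    (hmul : ∀ w x, f x = g x → f (ι ℂ w * x) = g (ι ℂ w * x)) : f = g := by
  refine LinearMap.ext fun x => ?_
  induction x using induction_left with
  | h1 => exact h1
  | hadd x y hx hy => rw [map_add, map_add, hx, hy]
  | hsmul c x hx => rw [map_smul, map_smul, hx]
  | hmul w x hx => exact hmul w x hx

/-- Uniqueness of the recursion is what yields linearity of `annLin` and `der` in their parameters.
-/
theorem eq_skewDer {A : W →ₗ[ℂ] T W} {τ : W →ₗ[ℂ] W} {f : T W →ₗ[ℂ] T W} (h1 : f 1 = 0)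
    (hmul : ∀ w x, f (ι ℂ w * x) = A w * x + ι ℂ (τ w) * f x) : f = skewDer A τ :=
  ext_left (by rw [h1, skewDer_one]) fun w x hx => by rw [hmul, skewDer_mul, hx]

namespace GradedForm

variable (G : GradedForm W)

/-- The operator which gives the sign when an object of parity `e` passes a vector. -/
def par (e : Bool) : W →ₗ[ℂ] W := if e then G.γ else LinearMap.id

/-- Homogeneous vectors. -/
def IsHom (e : Bool) (w : W) : Prop := G.γ w = if e then -w else w

variable {G} in
theorem IsHom.par {d : Bool} {w : W} (h : G.IsHom d w) (e : Bool) : G.par e w = sgn e d • w := by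
  cases e <;> cases d <;> simp_all [IsHom, GradedForm.par, sgn]

/-- The projection onto the homogeneous vectors of parity `e`. -/
def proj (e : Bool) : W →ₗ[ℂ] W := (1 / 2 : ℂ) • (LinearMap.id + (if e then -G.γ else G.γ))

theorem isHom_proj (e : Bool) (w : W) : G.IsHom e (G.proj e w) := by
  cases e <;> simp [IsHom, proj, G.γ_γ, add_comm, ← smul_neg]

theorem proj_add_proj (w : W) : G.proj false w + G.proj true w = w := by
  simp only [proj, LinearMap.smul_apply, LinearMap.add_apply, LinearMap.id_apply]
  simp
  module

variable {G} in
theorem IsHom.proj {e : Bool} {w : W} (h : G.IsHom e w) : G.proj e w = w := by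
  cases e
  · replace h : G.γ w = w := h
    simp only [GradedForm.proj, LinearMap.smul_apply, LinearMap.add_apply, LinearMap.id_apply,
      Bool.false_eq_true, if_false, h]
    module
  · replace h : G.γ w = -w := h
    simp only [GradedForm.proj, LinearMap.smul_apply, LinearMap.add_apply, LinearMap.id_apply,
      if_true, LinearMap.neg_apply, h]
    module

variable {G} in
theorem IsHom.proj_not {e : Bool} {w : W} (h : G.IsHom e w) : G.proj (!e) w = 0 := by
  cases e
  · replace h : G.γ w = w := h
    simp only [GradedForm.proj, LinearMap.smul_apply, LinearMap.add_apply, LinearMap.id_apply,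
      Bool.not_false, if_true, LinearMap.neg_apply, h]
    module
  · replace h : G.γ w = -w := h
    simp only [GradedForm.proj, LinearMap.smul_apply, LinearMap.add_apply, LinearMap.id_apply,
      Bool.not_true, Bool.false_eq_true, if_false, h]
    module

variable {G} in
-- Moving `γ` across the form gives `s u v = -s u v` when the parities differ.
theorem IsHom.s_eq_zero {e d : Bool} {u v : W} (hu : G.IsHom e u) (hv : G.IsHom d v) (h : e ≠ d) :
    G.s u v = 0 := by
  have := G.γ_s u v
  rw [show G.γ u = _ from hu, show G.γ v = _ from hv] at this
  cases e <;> cases d <;> simp at h this ⊢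
  · linear_combination (1 / 2 : ℂ) * this
  · linear_combination (-1 / 2 : ℂ) * this

variable {G} in
-- Either the parities agree or the form vanishes, so next to `s u v` the sign of `u` may be traded
-- for that of `v`.
theorem IsHom.s_mul_sgn {e d : Bool} {u v : W} (hu : G.IsHom e u) (hv : G.IsHom d v) (c : Bool) :
    G.s u v * sgn e c = G.s u v * sgn d c := by
  by_cases h : e = d
  · rw [h]
  · rw [hu.s_eq_zero hv h]; ring

theorem induction_hom {p : T W → Prop} (h1 : p 1) (hadd : ∀ x y, p x → p y → p (x + y))
    (hsmul : ∀ (c : ℂ) x, p x → p (c • x))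
    (hmul : ∀ e w x, G.IsHom e w → p x → p (ι ℂ w * x)) (x : T W) : p x := by
  refine induction_left h1 hadd hsmul (fun w x hx => ?_) x
  rw [← G.proj_add_proj w, map_add, add_mul]
  exact hadd _ _ (hmul _ _ _ (G.isHom_proj _ _) hx) (hmul _ _ _ (G.isHom_proj _ _) hx)

theorem ext_hom {N : Type*} [AddCommGroup N] [Module ℂ N] {f g : T W →ₗ[ℂ] N} (h1 : f 1 = g 1)
    (hmul : ∀ e w x, G.IsHom e w → f x = g x → f (ι ℂ w * x) = g (ι ℂ w * x)) : f = g := by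
  refine LinearMap.ext fun x => ?_
  induction x using G.induction_hom with
  | h1 => exact h1
  | hadd x y hx hy => rw [map_add, map_add, hx, hy]
  | hsmul c x hx => rw [map_smul, map_smul, hx]
  | hmul e w x hw hx => exact hmul e w x hw hx

/-- The annihilation operator of parity `e` given by a linear functional. -/
def annLin (e : Bool) : (W →ₗ[ℂ] ℂ) →ₗ[ℂ] Module.End ℂ (T W) where
  toFun ℓ := skewDer (ℓ.smulRight 1) (G.par e)
  map_add' ℓ ℓ' := by
    symm
    refine eq_skewDer (by simp [skewDer_one]) fun w x => ?_
    simp only [LinearMap.add_apply, skewDer_mul, LinearMap.smulRight_apply, mul_add, add_smul,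
      add_mul]
    abel
  map_smul' c ℓ := by
    symm
    refine eq_skewDer (by simp [skewDer_one]) fun w x => ?_
    simp [skewDer_mul, smul_smul]

theorem annLin_one (e : Bool) (ℓ : W →ₗ[ℂ] ℂ) : G.annLin e ℓ 1 = 0 := skewDer_one _ _

theorem annLin_mul (e : Bool) (ℓ : W →ₗ[ℂ] ℂ) {d : Bool} {w : W} (hw : G.IsHom d w) (x : T W) :
    G.annLin e ℓ (ι ℂ w * x) = ℓ w • x + sgn e d • (ι ℂ w * G.annLin e ℓ x) := by
  have := skewDer_mul (ℓ.smulRight (1 : T W)) (G.par e) w x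
  rw [hw.par e] at this
  simpa [annLin] using this

/-- The annihilation operator of a vector. -/
def ann : W →ₗ⋆[ℂ] Module.End ℂ (T W) :=
  (G.annLin false).comp (G.s.comp (G.proj false)) + (G.annLin true).comp (G.s.comp (G.proj true))

variable {G} in
theorem IsHom.ann_eq {e : Bool} {u : W} (hu : G.IsHom e u) : G.ann u = G.annLin e (G.s u) := by
  have h1 := hu.proj
  have h2 := hu.proj_not
  cases e <;> simp_all [GradedForm.ann]

theorem ann_one (u : W) : G.ann u 1 = 0 := by
  simp [ann, annLin_one]

variable {G} in
theorem IsHom.ann_mul {e d : Bool} {u w : W} (hu : G.IsHom e u) (hw : G.IsHom d w) (x : T W) :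
    G.ann u (ι ℂ w * x) = G.s u w • x + sgn e d • (ι ℂ w * G.ann u x) := by
  rw [hu.ann_eq, G.annLin_mul e _ hw]

/-- The Hermitian form of the Fock space; `form x y` is linear in `x` and antilinear in `y`. -/
def form : T W →ₗ[ℂ] (T W →ₗ⋆[ℂ] ℂ) :=
  -- A vector `w` acts on antilinear functionals by precomposition with `ann w`, and the form is the
  -- orbit of the vacuum functional. Half of the adjointness of creation and annihilation thus holds
  -- by construction.
  LinearMap.flip (lift ℂ (A := Module.End ℂ (T W →ₗ⋆[ℂ] ℂ))
    { toFun := fun w =>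
        { toFun := fun θ => θ.comp (G.ann w)
          map_add' := fun θ θ' => by ext; simp
          map_smul' := fun c θ => by ext; simp }
      map_add' := fun u v => by ext; simp
      map_smul' := fun c v => by ext; simp }).toLinearMap
    ((starLinearEquiv ℂ (A := ℂ)).toLinearMap.comp (algebraMapInv (R := ℂ) (M := W)).toLinearMap)

theorem form_one (y : T W) : G.form 1 y = conj (algebraMapInv y) := by
  simp [form]

theorem form_mul (w : W) (x y : T W) : G.form (ι ℂ w * x) y = G.form x (G.ann w y) := by
  simp [form]

variable {G} in
-- The other half of adjointness. Both sides obey the same graded Leibniz recursion in `x`, because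
-- `s` is Hermitian and the exchange sign is real and symmetric.
theorem IsHom.form_mul_right {e : Bool} {w : W} (hw : G.IsHom e w) (x y : T W) :
    G.form x (ι ℂ w * y) = G.form (G.ann w x) y := by
  induction x using G.induction_hom generalizing y with
  | h1 => simp [form_one, ann_one, algebraMapInv]
  | hadd x y hx hy => simp [hx, hy]
  | hsmul c x hx => simp [hx]
  | hmul d u x hu hx =>
    rw [form_mul, hu.ann_mul hw, hw.ann_mul hu]
    simp only [map_add, LinearMap.add_apply, LinearMap.map_smulₛₗ, LinearMap.smul_apply,
      form_mul, hx, G.symm, conj_sgn, sgn_comm d e, RingHom.id_apply]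

theorem form_mul_right (w : W) (x y : T W) :
    G.form x (ι ℂ w * y) = G.form (G.ann w x) y := by
  rw [← G.proj_add_proj w, map_add, add_mul, map_add, (G.isHom_proj _ _).form_mul_right,
    (G.isHom_proj _ _).form_mul_right, map_add, LinearMap.add_apply, map_add, LinearMap.add_apply]

/-- Two-sided adjointness moves the factors of `x` across one by one; what remains is a comparison
of constant terms. -/
theorem conj_form (x y : T W) : conj (G.form x y) = G.form y x := by
  induction x using induction_left generalizing y with
  | h1 =>
    rw [form_one, conj_conj]
    induction y using induction_left with
    | h1 => simp [form_one]
    | hadd x y hx hy => simp [hx, hy]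
    | hsmul c x hx => simp [hx]
    | hmul w x hx => simp [form_mul, ann_one, algebraMapInv]
  | hadd x y hx hy => simp [hx, hy]
  | hsmul c x hx => simp [hx]
  | hmul w x hx => rw [form_mul, hx, ← form_mul_right]

/-- Past a factor `w` both orders produce the same terms up to signs, and the signs match because
each functional sees only vectors of its own parity. No quotient is needed here, whereas creation
operators obey the exchange rule only modulo null vectors. -/
theorem annLin_annLin {e d : Bool} {ℓ ℓ' : W →ₗ[ℂ] ℂ}
    (h : ∀ c w, G.IsHom c w → c ≠ e → ℓ w = 0) (h' : ∀ c w, G.IsHom c w → c ≠ d → ℓ' w = 0) :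
    G.annLin e ℓ * G.annLin d ℓ' = sgn e d • (G.annLin d ℓ' * G.annLin e ℓ) := by
  refine G.ext_hom (by simp [annLin_one]) fun c w x hw hx => ?_
  simp only [Module.End.mul_apply, LinearMap.smul_apply] at hx ⊢
  rw [G.annLin_mul d _ hw, G.annLin_mul e _ hw, map_add, map_add, map_smul, map_smul, map_smul,
    map_smul, G.annLin_mul e _ hw, G.annLin_mul d _ hw, hx]
  have e1 : ℓ' w * sgn e d = ℓ' w * sgn e c := by
    by_cases hc : c = d
    · rw [hc]
    · rw [h' c w hw hc]; ring
  have e2 : ℓ w * sgn e d = ℓ w * sgn d c := by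
    by_cases hc : c = e
    · rw [hc, sgn_comm]
    · rw [h c w hw hc]; ring
  have e3 : ℓ' w = ℓ' w * sgn e d * sgn e c := by
    rw [e1, mul_assoc, sgn_mul_self, mul_one]
  have e4 := sgn_mul_self e d
  simp only [smul_add, smul_smul, mul_smul_comm]
  rw [show sgn d c * ℓ w = sgn e d * ℓ w by linear_combination -e2,
    show sgn e d * (sgn e c * ℓ' w) = ℓ' w by linear_combination -e3,
    show sgn d c * (sgn e c * sgn e d) = sgn e d * (sgn e c * sgn d c) by ring]
  abel

variable {G} in
theorem IsHom.ann_ann {e d : Bool} {u v : W} (hu : G.IsHom e u) (hv : G.IsHom d v) :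
    G.ann u * G.ann v = sgn e d • (G.ann v * G.ann u) := by
  rw [hu.ann_eq, hv.ann_eq]
  exact G.annLin_annLin (fun c w hw hc => hu.s_eq_zero hw hc.symm)
    fun c w hw hc => hv.s_eq_zero hw hc.symm

/-- The second quantization of a one-particle operator of parity `e`, a superderivation. -/
def der (e : Bool) : (W →ₗ[ℂ] W) →ₗ[ℂ] Module.End ℂ (T W) where
  toFun X := skewDer ((ι ℂ).comp X) (G.par e)
  map_add' X Y := by
    symm
    refine eq_skewDer (by simp [skewDer_one]) fun w x => ?_
    simp only [LinearMap.add_apply, skewDer_mul, LinearMap.comp_apply, mul_add, map_add, add_mul]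
    abel
  map_smul' c X := by
    symm
    refine eq_skewDer (by simp [skewDer_one]) fun w x => ?_
    simp [skewDer_mul]

theorem der_one (e : Bool) (X : W →ₗ[ℂ] W) : G.der e X 1 = 0 := skewDer_one _ _

theorem der_mul (e : Bool) (X : W →ₗ[ℂ] W) {d : Bool} {w : W} (hw : G.IsHom d w) (x : T W) :
    G.der e X (ι ℂ w * x) = ι ℂ (X w) * x + sgn e d • (ι ℂ w * G.der e X x) := by
  have := skewDer_mul ((ι ℂ).comp X) (G.par e) w x
  rw [hw.par e] at this
  simpa [der] using this

/-- Operators of parity `e`. -/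
def IsParity (e : Bool) (X : W →ₗ[ℂ] W) : Prop := ∀ d w, G.IsHom d w → G.IsHom (xor e d) (X w)

/-- A graded commutator of two superderivations is fixed by its values on single vectors. With
functionals in place of vectors no adjoint of `X` is needed; when there is one, `ℓ ∘ X` is again an
inner product. -/
theorem annLin_der {e d : Bool} {X : W →ₗ[ℂ] W} (hX : G.IsParity e X) {ℓ : W →ₗ[ℂ] ℂ}
    (h : ∀ c w, G.IsHom c w → c ≠ d → ℓ w = 0) :
    G.annLin d ℓ * G.der e X = G.annLin (xor e d) (ℓ.comp X) + sgn e d • (G.der e X * G.annLin d ℓ)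
    := by
  refine G.ext_hom (by simp [annLin_one, der_one]) fun c w x hw hx => ?_
  simp only [Module.End.mul_apply, LinearMap.smul_apply, LinearMap.add_apply] at hx ⊢
  rw [G.der_mul e _ hw, G.annLin_mul d _ hw, G.annLin_mul _ _ hw, map_add, map_add, map_smul,
    map_smul, map_smul, G.annLin_mul d _ (hX _ _ hw), G.annLin_mul d _ hw, hx, G.der_mul e _ hw]
  have e1 : ℓ w * sgn e d = ℓ w * sgn e c := by
    by_cases hc : c = d
    · rw [hc]
    · rw [h c w hw hc]; ring
  rw [sgn_comm d (xor e c), sgn_xor, sgn_xor, sgn_comm c d]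
  simp only [smul_add, smul_smul, mul_smul_comm, mul_add, LinearMap.comp_apply]
  rw [show sgn e d * ℓ w = sgn e c * ℓ w by linear_combination e1,
    show sgn e d * (sgn d c * sgn e c) = sgn e c * (sgn d c * sgn e d) by ring]
  abel

end GradedForm

end

end SuperFock

/-! ### Second quantization of operators and positivity of the Fock form. -/

namespace SuperFock

open TensorAlgebra
open scoped ComplexConjugate

noncomputable section

variable {W : Type} [AddCommGroup W] [Module ℂ W]

namespace GradedForm

variable (G : GradedForm W)

/-- A supercommutator of superderivations is a superderivation, hence determined on single vectors,
where it is the supercommutator of the one-particle operators. -/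
theorem der_der {e d : Bool} {X Y : W →ₗ[ℂ] W} (hX : G.IsParity e X) (hY : G.IsParity d Y) :
    G.der e X * G.der d Y - sgn e d • (G.der d Y * G.der e X)
      = G.der (xor e d) (X * Y - sgn e d • (Y * X)) := by
  refine G.ext_hom (by simp [der_one]) fun c w x hw hx => ?_
  simp only [Module.End.mul_apply, LinearMap.smul_apply, LinearMap.sub_apply] at hx ⊢
  rw [G.der_mul e _ hw, G.der_mul d _ hw, G.der_mul _ _ hw, ← hx, map_add, map_add, map_smul,
    map_smul, G.der_mul e _ (hY _ _ hw), G.der_mul d _ (hX _ _ hw), G.der_mul e _ hw,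
    G.der_mul d _ hw, sgn_comm d (xor e c), sgn_comm e (xor d c)]
  simp only [sgn_xor, smul_add, smul_sub, smul_smul, mul_sub, mul_smul_comm, LinearMap.sub_apply,
    Module.End.mul_apply, LinearMap.smul_apply, map_sub, map_smul, sub_mul, smul_mul_assoc,
    sgn_comm c, sgn_comm d e]
  rw [show sgn e d * (sgn e d * sgn d c) = (sgn e d * sgn e d) * sgn d c by ring, sgn_mul_self,
    one_mul]
  module

theorem form_mul_one (w : W) (x : T W) : G.form (ι ℂ w * x) 1 = 0 := by
  rw [form_mul, ann_one, map_zero]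

theorem form_der_one (e : Bool) (X : W →ₗ[ℂ] W) (x : T W) : G.form (G.der e X x) 1 = 0 := by
  induction x using G.induction_hom with
  | h1 => simp [der_one]
  | hadd x y hx hy => simp [hx, hy]
  | hsmul c x hx => simp [hx]
  | hmul d w x hw hx => rw [G.der_mul e X hw]; simp [form_mul_one]

/-- The second quantization of the adjoint operator is the adjoint. -/
theorem form_der {e : Bool} {X Y : W →ₗ[ℂ] W} (hX : G.IsParity e X) (hY : G.IsParity e Y)
    (h : ∀ u v, G.s (Y u) v = G.s u (X v)) (x y : T W) :
    G.form (G.der e X x) y = G.form x (G.der e Y y) := by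
  have h' : ∀ u v, G.s (X u) v = G.s u (Y v) := fun u v => by
    rw [← G.symm, ← h, G.symm]
  induction x using G.induction_hom generalizing y with
  | h1 => rw [der_one, ← G.conj_form (G.der e Y y) 1, form_der_one]; simp
  | hadd x y hx hy => simp [hx, hy]
  | hsmul c x hx => simp [hx]
  | hmul d w x hw hx =>
    have := LinearMap.congr_fun (G.annLin_der hY (fun c v hv hc => hw.s_eq_zero hv hc.symm)) y
    simp only [Module.End.mul_apply, LinearMap.add_apply, LinearMap.smul_apply] at this
    rw [G.der_mul e X hw, form_mul, hw.ann_eq, this, map_add, map_add, LinearMap.add_apply,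
      form_mul, (hX _ _ hw).ann_eq, ← hw.ann_eq]
    congr 1
    · congr 3
      exact LinearMap.ext fun v => h' w v
    · simp [form_mul, hx, conj_sgn]

/-- The elements of degree `n` of the tensor algebra of a subspace. -/
def deg (V : Submodule ℂ W) (n : ℕ) : Submodule ℂ (T W) := (V.map (ι ℂ)) ^ n

theorem deg_induction {V : Submodule ℂ W} {n : ℕ} {p : T W → Prop} (hadd : ∀ x y, p x → p y → p (x + y))
    (hmul : ∀ w ∈ V, ∀ x ∈ deg V n, p (ι ℂ w * x)) : ∀ x ∈ deg V (n + 1), p x := by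
  intro x hx
  rw [deg, pow_succ'] at hx
  refine Submodule.mul_induction_on hx ?_ hadd
  rintro _ ⟨w, hw, rfl⟩ y hy
  exact hmul w hw y hy

theorem mem_deg_zero {V : Submodule ℂ W} {x : T W} : x ∈ deg V 0 ↔ ∃ c : ℂ, x = c • 1 := by
  simp [deg, Submodule.mem_one, Algebra.algebraMap_eq_smul_one, eq_comm]

theorem mul_mem_deg {V : Submodule ℂ W} {n : ℕ} {w : W} (hw : w ∈ V) {x : T W} (hx : x ∈ deg V n) :
    ι ℂ w * x ∈ deg V (n + 1) := by
  rw [deg, pow_succ']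
  exact Submodule.mul_mem_mul (Submodule.mem_map_of_mem hw) hx

/-- Subspaces which are spanned by their homogeneous elements. -/
def Stable (V : Submodule ℂ W) : Prop := ∀ e, ∀ w ∈ V, G.proj e w ∈ V

variable {G} in
theorem Stable.deg_induction {V : Submodule ℂ W} (hV : G.Stable V) {n : ℕ} {p : T W → Prop}
    (hadd : ∀ x y, p x → p y → p (x + y))
    (hmul : ∀ e, ∀ w ∈ V, G.IsHom e w → ∀ x ∈ deg V n, p (ι ℂ w * x)) :
    ∀ x ∈ deg V (n + 1), p x := by
  refine GradedForm.deg_induction hadd fun w hw x hx => ?_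
  rw [← G.proj_add_proj w, map_add, add_mul]
  exact hadd _ _ (hmul _ _ (hV _ _ hw) (G.isHom_proj _ _) _ hx)
    (hmul _ _ (hV _ _ hw) (G.isHom_proj _ _) _ hx)

theorem ann_deg_zero {V : Submodule ℂ W} (u : W) {x : T W} (hx : x ∈ deg V 0) : G.ann u x = 0 := by
  obtain ⟨c, rfl⟩ := mem_deg_zero.1 hx
  rw [map_smul, ann_one, smul_zero]

variable {G} in
theorem Stable.ann_mem {V : Submodule ℂ W} (hV : G.Stable V) {e : Bool} {u : W} (hu : G.IsHom e u)
    {n : ℕ} : ∀ x ∈ deg V (n + 1), G.ann u x ∈ deg V n := by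
  induction n with
  | zero =>
    refine hV.deg_induction (fun x y hx hy => by rw [map_add]; exact add_mem hx hy) ?_
    intro d w _ hd x hx
    rw [hu.ann_mul hd, G.ann_deg_zero u hx, mul_zero, smul_zero, add_zero]
    exact Submodule.smul_mem _ _ hx
  | succ n ih =>
    refine hV.deg_induction (fun x y hx hy => by rw [map_add]; exact add_mem hx hy) ?_
    intro d w hw hd x hx
    rw [hu.ann_mul hd]
    exact add_mem (Submodule.smul_mem _ _ hx) (Submodule.smul_mem _ _ (mul_mem_deg hw (ih x hx)))

variable {G} in
theorem Stable.ann_mem_pred {V : Submodule ℂ W} (hV : G.Stable V) {e : Bool} {u : W}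
    (hu : G.IsHom e u) {n : ℕ} (x : T W) (hx : x ∈ deg V n) : G.ann u x ∈ deg V (n - 1) := by
  cases n with
  | zero => rw [G.ann_deg_zero u hx]; exact zero_mem _
  | succ n => exact hV.ann_mem hu x hx

theorem isHom_id : G.IsParity false LinearMap.id := fun d w hw => by simpa using hw

variable {G} in
-- The second quantized identity counts factors: it is the number operator, used both for
-- orthogonality of degrees and for positivity.
theorem Stable.der_id {V : Submodule ℂ W} (hV : G.Stable V) {n : ℕ} :
    ∀ x ∈ deg V n, G.der false LinearMap.id x = (n : ℂ) • x := by
  induction n with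
  | zero =>
    intro x hx
    obtain ⟨c, rfl⟩ := mem_deg_zero.1 hx
    simp [der_one]
  | succ n ih =>
    refine hV.deg_induction (fun x y hx hy => by rw [map_add, hx, hy, smul_add]) ?_
    intro d w hw hd x hx
    rw [G.der_mul _ _ hd, ih x hx]
    simp only [sgn, Bool.false_and, Bool.false_eq_true, if_false, LinearMap.id_apply,
      mul_smul_comm]
    push_cast
    module

variable {G} in
-- The number operator is symmetric for the form, so eigenvectors with different eigenvalues are
-- orthogonal.
theorem Stable.form_deg_deg {V : Submodule ℂ W} (hV : G.Stable V) {n k : ℕ} (h : n ≠ k)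
    {x y : T W} (hx : x ∈ deg V n) (hy : y ∈ deg V k) : G.form x y = 0 := by
  have := G.form_der G.isHom_id G.isHom_id (fun _ _ => rfl) x y
  rw [hV.der_id x hx, hV.der_id y hy] at this
  simp only [map_smul, LinearMap.smul_apply, LinearMap.map_smulₛₗ, map_natCast, smul_eq_mul] at this
  have h2 : ((n : ℂ) - k) * G.form x y = 0 := by linear_combination this
  rcases mul_eq_zero.1 h2 with h3 | h3
  · exact absurd (by exact_mod_cast sub_eq_zero.1 h3) h
  · exact h3

/-- A finite family of homogeneous vectors which resolves the form on a subspace. -/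
structure Frame (V : Submodule ℂ W) where
  idx : Type
  fin : Fintype idx
  vec : idx → W
  parity : idx → Bool
  hom : ∀ i, G.IsHom (parity i) (vec i)
  res : ∀ u ∈ V, ∀ v ∈ V, G.s u v = ∑ i, G.s u (vec i) * G.s (vec i) v

attribute [instance] Frame.fin

variable {G} in
-- The frame resolves the form only on `V`. This suffices because annihilation meets an element of
-- `deg V n` only through its factors, which lie in `V`.
theorem Frame.sum_ann {V : Submodule ℂ W} (B : G.Frame V) (hV : G.Stable V) {e : Bool} {u : W}
    (hu : G.IsHom e u) (hu' : u ∈ V) {n : ℕ} :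
    ∀ x ∈ deg V n, ∑ i, G.s u (B.vec i) • G.ann (B.vec i) x = G.ann u x := by
  induction n with
  | zero => intro x hx; simp [G.ann_deg_zero _ hx]
  | succ n ih =>
    refine hV.deg_induction (fun x y hx hy => ?_) ?_
    · rw [map_add, ← hx, ← hy, ← Finset.sum_add_distrib]
      simp only [map_add, smul_add]
    intro d w hw hd x hx
    rw [hu.ann_mul hd, B.res u hu' w hw, ← ih x hx, Finset.sum_smul, Finset.mul_sum,
      Finset.smul_sum, ← Finset.sum_add_distrib]
    refine Finset.sum_congr rfl fun i _ => ?_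
    rw [(B.hom i).ann_mul hd, smul_add, smul_smul, smul_smul, mul_smul_comm, smul_smul,
      mul_comm (sgn e d), hu.s_mul_sgn (B.hom i)]

variable {G} in
-- The number operator equals `∑ a(e_i)* a(e_i)`. The induction exchanges `a(e_i)` with `a(w)` in
-- the second argument, and the sign this produces agrees with the one from the Leibniz rule in the
-- first.
theorem Frame.form_number {V : Submodule ℂ W} (B : G.Frame V) (hV : G.Stable V) {n : ℕ} :
    ∀ x ∈ deg V n, ∀ k, ∀ y ∈ deg V k, G.form (G.der false LinearMap.id x) y
      = ∑ i, G.form (G.ann (B.vec i) x) (G.ann (B.vec i) y) := by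
  induction n with
  | zero =>
    intro x hx k y _
    obtain ⟨c, rfl⟩ := mem_deg_zero.1 hx
    simp [der_one, ann_one]
  | succ n ih =>
    refine hV.deg_induction (fun x y hx hy k z hz => ?_) ?_
    · simp only [map_add, LinearMap.add_apply, hx k z hz, hy k z hz, Finset.sum_add_distrib]
    intro d w hw hd x hx k y hy
    have hs : G.form x (G.ann w y)
        = ∑ i, G.s (B.vec i) w • G.form x (G.ann (B.vec i) y) := by
      rw [← B.sum_ann hV hd hw y hy, map_sum]
      simp only [LinearMap.map_smulₛₗ, G.symm]
    rw [G.der_mul _ _ hd, map_add, LinearMap.add_apply, map_smul, LinearMap.smul_apply, form_mul,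
      form_mul, ih x hx _ _ (hV.ann_mem_pred hd y hy), LinearMap.id_apply, hs,
      Finset.smul_sum, ← Finset.sum_add_distrib]
    refine Finset.sum_congr rfl fun i _ => ?_
    have := LinearMap.congr_fun ((B.hom i).ann_ann hd) y
    simp only [Module.End.mul_apply, LinearMap.smul_apply] at this
    rw [(B.hom i).ann_mul hd, map_add, map_smul, map_smul, LinearMap.add_apply,
      LinearMap.smul_apply, LinearMap.smul_apply, form_mul, this,
      LinearMap.map_smulₛₗ, conj_sgn, smul_smul]
    simp [sgn]

variable {G} in
-- For `x` of degree `n + 1`, `form_number` turns `n + 1` times the square of `x` into a sum of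
-- squares of the vectors `a(e_i) x`, which have degree `n`. This takes the place of the positivity
-- of a symmetrizer.
theorem Frame.form_self_nonneg {V : Submodule ℂ W} (B : G.Frame V) (hV : G.Stable V) {n : ℕ} :
    ∀ x ∈ deg V n, 0 ≤ (G.form x x).re := by
  induction n with
  | zero =>
    intro x hx
    obtain ⟨c, rfl⟩ := mem_deg_zero.1 hx
    simp only [map_smul, LinearMap.smul_apply, LinearMap.map_smulₛₗ, form_one, map_one, smul_eq_mul,
      mul_one]
    rw [mul_comm, Complex.mul_conj]
    exact_mod_cast Complex.normSq_nonneg c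
  | succ n ih =>
    intro x hx
    have h := B.form_number hV x hx _ x hx
    rw [hV.der_id x hx, map_smul, LinearMap.smul_apply] at h
    have h2 : 0 ≤ (((n + 1 : ℕ) : ℂ) • G.form x x).re := by
      rw [h, Complex.re_sum]
      exact Finset.sum_nonneg fun i _ => ih _ (hV.ann_mem (B.hom i) x hx)
    rw [smul_eq_mul, ← Complex.ofReal_natCast, Complex.re_ofReal_mul] at h2
    exact nonneg_of_mul_nonneg_right h2 (by positivity)

/-- The form may be degenerate on `V`, so an orthonormal basis is chosen in the image of `V` in the
Hausdorff quotient and then lifted; null parts do not affect the form. -/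
theorem exists_resolution (V : Submodule ℂ W) [FiniteDimensional ℂ V] :
    ∃ (n : ℕ) (e : Fin n → W), (∀ i, e i ∈ V) ∧
      ∀ u ∈ V, ∀ v ∈ V, G.s u v = ∑ i, G.s u (e i) * G.s (e i) v := by
  let c : PreInnerProductSpace.Core ℂ W :=
    { inner := fun u v => G.s u v
      conj_inner_symm := fun u v => G.symm v u
      re_inner_nonneg := fun u => G.nonneg u
      add_left := fun u v w => by simp
      smul_left := fun u v r => by simp }
  let _ : SeminormedAddCommGroup W := InnerProductSpace.Core.toSeminormedAddCommGroup (c := c)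
  let _ : InnerProductSpace ℂ W := InnerProductSpace.ofCore c
  have hin : ∀ u v : W, inner ℂ u v = G.s u v := fun u v => rfl
  let mk : W →ₗ[ℂ] SeparationQuotient W := (SeparationQuotient.mkCLM ℂ W).toLinearMap
  let b := stdOrthonormalBasis ℂ (V.map mk)
  have hb : ∀ i, ∃ e ∈ V, mk e = b i := fun i => (Submodule.mem_map).1 (b i).2
  choose e he heb using hb
  refine ⟨_, e, he, fun u hu v hv => ?_⟩
  have := b.sum_inner_mul_inner ⟨mk u, Submodule.mem_map_of_mem hu⟩ ⟨mk v, Submodule.mem_map_of_mem hv⟩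
  simp only [Submodule.coe_inner, ← heb] at this
  exact this.symm

/-- Resolving the two parity components separately makes the frame vectors homogeneous; mixed inner
products vanish. -/
theorem exists_frame (V : Submodule ℂ W) [FiniteDimensional ℂ V] : Nonempty (G.Frame V) := by
  choose n e he hr using fun d : Bool => G.exists_resolution (V.map (G.proj d))
  refine ⟨⟨Σ d, Fin (n d), inferInstance, fun i => e i.1 i.2, fun i => i.1, fun i => ?_, ?_⟩⟩
  · obtain ⟨w, _, hw⟩ := he i.1 i.2
    rw [← hw]
    exact G.isHom_proj _ _
  · intro u hu v hv
    have hE : ∀ d i, G.IsHom d (e d i) := fun d i => by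
      obtain ⟨w, _, hw⟩ := he d i
      rw [← hw]
      exact G.isHom_proj _ _
    have h1 : ∀ d i, G.s u (e d i) = G.s (G.proj d u) (e d i) := fun d i => by
      conv_lhs => rw [← G.proj_add_proj u]
      cases d
      · simp [(G.isHom_proj true u).s_eq_zero (hE false i)]
      · simp [(G.isHom_proj false u).s_eq_zero (hE true i)]
    have h2 : ∀ d i, G.s (e d i) v = G.s (e d i) (G.proj d v) := fun d i => by
      conv_lhs => rw [← G.proj_add_proj v]
      cases d
      · simp [(hE false i).s_eq_zero (G.isHom_proj true v)]
      · simp [(hE true i).s_eq_zero (G.isHom_proj false v)]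
    rw [Fintype.sum_sigma]
    simp only [h1, h2]
    rw [Fintype.sum_bool, ← hr true _ (Submodule.mem_map_of_mem hu) _ (Submodule.mem_map_of_mem hv),
      ← hr false _ (Submodule.mem_map_of_mem hu) _ (Submodule.mem_map_of_mem hv)]
    conv_lhs => rw [← G.proj_add_proj u, ← G.proj_add_proj v]
    simp [(G.isHom_proj false u).s_eq_zero (G.isHom_proj true v),
      (G.isHom_proj true u).s_eq_zero (G.isHom_proj false v), add_comm]

theorem deg_mono {V V' : Submodule ℂ W} (h : V ≤ V') (n : ℕ) : deg V n ≤ deg V' n :=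
  pow_le_pow_left' (Submodule.map_mono h) n

/-- An element of the tensor algebra involves finitely many vectors. This confines the positivity
argument to finite-dimensional `V`, where finite frames exist. -/
theorem exists_mem_iSup_deg (x : T W) :
    ∃ V : Submodule ℂ W, FiniteDimensional ℂ V ∧ G.Stable V ∧ x ∈ ⨆ n, deg V n := by
  suffices h : ∃ V : Submodule ℂ W, FiniteDimensional ℂ V ∧ x ∈ ⨆ n, deg V n by
    obtain ⟨V, hV, hx⟩ := h
    refine ⟨V.map (G.proj false) ⊔ V.map (G.proj true), inferInstance, ?_, ?_⟩
    · intro e w hw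
      obtain ⟨_, ⟨a, ha, rfl⟩, _, ⟨b, hb, rfl⟩, rfl⟩ := Submodule.mem_sup.1 hw
      rw [map_add]
      cases e
      · rw [(G.isHom_proj false a).proj, show G.proj false (G.proj true b) = 0 from
          (G.isHom_proj true b).proj_not, add_zero]
        exact Submodule.mem_sup_left (Submodule.mem_map_of_mem ha)
      · rw [(G.isHom_proj true b).proj, show G.proj true (G.proj false a) = 0 from
          (G.isHom_proj false a).proj_not, zero_add]
        exact Submodule.mem_sup_right (Submodule.mem_map_of_mem hb)
    · refine iSup_mono (fun n => deg_mono (fun w hw => ?_) n) hx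
      rw [← G.proj_add_proj w]
      exact add_mem (Submodule.mem_sup_left (Submodule.mem_map_of_mem hw))
        (Submodule.mem_sup_right (Submodule.mem_map_of_mem hw))
  induction x using induction_left with
  | h1 => exact ⟨⊥, inferInstance, Submodule.mem_iSup_of_mem 0 (mem_deg_zero.2 ⟨1, by simp⟩)⟩
  | hadd x y hx hy =>
    obtain ⟨V, _, hx⟩ := hx
    obtain ⟨V', _, hy⟩ := hy
    exact ⟨V ⊔ V', inferInstance, add_mem (iSup_mono (fun n => deg_mono le_sup_left n) hx)
      (iSup_mono (fun n => deg_mono le_sup_right n) hy)⟩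
  | hsmul c x hx =>
    obtain ⟨V, hV, hx⟩ := hx
    exact ⟨V, hV, Submodule.smul_mem _ _ hx⟩
  | hmul w x hx =>
    obtain ⟨V, hV, hx⟩ := hx
    refine ⟨V ⊔ ℂ ∙ w, inferInstance, ?_⟩
    have hx' : x ∈ ⨆ n, deg (V ⊔ ℂ ∙ w) n := iSup_mono (fun n => deg_mono le_sup_left n) hx
    clear hx
    induction hx' using Submodule.iSup_induction' with
    | mem n x hx =>
      exact Submodule.mem_iSup_of_mem (n + 1)
        (mul_mem_deg (Submodule.mem_sup_right (Submodule.mem_span_singleton_self w)) hx)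
    | zero => rw [mul_zero]; exact zero_mem _
    | add x y _ _ hx hy => rw [mul_add]; exact add_mem hx hy

/-- The Fock form is positive. -/
theorem form_nonneg (x : T W) : 0 ≤ (G.form x x).re := by
  obtain ⟨V, _, hV, hx⟩ := G.exists_mem_iSup_deg x
  obtain ⟨B⟩ := G.exists_frame V
  obtain ⟨f, hf, rfl⟩ := (Submodule.mem_iSup_iff_exists_finsupp _ _).1 hx
  rw [Finsupp.sum]
  -- Distinct degrees are orthogonal, so only diagonal terms survive.
  have : G.form (∑ i ∈ f.support, f i) (∑ i ∈ f.support, f i)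
      = ∑ i ∈ f.support, G.form (f i) (f i) := by
    rw [LinearMap.map_sum₂]
    refine Finset.sum_congr rfl fun i hi => ?_
    rw [map_sum]
    exact Finset.sum_eq_single_of_mem i hi fun j _ hj => hV.form_deg_deg hj.symm (hf i) (hf j)
  rw [this, Complex.re_sum]
  exact Finset.sum_nonneg fun i _ => B.form_self_nonneg hV _ (hf i)

end GradedForm

end

end SuperFock

/-! ### The Fock space as a completion, with fields, cyclicity and unitary symmetries. -/

namespace SuperFock

open TensorAlgebra
open scoped ComplexConjugate

noncomputable section

variable {W : Type} [AddCommGroup W] [Module ℂ W]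

namespace GradedForm

variable (G : GradedForm W)

/-- The tensor algebra with the semi-inner product of the Fock space. -/
def Fock (_ : GradedForm W) : Type := T W

instance : AddCommGroup G.Fock := inferInstanceAs (AddCommGroup (T W))

instance : Module ℂ G.Fock := inferInstanceAs (Module ℂ (T W))

/-- The semi-inner product of the Fock space. -/
@[reducible] def core : PreInnerProductSpace.Core ℂ G.Fock where
  -- The arguments are exchanged because `form` is linear in the first one, where `inner` is
  -- antilinear.
  inner x y := G.form y x
  conj_inner_symm _ _ := G.conj_form _ _
  re_inner_nonneg _ := G.form_nonneg _
  add_left x y z := (G.form z).map_add x y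
  smul_left x y r := (G.form y).map_smulₛₗ r x

instance : SeminormedAddCommGroup G.Fock :=
  InnerProductSpace.Core.toSeminormedAddCommGroup (c := G.core)

instance : InnerProductSpace ℂ G.Fock := InnerProductSpace.ofCore G.core

/-- The Fock space. -/
abbrev Hilb : Type := UniformSpace.Completion G.Fock

/-- The vectors of the Fock space given by the tensor algebra. -/
def vec : T W →ₗ[ℂ] G.Hilb :=
  (UniformSpace.Completion.toComplL (𝕜 := ℂ) (E := G.Fock)).toLinearMap

theorem inner_vec (x y : T W) : inner ℂ (G.vec x) (G.vec y) = G.form y x :=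
  UniformSpace.Completion.inner_coe (E := G.Fock) x y

theorem denseRange_vec : DenseRange G.vec :=
  UniformSpace.Completion.denseRange_coe (α := G.Fock)

/-- The domain of the fields. -/
abbrev dom : Submodule ℂ G.Hilb := LinearMap.range G.vec

/-- The vectors of the domain given by the tensor algebra. -/
def dvec : T W →ₗ[ℂ] G.dom := G.vec.rangeRestrict

theorem coe_dvec (x : T W) : (G.dvec x : G.Hilb) = G.vec x := rfl

theorem dvec_surjective : Function.Surjective G.dvec := G.vec.surjective_rangeRestrict

/-- The completion is Hausdorff, so null vectors become zero. The exchange relations of creation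
operators enter through this fact. -/
theorem vec_eq_of_form {x y : T W} (h : ∀ z, G.form x z = G.form y z) : G.vec x = G.vec y := by
  have h0 : inner ℂ (G.vec (x - y)) (G.vec (x - y)) = (0 : ℂ) := by
    have h1 : G.form (x - y) = 0 :=
      LinearMap.ext fun z => by rw [map_sub, LinearMap.sub_apply, h, sub_self]; rfl
    rw [inner_vec, h1]; rfl
  rw [inner_self_eq_zero, map_sub, sub_eq_zero] at h0
  exact h0

theorem dvec_eq_of_form {x y : T W} (h : ∀ z, G.form x z = G.form y z) : G.dvec x = G.dvec y :=
  Subtype.ext (G.vec_eq_of_form h)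

theorem form_eq_of_dvec {x y : T W} (h : G.dvec x = G.dvec y) (z : T W) :
    G.form x z = G.form y z := by
  rw [← inner_vec, ← inner_vec]
  exact congrArg (fun u : G.dom => inner ℂ (G.vec z) (u : G.Hilb)) h

theorem end_ext {A B : Module.End ℂ G.dom} (h : ∀ x, A (G.dvec x) = B (G.dvec x)) : A = B := by
  refine LinearMap.ext fun u => ?_
  obtain ⟨x, rfl⟩ := G.dvec_surjective u
  exact h x

/-- Operators with a formal adjoint. -/
def HasAdj (X : Module.End ℂ (T W)) : Prop :=
  ∃ Y : Module.End ℂ (T W), ∀ x y, G.form (X x) y = G.form x (Y y)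

open Classical in
/-- The operator on the domain given by an operator with a formal adjoint. -/
def op (X : Module.End ℂ (T W)) : Module.End ℂ G.dom :=
  -- A formal adjoint forces null vectors to go to null vectors, so `X` descends to `T W` modulo the
  -- kernel of `dvec`. Operators without one receive the value `0`.
  if h : G.HasAdj X then
    let e := G.dvec.quotKerEquivOfSurjective G.dvec_surjective
    e.toLinearMap ∘ₗ (LinearMap.ker G.dvec).mapQ (LinearMap.ker G.dvec) X (by
      obtain ⟨Y, hY⟩ := h
      intro x hx
      rw [Submodule.mem_comap, LinearMap.mem_ker, ← map_zero G.dvec]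
      refine G.dvec_eq_of_form fun z => ?_
      rw [hY, map_zero, LinearMap.zero_apply, G.form_eq_of_dvec (y := 0) (by simpa using hx)]
      simp) ∘ₗ e.symm.toLinearMap
  else 0

theorem op_dvec {X : Module.End ℂ (T W)} (h : G.HasAdj X) (x : T W) :
    G.op X (G.dvec x) = G.dvec (X x) := by
  simp only [op, dif_pos h, LinearMap.comp_apply, LinearEquiv.coe_coe,
    LinearMap.quotKerEquivOfSurjective_symm_apply]
  rfl

theorem inner_op {X Y : Module.End ℂ (T W)} (h : ∀ x y, G.form (X x) y = G.form x (Y y))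
    (u v : G.dom) : inner ℂ (G.op X u : G.Hilb) (v : G.Hilb) = inner ℂ (u : G.Hilb) (G.op Y v) := by
  have h' : ∀ x y, G.form (Y x) y = G.form x (X y) := fun x y => by
    rw [← G.conj_form, ← h, G.conj_form]
  obtain ⟨x, rfl⟩ := G.dvec_surjective u
  obtain ⟨y, rfl⟩ := G.dvec_surjective v
  rw [op_dvec G ⟨Y, h⟩, op_dvec G ⟨X, h'⟩, coe_dvec, coe_dvec, coe_dvec, coe_dvec, inner_vec,
    inner_vec, h']

/-! ### Fields -/

/-- The field operator which creates `u` and annihilates `v`. -/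
def fieldOp (u v : W) : Module.End ℂ (T W) := LinearMap.mulLeft ℂ (ι ℂ u) + G.ann v

theorem fieldOp_apply (u v : W) (x : T W) : G.fieldOp u v x = ι ℂ u * x + G.ann v x := rfl

/-- Adjunction exchanges creation and annihilation, hence the two vectors. -/
theorem form_fieldOp (u v : W) (x y : T W) :
    G.form (G.fieldOp u v x) y = G.form x (G.fieldOp v u y) := by
  simp only [fieldOp_apply, map_add, LinearMap.add_apply, form_mul, form_mul_right]
  rw [add_comm]

theorem hasAdj_fieldOp (u v : W) : G.HasAdj (G.fieldOp u v) := ⟨_, G.form_fieldOp u v⟩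

theorem fieldOp_add (u v u' v' : W) :
    G.fieldOp (u + u') (v + v') = G.fieldOp u v + G.fieldOp u' v' := by
  refine LinearMap.ext fun x => ?_
  simp only [fieldOp_apply, map_add, LinearMap.add_apply, add_mul]
  exact add_add_add_comm _ _ _ _

theorem fieldOp_smul (c : ℂ) (u v : W) : G.fieldOp (c • u) (conj c • v) = c • G.fieldOp u v := by
  refine LinearMap.ext fun x => ?_
  simp [fieldOp_apply]

theorem fieldOp_zero : G.fieldOp 0 0 = 0 := by
  refine LinearMap.ext fun x => ?_
  simp [fieldOp_apply]

/-- The (anti)commutation relations of the fields. -/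
theorem op_fieldOp_comm {e d : Bool} {u v u' v' : W} (hu : G.IsHom e u) (hv : G.IsHom e v)
    (hu' : G.IsHom d u') (hv' : G.IsHom d v') :
    G.op (G.fieldOp u v) * G.op (G.fieldOp u' v')
        - sgn e d • (G.op (G.fieldOp u' v') * G.op (G.fieldOp u v))
      = (G.s v u' - sgn e d * G.s v' u) • 1 := by
  refine G.end_ext fun x => ?_
  simp only [LinearMap.sub_apply, LinearMap.smul_apply, Module.End.mul_apply, Module.End.one_apply,
    op_dvec G (G.hasAdj_fieldOp _ _), ← map_smul, ← map_sub]
  refine G.dvec_eq_of_form fun z => ?_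
  -- `h1` exchanges the annihilation parts on `x`; `h2` exchanges the creation parts once they have
  -- been moved to the other argument as annihilation operators on `z`.
  have h1 := LinearMap.congr_fun (hv.ann_ann hv') x
  have h2 := LinearMap.congr_fun (hu'.ann_ann hu) z
  simp only [Module.End.mul_apply, LinearMap.smul_apply] at h1 h2
  simp only [fieldOp_apply, map_add, hv.ann_mul hu', hv'.ann_mul hu, map_sub, map_smul,
    LinearMap.add_apply, LinearMap.sub_apply, LinearMap.smul_apply, form_mul, h1, h2,
    LinearMap.map_smulₛₗ, conj_sgn, sgn_comm d e, smul_eq_mul]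
  have := sgn_mul_self e d
  linear_combination (-(G.form (G.ann v' x)) (G.ann u z)) * this

/-- The (anti)commutator of a second quantized operator with a field. -/
theorem der_fieldOp {e d : Bool} {X Y : W →ₗ[ℂ] W} (hX : G.IsParity e X) (hY : G.IsParity e Y)
    (h : ∀ u v, G.s (Y u) v = G.s u (X v)) {u v : W} (hu : G.IsHom d u) (hv : G.IsHom d v) :
    G.der e X * G.fieldOp u v - sgn e d • (G.fieldOp u v * G.der e X)
      = G.fieldOp (X u) (-sgn e d • Y v) := by
  refine LinearMap.ext fun x => ?_
  -- The functional `s v ∘ X` is `s (Y v)`, so the graded commutator with `ann v` annihilates `Y v`.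
  have h1 := LinearMap.congr_fun (G.annLin_der hX (fun c w hw hc => hv.s_eq_zero hw hc.symm)) x
  rw [← hv.ann_eq, show (G.s v).comp X = G.s (Y v) from (LinearMap.ext fun w => h v w).symm,
    ← (hY _ _ hv).ann_eq] at h1
  simp only [Module.End.mul_apply, LinearMap.smul_apply, LinearMap.add_apply] at h1
  simp only [LinearMap.sub_apply, LinearMap.smul_apply, Module.End.mul_apply, fieldOp_apply, map_add,
    G.der_mul e X hu, h1, LinearMap.map_smulₛₗ, map_neg, conj_sgn, smul_add, smul_smul,
    sgn_mul_self, neg_smul, one_smul, LinearMap.neg_apply]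
  abel

theorem hasAdj_der {e : Bool} {X Y : W →ₗ[ℂ] W} (hX : G.IsParity e X) (hY : G.IsParity e Y)
    (h : ∀ u v, G.s (Y u) v = G.s u (X v)) : G.HasAdj (G.der e X) := ⟨_, G.form_der hX hY h⟩

theorem op_der_fieldOp {e d : Bool} {X Y : W →ₗ[ℂ] W} (hX : G.IsParity e X) (hY : G.IsParity e Y)
    (h : ∀ u v, G.s (Y u) v = G.s u (X v)) {u v : W} (hu : G.IsHom d u) (hv : G.IsHom d v) :
    G.op (G.der e X) * G.op (G.fieldOp u v) - sgn e d • (G.op (G.fieldOp u v) * G.op (G.der e X))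
      = G.op (G.fieldOp (X u) (-sgn e d • Y v)) := by
  refine G.end_ext fun x => ?_
  simp only [LinearMap.sub_apply, LinearMap.smul_apply, Module.End.mul_apply,
    op_dvec G (G.hasAdj_fieldOp _ _), op_dvec G (G.hasAdj_der hX hY h)]
  rw [← G.dvec.map_smul, ← map_sub, ← G.der_fieldOp hX hY h hu hv]
  rfl

theorem op_der_der {e d : Bool} {X X' Y Y' : W →ₗ[ℂ] W} (hX : G.IsParity e X)
    (hX' : G.IsParity e X') (h : ∀ u v, G.s (X' u) v = G.s u (X v)) (hY : G.IsParity d Y)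
    (hY' : G.IsParity d Y') (h' : ∀ u v, G.s (Y' u) v = G.s u (Y v)) {Z Z' : W →ₗ[ℂ] W}
    (hZ : G.IsParity (xor e d) Z) (hZ' : G.IsParity (xor e d) Z')
    (hh : ∀ u v, G.s (Z' u) v = G.s u (Z v)) {c : ℂ}
    (hXY : X * Y - sgn e d • (Y * X) = c • Z) :
    G.op (G.der e X) * G.op (G.der d Y) - sgn e d • (G.op (G.der d Y) * G.op (G.der e X))
      = c • G.op (G.der (xor e d) Z) := by
  refine G.end_ext fun x => ?_
  have := LinearMap.congr_fun (G.der_der hX hY) x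
  rw [hXY, map_smul] at this
  simp only [LinearMap.sub_apply, LinearMap.smul_apply, Module.End.mul_apply] at this
  simp only [LinearMap.sub_apply, LinearMap.smul_apply, Module.End.mul_apply,
    op_dvec G (G.hasAdj_der hX hX' h), op_dvec G (G.hasAdj_der hY hY' h'),
    op_dvec G (G.hasAdj_der hZ hZ' hh)]
  rw [← G.dvec.map_smul, ← G.dvec.map_smul, ← map_sub, this]

/-- If the creation parts of a family of fields span the one-particle space, then the vacuum is
cyclic for these fields. -/
theorem cyclic {J : Type*} (c : J → W × W) (hc : ∀ j, ∃ e, G.IsHom e (c j).2)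
    (hspan : Submodule.span ℂ (Set.range fun j => (c j).1) = ⊤) (S : Submodule ℂ G.dom)
    (h1 : G.dvec 1 ∈ S) (hS : ∀ j, ∀ u ∈ S, G.op (G.fieldOp (c j).1 (c j).2) u ∈ S) : S = ⊤ := by
  have hst : G.Stable (⊤ : Submodule ℂ W) := fun _ _ _ => trivial
  -- All degrees up to `n` are treated at once: a field applied to `x` of degree `n` gives `w ⊗ x`
  -- plus an annihilated term of degree `n - 1`, which is already known to lie in `S`.
  have key : ∀ n, ∀ k ≤ n, ∀ x ∈ deg (⊤ : Submodule ℂ W) k, G.dvec x ∈ S := by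
    intro n
    induction n with
    | zero =>
      intro k hk x hx
      rw [Nat.le_zero.1 hk] at hx
      obtain ⟨c, rfl⟩ := mem_deg_zero.1 hx
      rw [map_smul]
      exact S.smul_mem _ h1
    | succ n ih =>
      intro k hk
      rcases Nat.lt_or_ge n k with h | h
      · rw [le_antisymm hk h]
        refine deg_induction (fun x y hx hy => by rw [map_add]; exact add_mem hx hy) ?_
        intro w _ x hx
        have hw : w ∈ Submodule.span ℂ (Set.range fun j => (c j).1) := hspan ▸ trivial
        induction hw using Submodule.span_induction with
        | mem w hw =>
          obtain ⟨j, rfl⟩ := hw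
          obtain ⟨e, he⟩ := hc j
          have h2 := hS j _ (ih n le_rfl x hx)
          rw [op_dvec G (G.hasAdj_fieldOp _ _), fieldOp_apply, map_add] at h2
          exact (S.add_mem_iff_left (ih (n - 1) (Nat.sub_le _ _) _ (hst.ann_mem_pred he x hx))).1 h2
        | zero => simp
        | add w w' _ _ hw hw' => rw [map_add, add_mul, map_add]; exact add_mem (hw trivial) (hw' trivial)
        | smul r w _ hw => rw [map_smul, smul_mul_assoc, map_smul]; exact S.smul_mem _ (hw trivial)
      · exact ih k h
  refine (Submodule.eq_top_iff').2 fun u => ?_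
  obtain ⟨x, rfl⟩ := G.dvec_surjective u
  obtain ⟨V, _, _, hx⟩ := G.exists_mem_iSup_deg x
  induction hx using Submodule.iSup_induction' with
  | mem n x hx => exact key n n le_rfl x (deg_mono le_top n hx)
  | zero => simp
  | add x y _ _ hx hy => rw [map_add]; exact add_mem hx hy

/-! ### Second quantized unitary operators -/

/-- The second quantization of a symmetry. -/
def second (U : W →ₗ[ℂ] W) : T W →ₐ[ℂ] T W := lift ℂ ((ι ℂ).comp U)

theorem second_mul (U : W →ₗ[ℂ] W) (w : W) (x : T W) :
    second U (ι ℂ w * x) = ι ℂ (U w) * second U x := by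
  simp [second]

theorem second_comp (U V : W →ₗ[ℂ] W) : second (U * V) = (second U).comp (second V) := by
  refine TensorAlgebra.hom_ext (LinearMap.ext fun w => ?_)
  simp [second]

theorem second_one : second (1 : W →ₗ[ℂ] W) = AlgHom.id ℂ (T W) := by
  refine TensorAlgebra.hom_ext (LinearMap.ext fun w => ?_)
  simp [second]

theorem algebraMapInv_second (U : W →ₗ[ℂ] W) (x : T W) :
    algebraMapInv (second U x) = algebraMapInv x := by
  have : (algebraMapInv (R := ℂ) (M := W)).comp (second U) = algebraMapInv := by
    refine TensorAlgebra.hom_ext (LinearMap.ext fun w => ?_)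
    simp [second, algebraMapInv]
  exact DFunLike.congr_fun this x

/-- Even operators which preserve the form. -/
structure IsSymm (U : W →ₗ[ℂ] W) : Prop where
  even : G.IsParity false U
  iso : ∀ u v, G.s (U u) (U v) = G.s u v

variable {G} in
theorem IsSymm.hom {U : W →ₗ[ℂ] W} (hU : G.IsSymm U) {e : Bool} {u : W} (hu : G.IsHom e u) :
    G.IsHom e (U u) := by
  simpa using hU.even _ _ hu

variable {G} in
theorem IsSymm.ann {U : W →ₗ[ℂ] W} (hU : G.IsSymm U) {e : Bool} {u : W} (hu : G.IsHom e u)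
    (x : T W) : G.ann (U u) (second U x) = second U (G.ann u x) := by
  induction x using G.induction_hom with
  | h1 => rw [map_one, ann_one, ann_one, map_zero]
  | hadd x y hx hy => simp only [map_add, hx, hy]
  | hsmul c x hx => simp only [map_smul, hx]
  | hmul d w x hw hx =>
    rw [second_mul, (hU.hom hu).ann_mul (hU.hom hw), hu.ann_mul hw, map_add, map_smul, map_smul,
      second_mul, hU.iso, hx]

variable {G} in
theorem IsSymm.form {U : W →ₗ[ℂ] W} (hU : G.IsSymm U) (x y : T W) :
    G.form (second U x) (second U y) = G.form x y := by
  induction x using G.induction_hom generalizing y with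
  | h1 => rw [map_one, form_one, form_one, algebraMapInv_second]
  | hadd x y hx hy => simp only [map_add, LinearMap.add_apply, hx, hy]
  | hsmul c x hx => simp only [map_smul, LinearMap.smul_apply, hx]
  | hmul d w x hw hx => rw [second_mul, form_mul, form_mul, hU.ann hw, hx]

variable {G} in
theorem IsSymm.fieldOp {U : W →ₗ[ℂ] W} (hU : G.IsSymm U) {e : Bool} (u : W) {v : W}
    (hv : G.IsHom e v) (x : T W) :
    second U (G.fieldOp u v x) = G.fieldOp (U u) (U v) (second U x) := by
  rw [fieldOp_apply, fieldOp_apply, map_add, second_mul, hU.ann hv]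

theorem second_der {e : Bool} {U X : W →ₗ[ℂ] W} (hU : G.IsParity false U) {X' : W →ₗ[ℂ] W}
    (h : ∀ w, U (X w) = X' (U w)) (x : T W) :
    second U (G.der e X x) = G.der e X' (second U x) := by
  induction x using G.induction_hom with
  | h1 => rw [der_one, map_zero, map_one (second U), der_one]
  | hadd x y hx hy => simp only [map_add, hx, hy]
  | hsmul c x hx => simp only [map_smul, hx]
  | hmul d w x hw hx =>
    rw [second_mul, G.der_mul _ _ hw, G.der_mul _ _ (by simpa using hU _ _ hw), map_add, map_smul,
      second_mul, second_mul, hx, h]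

variable {Γ : Type} [Group Γ]

theorem second_second_inv (ρ : Γ →* Module.End ℂ W) {g h : Γ} (hgh : g * h = 1) :
    (second (ρ g)).toLinearMap ∘ₗ (second (ρ h)).toLinearMap = LinearMap.id := by
  refine LinearMap.ext fun x => ?_
  have := second_comp (ρ g) (ρ h)
  rw [← map_mul, hgh, map_one, second_one] at this
  exact (DFunLike.congr_fun this x).symm

/-- A second quantized symmetry as an equivalence. -/
def secondEquiv (ρ : Γ →* Module.End ℂ W) (g : Γ) : T W ≃ₗ[ℂ] T W :=
  LinearEquiv.ofLinearMap (second (ρ g)).toLinearMap (second (ρ g⁻¹)).toLinearMap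
    (second_second_inv ρ (mul_inv_cancel g)) (second_second_inv ρ (inv_mul_cancel g))

theorem norm_secondEquiv {ρ : Γ →* Module.End ℂ W} (hρ : ∀ g, G.IsSymm (ρ g)) (g : Γ) (x : T W) :
    ‖G.vec (secondEquiv ρ g x)‖ = ‖G.vec x‖ := by
  have h2 : inner ℂ (G.vec (secondEquiv ρ g x)) (G.vec (secondEquiv ρ g x))
      = inner ℂ (G.vec x) (G.vec x) := by
    rw [inner_vec, inner_vec]
    exact (hρ g).form x x
  rw [inner_self_eq_norm_sq_to_K, inner_self_eq_norm_sq_to_K] at h2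
  norm_cast at h2
  exact (sq_eq_sq₀ (norm_nonneg _) (norm_nonneg _)).1 h2

/-- A second quantized symmetry as a unitary operator. -/
def unitaryEquiv (ρ : Γ →* Module.End ℂ W) (hρ : ∀ g, G.IsSymm (ρ g)) (g : Γ) :
    G.Hilb ≃ₗᵢ[ℂ] G.Hilb :=
  (secondEquiv ρ g).extendOfIsometry G.vec G.vec G.denseRange_vec G.denseRange_vec
    (G.norm_secondEquiv hρ g)

theorem unitaryEquiv_vec (ρ : Γ →* Module.End ℂ W) (hρ : ∀ g, G.IsSymm (ρ g)) (g : Γ) (x : T W) :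
    G.unitaryEquiv ρ hρ g (G.vec x) = G.vec (second (ρ g) x) :=
  LinearEquiv.extendOfIsometry_eq _ _ _ _ _ _ x

theorem isometry_ext {A B : G.Hilb ≃ₗᵢ[ℂ] G.Hilb} (h : ∀ x, A (G.vec x) = B (G.vec x)) : A = B :=
  LinearIsometryEquiv.ext fun v => G.denseRange_vec.induction_on (p := fun v => A v = B v) v
    (isClosed_eq A.continuous B.continuous) h

/-- The unitary representation on the Fock space given by one on the one-particle space. -/
def unitary (ρ : Γ →* Module.End ℂ W) (hρ : ∀ g, G.IsSymm (ρ g)) :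
    Γ →* (G.Hilb ≃ₗᵢ[ℂ] G.Hilb) where
  toFun := G.unitaryEquiv ρ hρ
  map_one' := G.isometry_ext fun x => by
    rw [unitaryEquiv_vec, map_one, second_one]; rfl
  map_mul' g h := G.isometry_ext fun x => by
    rw [unitaryEquiv_vec, map_mul, second_comp]
    refine Eq.trans ?_ (congrArg (G.unitaryEquiv ρ hρ g) (G.unitaryEquiv_vec ρ hρ h x)).symm
    rw [unitaryEquiv_vec]
    rfl

theorem unitary_vec (ρ : Γ →* Module.End ℂ W) (hρ : ∀ g, G.IsSymm (ρ g)) (g : Γ) (x : T W) :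
    G.unitary ρ hρ g (G.vec x) = G.vec (second (ρ g) x) :=
  G.unitaryEquiv_vec ρ hρ g x

theorem unitary_mem (ρ : Γ →* Module.End ℂ W) (hρ : ∀ g, G.IsSymm (ρ g)) (g : Γ) (u : G.dom) :
    G.unitary ρ hρ g u ∈ G.dom := by
  obtain ⟨x, rfl⟩ := G.dvec_surjective u
  exact ⟨_, (G.unitary_vec ρ hρ g x).symm⟩

variable [TopologicalSpace Γ]

/-- By `key`, annihilating a transformed vector gives a finite combination of transformed vectors
with continuous coefficients. Moving the factors of `x` across reduces everything to the constant
term, which does not depend on `g`. -/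
theorem continuous_form_second {ρ : Γ →* Module.End ℂ W} (hρ : ∀ g, G.IsSymm (ρ g))
    (hc : ∀ u w, Continuous fun g => G.s u (ρ g w)) (x y : T W) :
    Continuous fun g => G.form (second (ρ g) y) x := by
  have key : ∀ (e : Bool) (u : W), G.IsHom e u → ∀ y : T W, ∃ (n : ℕ) (f : Fin n → Γ → ℂ)
      (z : Fin n → T W), (∀ i, Continuous (f i)) ∧
      ∀ g, G.ann u (second (ρ g) y) = ∑ i, f i g • second (ρ g) (z i) := by
    intro e u hu y
    induction y using G.induction_hom with
    | h1 => exact ⟨0, Fin.elim0, Fin.elim0, fun i => i.elim0, fun g => by simp [ann_one]⟩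
    | hadd y y' hy hy' =>
      obtain ⟨n, f, z, hf, hz⟩ := hy
      obtain ⟨n', f', z', hf', hz'⟩ := hy'
      refine ⟨n + n', Fin.append f f', Fin.append z z', ?_, fun g => ?_⟩
      · intro i
        refine Fin.addCases (fun i => ?_) (fun i => ?_) i
        · simpa using hf i
        · simpa using hf' i
      · rw [map_add, map_add, hz, hz', Fin.sum_univ_add]
        simp
    | hsmul c y hy =>
      obtain ⟨n, f, z, hf, hz⟩ := hy
      refine ⟨n, fun i g => c * f i g, z, fun i => continuous_const.mul (hf i), fun g => ?_⟩
      rw [map_smul, map_smul, hz, Finset.smul_sum]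
      simp only [smul_smul]
    | hmul d w y hw hy =>
      obtain ⟨n, f, z, hf, hz⟩ := hy
      refine ⟨n + 1, Fin.cons (fun g => G.s u (ρ g w)) f,
        Fin.cons y fun i => sgn e d • (ι ℂ w * z i), ?_, fun g => ?_⟩
      · intro i
        refine Fin.cases ?_ (fun i => ?_) i
        · simpa using hc u w
        · simpa using hf i
      · rw [second_mul, hu.ann_mul ((hρ g).hom hw), hz, Fin.sum_univ_succ]
        simp [second_mul, Finset.mul_sum, Finset.smul_sum, smul_smul, mul_comm]
  induction x using G.induction_hom generalizing y with
  | h1 =>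
    have : ∀ g, G.form (second (ρ g) y) 1 = G.form y 1 := fun g => by
      conv_lhs => rw [← map_one (second (ρ g)), (hρ g).form]
    simp only [this]
    exact continuous_const
  | hadd x x' hx hx' =>
    simp only [map_add]
    exact (hx y).add (hx' y)
  | hsmul c x hx =>
    simp only [LinearMap.map_smulₛₗ]
    exact continuous_const.mul (hx y)
  | hmul d w x hw hx =>
    obtain ⟨n, f, z, hf, hz⟩ := key d w hw y
    have : ∀ g, G.form (second (ρ g) y) (ι ℂ w * x) = ∑ i, f i g * G.form (second (ρ g) (z i)) x := by
      intro g
      rw [form_mul_right, hz, map_sum, LinearMap.sum_apply]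
      simp
    simp only [this]
    exact continuous_finsetSum _ fun i _ => (hf i).mul (hx (z i))

/-- Weak continuity on the one-particle space gives strong continuity on the Fock space. -/
theorem continuous_unitary {ρ : Γ →* Module.End ℂ W} (hρ : ∀ g, G.IsSymm (ρ g))
    (hc : ∀ u w, Continuous fun g => G.s u (ρ g w)) (v : G.Hilb) :
    Continuous fun g => G.unitary ρ hρ g v := by
  have hx : ∀ x, Continuous fun g => G.unitary ρ hρ g (G.vec x) := by
    intro x
    rw [continuous_iff_continuousAt]
    intro g₀
    rw [ContinuousAt, tendsto_iff_norm_sub_tendsto_zero]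
    -- By unitarity the squared distance is `2‖x‖²` minus twice the real part of a matrix element,
    -- so weak continuity suffices.
    have h1 : Continuous fun g => ‖G.unitary ρ hρ g (G.vec x) - G.unitary ρ hρ g₀ (G.vec x)‖ ^ 2 := by
      have : ∀ g, ‖G.unitary ρ hρ g (G.vec x) - G.unitary ρ hρ g₀ (G.vec x)‖ ^ 2
          = ‖G.vec x‖ ^ 2 - 2 * (G.form (second (ρ g) x) (second (ρ g₀) x)).re + ‖G.vec x‖ ^ 2 := by
        intro g
        rw [@norm_sub_sq ℂ, LinearIsometryEquiv.norm_map, LinearIsometryEquiv.norm_map,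
          unitary_vec, unitary_vec, inner_vec, ← G.conj_form]
        simp
      simp only [this]
      exact (continuous_const.sub (continuous_const.mul
        (Complex.continuous_re.comp (G.continuous_form_second hρ hc _ x)))).add continuous_const
    have h2 := (h1.tendsto g₀).sqrt
    simpa using h2
  rw [continuous_iff_continuousAt]
  intro g₀
  rw [Metric.continuousAt_iff']
  intro ε hε
  -- A general vector is approximated by one of the domain, uniformly in `g` since the operators are
  -- isometries.
  obtain ⟨_, ⟨x, rfl⟩, hxv⟩ := Metric.mem_closure_iff.1 (G.denseRange_vec v) (ε / 3) (by positivity)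
  filter_upwards [Metric.continuousAt_iff'.1 (hx x).continuousAt (ε / 3) (by positivity)] with g hg
  have e1 : ∀ g, dist (G.unitary ρ hρ g v) (G.unitary ρ hρ g (G.vec x)) < ε / 3 := fun g => by
    rwa [LinearIsometryEquiv.dist_map]
  calc dist (G.unitary ρ hρ g v) (G.unitary ρ hρ g₀ v)
      ≤ dist (G.unitary ρ hρ g v) (G.unitary ρ hρ g (G.vec x))
        + dist (G.unitary ρ hρ g (G.vec x)) (G.unitary ρ hρ g₀ (G.vec x))
        + dist (G.unitary ρ hρ g₀ (G.vec x)) (G.unitary ρ hρ g₀ v) := dist_triangle4 _ _ _ _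
    _ < ε / 3 + ε / 3 + ε / 3 := by
        refine add_lt_add (add_lt_add (e1 g) hg) ?_
        rw [dist_comm]
        exact e1 g₀
    _ = ε := by ring

end GradedForm

end

end SuperFock

/-! ### Fourier transforms of test functions on the mass shell. -/

namespace Hyper

noncomputable section

open scoped FourierTransform ComplexConjugate

/-- Three-dimensional momentum space. -/
abbrev Mom : Type := EuclideanSpace ℝ (Fin 3)

theorem energy_nonneg (m : ℝ) (p : Mom) : 0 ≤ energy m p := Real.sqrt_nonneg _

theorem energy_sq (m : ℝ) (p : Mom) : energy m p ^ 2 = m ^ 2 + ‖p‖ ^ 2 :=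
  Real.sq_sqrt (by positivity)

theorem norm_le_energy (m : ℝ) (p : Mom) : ‖p‖ ≤ energy m p :=
  Real.le_sqrt_of_sq_le (by nlinarith [sq_nonneg m])

theorem continuous_energy (m : ℝ) : Continuous (energy m) := by
  unfold energy; fun_prop

/-- The covariant components `p_μ` of the four-momentum on the mass shell. -/
def kcov (m : ℝ) (p : Mom) : Fin 4 → ℝ := Fin.cons (energy m p) fun i => -p i

theorem kcov_zero (m : ℝ) (p : Mom) : kcov m p 0 = energy m p := rfl

theorem kcov_succ (m : ℝ) (p : Mom) (i : Fin 3) : kcov m p i.succ = -p i := rfl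

theorem kcov_sq (m : ℝ) (p : Mom) :
    kcov m p 0 ^ 2 - kcov m p 1 ^ 2 - kcov m p 2 ^ 2 - kcov m p 3 ^ 2 = m ^ 2 := by
  have h := energy_sq m p
  rw [EuclideanSpace.norm_sq_eq, Fin.sum_univ_three] at h
  simp only [Real.norm_eq_abs, sq_abs] at h
  change energy m p ^ 2 - (-p 0) ^ 2 - (-p 1) ^ 2 - (-p 2) ^ 2 = m ^ 2
  linarith

theorem continuous_kcov (m : ℝ) (μ : Fin 4) : Continuous fun p => kcov m p μ := by
  refine Fin.cases ?_ (fun i => ?_) μ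
  · exact continuous_energy m
  · simp only [kcov_succ]; fun_prop

theorem shellDot_eq (m : ℝ) (p : Mom) (x : Spacetime) :
    shellDot m p x = ∑ μ, kcov m p μ * x μ := by
  simp [shellDot, Fin.sum_univ_succ, kcov, sub_eq_add_neg]

/-- The point at which the Fourier transform gives the mass-shell transform. -/
def shellPt (m s : ℝ) (p : Mom) : Spacetime :=
  WithLp.toLp 2 fun μ => -(s * kcov m p μ) / (2 * Real.pi)

theorem shellPt_apply (m s : ℝ) (p : Mom) (μ : Fin 4) :
    shellPt m s p μ = -(s * kcov m p μ) / (2 * Real.pi) := rfl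

/-- Up to the `2π` convention the mass-shell transform is the Fourier transform evaluated on a
hyperboloid. Continuity, decay and the derivative rule are inherited from Schwartz functions through
this identity. -/
theorem shellTransform_eq (m s : ℝ) (F : TestFn) (p : Mom) :
    shellTransform m s F p = 𝓕 F (shellPt m s p) := by
  rw [fourier_coe, Real.fourier_eq', shellTransform]
  refine integral_congr_ae (Filter.Eventually.of_forall fun x => ?_)
  simp only [smul_eq_mul]
  congr 2
  rw [PiLp.inner_apply, shellDot_eq, Finset.mul_sum, Finset.mul_sum, ofReal_sum, ofReal_sum,
    Finset.mul_sum, Finset.sum_mul]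
  refine Finset.sum_congr rfl fun μ _ => ?_
  simp only [shellPt_apply, RCLike.inner_apply, conj_trivial]
  have : (Real.pi : ℂ) ≠ 0 := by exact_mod_cast Real.pi_ne_zero
  push_cast
  field_simp

theorem continuous_shellPt (m s : ℝ) : Continuous (shellPt m s) := by
  unfold shellPt
  refine (PiLp.continuous_toLp 2 _).comp (continuous_pi fun μ => ?_)
  exact ((continuous_const.mul (continuous_kcov m μ)).neg).div_const _

theorem continuous_shellTransform (m s : ℝ) (F : TestFn) : Continuous (shellTransform m s F) := by
  simp only [funext (shellTransform_eq m s F)]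
  exact (𝓕 F).continuous.comp (continuous_shellPt m s)

theorem norm_shellTransform_le (m s : ℝ) (F : TestFn) (p : Mom) :
    ‖shellTransform m s F p‖ ≤ ‖F.toLp 1‖ := by
  rw [shellTransform_eq]
  exact norm_fourier_apply_le_toLp_one F _

theorem shellTransform_add (m s : ℝ) (F G : TestFn) (p : Mom) :
    shellTransform m s (F + G) p = shellTransform m s F p + shellTransform m s G p := by
  simp only [shellTransform_eq, FourierTransform.fourier_add, add_apply]

theorem shellTransform_smul (m s : ℝ) (c : ℂ) (F : TestFn) (p : Mom) :
    shellTransform m s (c • F) p = c * shellTransform m s F p := by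
  simp only [shellTransform_eq, FourierTransform.fourier_smul, smul_apply, smul_eq_mul]

theorem shellTransform_pd (m s : ℝ) (μ : Fin 4) (F : TestFn) (p : Mom) :
    shellTransform m s (pd μ F) p = -(I * s * kcov m p μ) * shellTransform m s F p := by
  rw [shellTransform_eq, shellTransform_eq, pd, SchwartzMap.fourier_lineDerivOp_eq,
    smul_apply, SchwartzMap.smulLeftCLM_apply_apply (by fun_prop)]
  have : (Real.pi : ℂ) ≠ 0 := by exact_mod_cast Real.pi_ne_zero
  rw [EuclideanSpace.inner_single_right, shellPt_apply]
  simp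
  field_simp

/-- The mass-shell transform decays rapidly. -/
theorem exists_shellTransform_bound (m : ℝ) {s : ℝ} (hs : s ^ 2 = 1) (F : TestFn) (n : ℕ) :
    ∃ C : ℝ, 0 ≤ C ∧ ∀ p, (1 + ‖p‖) ^ n * ‖shellTransform m s F p‖ ≤ C := by
  obtain ⟨C, hC⟩ : ∃ C : ℝ, ∀ ξ, (1 + ‖ξ‖) ^ n * ‖𝓕 F ξ‖ ≤ C :=
    ⟨_, fun ξ => by
      simpa using one_add_le_sup_seminorm_apply (𝕜 := ℂ) (m := (n, 0)) le_rfl le_rfl (𝓕 F) ξ⟩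
  have hC0 : 0 ≤ C := le_trans (by positivity) (hC 0)
  refine ⟨(2 * Real.pi) ^ n * C, by positivity, fun p => ?_⟩
  -- The spatial part of `shellPt m s p` is `s p / 2π`, and the energy component can only increase
  -- the norm.
  have h1 : ‖p‖ ≤ 2 * Real.pi * ‖shellPt m s p‖ := by
    have h2 : ‖p‖ ^ 2 ≤ (2 * Real.pi * ‖shellPt m s p‖) ^ 2 := by
      rw [mul_pow, EuclideanSpace.norm_sq_eq, EuclideanSpace.norm_sq_eq,
        Fin.sum_univ_succ fun i => ‖shellPt m s p i‖ ^ 2, mul_add, Finset.mul_sum]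
      refine le_add_of_nonneg_of_le (by positivity) (Finset.sum_le_sum fun i _ => le_of_eq ?_)
      rw [shellPt_apply, kcov_succ]
      have := Real.pi_pos
      simp only [Real.norm_eq_abs, sq_abs]
      field_simp
      linear_combination (-(p i) ^ 2) * hs
    exact (le_abs_self _).trans (abs_le_of_sq_le_sq h2 (by positivity))
  have h2 : 1 + ‖p‖ ≤ 2 * Real.pi * (1 + ‖shellPt m s p‖) := by
    nlinarith [Real.pi_gt_three]
  calc (1 + ‖p‖) ^ n * ‖shellTransform m s F p‖
      ≤ (2 * Real.pi * (1 + ‖shellPt m s p‖)) ^ n * ‖𝓕 F (shellPt m s p)‖ := by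
        rw [shellTransform_eq]; gcongr
    _ = (2 * Real.pi) ^ n * ((1 + ‖shellPt m s p‖) ^ n * ‖𝓕 F (shellPt m s p)‖) := by
        rw [mul_pow, mul_assoc]
    _ ≤ _ := by gcongr; exact hC _

/-- The complex conjugate of a test function. -/
def conjFn (F : TestFn) : TestFn where
  toFun x := conj (F x)
  smooth' := by
    have : ContDiff ℝ (⊤ : ℕ∞) F := F.smooth _
    exact Complex.conjCLE.contDiff.comp this
  decay' k n := by
    obtain ⟨C, -, hC⟩ := F.decay k n
    refine ⟨C, fun x => ?_⟩
    have := Complex.conjLIE.norm_iteratedFDeriv_comp_left (𝕜 := ℝ) (F := ℂ) (f := F) (x := x)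
      (i := n)
    rw [show (fun x => conj (F x)) = Complex.conjLIE ∘ F from rfl, this]
    exact hC x

theorem conjFn_apply (F : TestFn) (x : Spacetime) : conjFn F x = conj (F x) := rfl

theorem conjFn_conjFn (F : TestFn) : conjFn (conjFn F) = F := by
  ext x; simp [conjFn_apply]

theorem conjFn_add (F G : TestFn) : conjFn (F + G) = conjFn F + conjFn G := by
  ext x; simp [conjFn_apply]

theorem conjFn_smul (c : ℂ) (F : TestFn) : conjFn (c • F) = conj c • conjFn F := by
  ext x; simp [conjFn_apply]

theorem shellTransform_conjFn (m s : ℝ) (F : TestFn) (p : Mom) :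
    shellTransform m s (conjFn F) p = conj (shellTransform m (-s) F p) := by
  rw [shellTransform, shellTransform, ← integral_conj]
  refine integral_congr_ae (Filter.Eventually.of_forall fun x => ?_)
  simp only [map_mul, conjFn_apply, ← Complex.exp_conj, conj_I, conj_ofReal]
  push_cast
  ring_nf

theorem pd_conjFn (μ : Fin 4) (F : TestFn) : pd μ (conjFn F) = conjFn (pd μ F) := by
  ext x
  rw [conjFn_apply, pd, pd, SchwartzMap.lineDerivOp_apply_eq_fderiv,
    SchwartzMap.lineDerivOp_apply_eq_fderiv]
  have h : HasFDerivAt (⇑(conjFn F)) (Complex.conjCLE.toContinuousLinearMap.comp (fderiv ℝ F x)) x :=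
    Complex.conjCLE.toContinuousLinearMap.hasFDerivAt.comp x F.differentiableAt.hasFDerivAt
  rw [h.fderiv]
  rfl

/-! ### The invariant measure on the mass shell -/

/-- The invariant measure `d³p / (2 ω(p))` on the mass shell. -/
def shellMeasure (m : ℝ) : Measure Mom :=
  volume.withDensity fun p => ENNReal.ofReal (1 / (2 * energy m p))

theorem measurable_density (m : ℝ) :
    Measurable fun p : Mom => ENNReal.ofReal (1 / (2 * energy m p)) := by
  have := (continuous_energy m).measurable
  fun_prop

theorem integral_shellMeasure (m : ℝ) (g : Mom → ℂ) :
    ∫ p, g p ∂shellMeasure m = ∫ p, ((1 / (2 * energy m p) : ℝ) : ℂ) * g p := by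
  rw [shellMeasure, integral_withDensity_eq_integral_toReal_smul (measurable_density m)
    (Filter.Eventually.of_forall fun p => ENNReal.ofReal_lt_top)]
  refine integral_congr_ae (Filter.Eventually.of_forall fun p => ?_)
  have := energy_nonneg m p
  simp only
  rw [ENNReal.toReal_ofReal (by positivity), Complex.real_smul]

theorem integrable_shellMeasure_iff (m : ℝ) (g : Mom → ℂ) :
    Integrable g (shellMeasure m)
      ↔ Integrable (fun p => ((1 / (2 * energy m p) : ℝ) : ℂ) * g p) := by
  rw [shellMeasure, integrable_withDensity_iff_integrable_smul' (measurable_density m)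
    (Filter.Eventually.of_forall fun p => ENNReal.ofReal_lt_top)]
  refine integrable_congr (Filter.Eventually.of_forall fun p => ?_)
  have := energy_nonneg m p
  simp only
  rw [ENNReal.toReal_ofReal (by positivity), Complex.real_smul]

/-- A majorant that works for every mass, including `m = 0`: in three dimensions the radial factor
`r²` absorbs the singularity `1 / r` of the massless density. -/
theorem integrable_inv_norm_mul :
    Integrable fun p : Mom => (1 / (2 * ‖p‖)) * ((1 + ‖p‖) ^ 4)⁻¹ := by
  have h := integrable_fun_norm_addHaar (volume : Measure Mom)
    (f := fun r : ℝ => (1 / (2 * r)) * ((1 + r) ^ 4)⁻¹)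
  refine h.2 ?_
  have h2 : Integrable fun r : ℝ => (1 + ‖r‖) ^ (-2 : ℝ) :=
    integrable_one_add_norm (by simp)
  refine Integrable.mono' h2.integrableOn ?_ ?_
  · refine (ContinuousOn.aestronglyMeasurable ?_ measurableSet_Ioi)
    intro r hr
    have hr' : (0 : ℝ) < r := hr
    refine ContinuousAt.continuousWithinAt ?_
    have h3 : (1 + r) ^ 4 ≠ 0 := by positivity
    have h4 : 2 * r ≠ 0 := by positivity
    fun_prop (disch := assumption)
  · filter_upwards [self_mem_ae_restrict measurableSet_Ioi] with r hr
    have hr' : (0 : ℝ) < r := hr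
    rw [finrank_euclideanSpace, Fintype.card_fin, Real.rpow_neg (by positivity), Real.rpow_two,
      Real.norm_of_nonneg (by simp only [smul_eq_mul]; positivity), Real.norm_of_nonneg hr'.le,
      smul_eq_mul]
    rw [show r ^ (3 - 1) * (1 / (2 * r) * ((1 + r) ^ 4)⁻¹) = (r / 2) / (1 + r) ^ 4 by
      field_simp, ← one_div, div_le_div_iff₀ (by positivity) (by positivity)]
    nlinarith [mul_pos hr' hr', sq_nonneg (1 + r), mul_pos (mul_pos hr' hr') hr', pow_pos hr' 4]

theorem integrable_shellMeasure_of_bound {m : ℝ} {g : Mom → ℂ}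
    (hg : AEStronglyMeasurable g volume) {C : ℝ}
    (hC : ∀ p, (1 + ‖p‖) ^ 4 * ‖g p‖ ≤ C) : Integrable g (shellMeasure m) := by
  rw [integrable_shellMeasure_iff]
  refine (integrable_inv_norm_mul.mul_const C).mono' ?_ ?_
  · refine AEStronglyMeasurable.mul ?_ hg
    have := (continuous_energy m).measurable
    exact (by fun_prop : Measurable _).aestronglyMeasurable
  -- The comparison `1 / 2ω ≤ 1 / 2‖p‖` needs `p ≠ 0`; the origin is a null set.
  · have h0 : ∀ᵐ p : Mom, p ≠ 0 := by simp [ae_iff]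
    filter_upwards [h0] with p hp
    have hp' : 0 < ‖p‖ := norm_pos_iff.2 hp
    have h1 := norm_le_energy m p
    have h2 := energy_nonneg m p
    rw [norm_mul, norm_real, Real.norm_of_nonneg (by positivity), mul_assoc]
    gcongr
    rw [inv_mul_eq_div, le_div_iff₀ (by positivity), mul_comm]
    exact hC p

theorem integrable_shellTransform_mul (m : ℝ) {s t : ℝ} (hs : s ^ 2 = 1) (ht : t ^ 2 = 1)
    (F G : TestFn) :
    Integrable (fun p => shellTransform m s F p * shellTransform m t G p) (shellMeasure m) := by
  obtain ⟨C, hC0, hC⟩ := exists_shellTransform_bound m hs F 4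
  obtain ⟨D, hD0, hD⟩ := exists_shellTransform_bound m ht G 0
  refine integrable_shellMeasure_of_bound (C := C * D) ((continuous_shellTransform m s F).mul
    (continuous_shellTransform m t G)).aestronglyMeasurable fun p => ?_
  rw [norm_mul, ← mul_assoc]
  have h2 := hD p
  rw [pow_zero, one_mul] at h2
  exact mul_le_mul (hC p) h2 (norm_nonneg _) hC0

theorem pauliJordan_eq (m : ℝ) (F G : TestFn) :
    pauliJordan m F G = I / ((2 * Real.pi : ℝ) : ℂ) ^ 3 *
      (∫ p, shellTransform m (-1) F p * shellTransform m 1 G p ∂shellMeasure m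
        - ∫ p, shellTransform m 1 F p * shellTransform m (-1) G p ∂shellMeasure m) := by
  rw [pauliJordan, ← integral_sub (integrable_shellTransform_mul m (by norm_num) (by norm_num) F G)
    (integrable_shellTransform_mul m (by norm_num) (by norm_num) F G), integral_shellMeasure]

end

end Hyper

namespace Hyper

noncomputable section

open scoped FourierTransform ComplexConjugate Matrix

/-! ### Lorentz transformations -/

theorem slash_eq (x : Spacetime) :
    slash x = !![(x 0 : ℂ) - x 3, -x 1 + I * x 2; -x 1 - I * x 2, (x 0 : ℂ) + x 3] := by
  simp only [slash, pauli, Fin.sum_univ_three]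
  ext i j
  fin_cases i <;> fin_cases j <;> simp [Matrix.sub_apply, Matrix.smul_apply] <;> ring

theorem slash_injective : Function.Injective slash := by
  intro x y h
  rw [slash_eq, slash_eq] at h
  have h00 := congrFun (congrFun h 0) 0
  have h11 := congrFun (congrFun h 1) 1
  have h01 := congrFun (congrFun h 0) 1
  simp only [Matrix.of_apply, Matrix.cons_val', Matrix.cons_val_zero, Matrix.cons_val_one,
    Matrix.cons_val_fin_one] at h00 h11 h01
  have a := congrArg Complex.re h00
  have b := congrArg Complex.re h11
  have c := congrArg Complex.re h01
  have d := congrArg Complex.im h01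
  simp at a b c d
  ext μ
  fin_cases μ
  · change x 0 = y 0; linarith
  · exact c
  · exact d
  · change x 3 = y 3; linarith

theorem slash_isHermitian (x : Spacetime) : (slash x).IsHermitian := by
  rw [slash_eq]
  ext i j
  fin_cases i <;> fin_cases j <;> simp [Matrix.conjTranspose_apply] <;> ring

theorem slash_of_isHermitian {X : Matrix (Fin 2) (Fin 2) ℂ} (hX : X.IsHermitian) :
    slash (WithLp.toLp 2 fun μ => (if μ = 0 then 1 else -1 : ℝ) * ((pauli μ * X).trace).re / 2) = X := by
  have h00 := congrArg Complex.im (hX.apply 0 0)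
  have h11 := congrArg Complex.im (hX.apply 1 1)
  have h10 := congrArg Complex.re (hX.apply 0 1)
  have h10' := congrArg Complex.im (hX.apply 0 1)
  simp at h00 h11 h10 h10'
  rw [slash_eq]
  ext i j
  fin_cases i <;> fin_cases j <;> (apply Complex.ext) <;>
    simp [pauli, Matrix.trace_fin_two, Matrix.vecMul, dotProduct, Fin.sum_univ_two] <;> linarith

/-- The trace formula inverts `slash` on Hermitian matrices. With `slash_injective`, statements on
`lorentz` become statements on `X ↦ A X Aᴴ`. -/
theorem slash_lorentz (A : SL2C) (x : Spacetime) :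
    slash (lorentz A x) = A.1 * slash x * A.1ᴴ :=
  slash_of_isHermitian (Matrix.isHermitian_mul_mul_conjTranspose _ (slash_isHermitian x))

theorem slash_add (x y : Spacetime) : slash (x + y) = slash x + slash y := by
  rw [slash_eq, slash_eq, slash_eq]
  ext i j
  fin_cases i <;> fin_cases j <;> simp <;> ring

theorem slash_smul (c : ℝ) (x : Spacetime) : slash (c • x) = (c : ℂ) • slash x := by
  rw [slash_eq, slash_eq]
  ext i j
  fin_cases i <;> fin_cases j <;> simp <;> ring

theorem lorentz_one (x : Spacetime) : lorentz 1 x = x :=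
  slash_injective (by rw [slash_lorentz]; simp)

theorem lorentz_mul (A B : SL2C) (x : Spacetime) : lorentz (A * B) x = lorentz A (lorentz B x) :=
  slash_injective (by
    simp only [slash_lorentz, Matrix.SpecialLinearGroup.coe_mul, Matrix.conjTranspose_mul,
      Matrix.mul_assoc])

theorem lorentz_add (A : SL2C) (x y : Spacetime) :
    lorentz A (x + y) = lorentz A x + lorentz A y :=
  slash_injective (by simp only [slash_lorentz, slash_add, Matrix.mul_add, Matrix.add_mul])

theorem lorentz_smul (A : SL2C) (c : ℝ) (x : Spacetime) : lorentz A (c • x) = c • lorentz A x :=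
  slash_injective (by simp only [slash_lorentz, slash_smul, Matrix.mul_smul, Matrix.smul_mul])

/-- Lorentz transformations as linear equivalences. -/
def lorentzEquiv (A : SL2C) : Spacetime ≃L[ℝ] Spacetime :=
  LinearEquiv.toContinuousLinearEquiv
    { toFun := lorentz A
      invFun := lorentz A⁻¹
      map_add' := lorentz_add A
      map_smul' := lorentz_smul A
      left_inv := fun x => by rw [← lorentz_mul, inv_mul_cancel, lorentz_one]
      right_inv := fun x => by rw [← lorentz_mul, mul_inv_cancel, lorentz_one] }

/-- The Minkowski product. -/
def mink (x y : Spacetime) : ℝ := x 0 * y 0 - x 1 * y 1 - x 2 * y 2 - x 3 * y 3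

theorem det_slash (x : Spacetime) : (slash x).det = (mink x x : ℝ) := by
  rw [slash_eq, Matrix.det_fin_two_of, mink]
  push_cast
  linear_combination (x 2 : ℂ) ^ 2 * I_sq

/-- The Minkowski square is the determinant of `slash x`, and `A` has determinant one. -/
theorem mink_lorentz_self (A : SL2C) (x : Spacetime) :
    mink (lorentz A x) (lorentz A x) = mink x x := by
  have h := det_slash (lorentz A x)
  rw [slash_lorentz, Matrix.det_mul, Matrix.det_mul, Matrix.det_conjTranspose, A.2, det_slash] at h
  simp only [star_one, one_mul, mul_one] at h
  exact_mod_cast h.symm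

theorem mink_lorentz (A : SL2C) (x y : Spacetime) :
    mink (lorentz A x) (lorentz A y) = mink x y := by
  have h1 := mink_lorentz_self A x
  have h2 := mink_lorentz_self A y
  have h3 := mink_lorentz_self A (x + y)
  rw [lorentz_add] at h3
  simp only [mink, PiLp.add_apply] at h1 h2 h3 ⊢
  linarith

/-- The metric as a linear map. -/
def metricMap : Spacetime →ₗ[ℝ] Spacetime where
  toFun x := !₂[x 0, -x 1, -x 2, -x 3]
  map_add' x y := by ext μ; fin_cases μ <;> simp <;> ring
  map_smul' c x := by ext μ; fin_cases μ <;> simp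

theorem mink_eq_inner (x y : Spacetime) : mink x y = inner ℝ (metricMap x) y := by
  simp [mink, metricMap, PiLp.inner_apply, Fin.sum_univ_four]
  ring

/-- Invariance of the metric reads `Lᵀ g L = g`, so `(det L)² = 1`; the sign is irrelevant for
Lebesgue measure. -/
theorem abs_det_lorentz (A : SL2C) :
    |LinearMap.det (lorentzEquiv A).toLinearEquiv.toLinearMap| = 1 := by
  set L := (lorentzEquiv A).toLinearEquiv.toLinearMap with hL
  have h1 : (LinearMap.adjoint L) ∘ₗ metricMap ∘ₗ L = metricMap := by
    refine LinearMap.ext fun x => ext_inner_right ℝ fun y => ?_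
    rw [LinearMap.comp_apply, LinearMap.adjoint_inner_left, LinearMap.comp_apply,
      ← mink_eq_inner, ← mink_eq_inner]
    exact mink_lorentz A x y
  have h2 : metricMap ∘ₗ metricMap = LinearMap.id := by
    refine LinearMap.ext fun x => ?_
    ext μ
    fin_cases μ <;> simp [metricMap]
  have h3 := congrArg LinearMap.det h2
  rw [LinearMap.det_comp, LinearMap.det_id] at h3
  have h4 : LinearMap.det metricMap ≠ 0 := fun h => by simp [h] at h3
  have h5 := congrArg LinearMap.det h1
  have h6 : LinearMap.det (LinearMap.adjoint L) = LinearMap.det L := by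
    let b := (EuclideanSpace.basisFun (Fin 4) ℝ)
    rw [← LinearMap.det_toMatrix b.toBasis, ← LinearMap.det_toMatrix b.toBasis,
      LinearMap.toMatrix_adjoint b b, Matrix.det_conjTranspose]
    simp
  rw [LinearMap.det_comp, LinearMap.det_comp, h6] at h5
  have h7 : LinearMap.det L * LinearMap.det L = 1 := by
    apply mul_right_cancel₀ h4
    linear_combination h5
  rcases mul_self_eq_one_iff.1 h7 with h | h <;> rw [h] <;> simp

theorem measurePreserving_lorentz (A : SL2C) :
    MeasurePreserving (lorentz A) (volume : Measure Spacetime) volume := by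
  refine ⟨(lorentzEquiv A).continuous.measurable, ?_⟩
  have h := Measure.map_linearMap_addHaar_eq_smul_addHaar (volume : Measure Spacetime)
    (f := (lorentzEquiv A).toLinearEquiv.toLinearMap) (fun h => by
      have := abs_det_lorentz A
      rw [h] at this
      simp at this)
  rw [abs_inv, abs_det_lorentz, inv_one, ENNReal.ofReal_one, one_smul] at h
  exact h

/-- The contravariant four-momentum on the mass shell. -/
def shellVec (m : ℝ) (p : Mom) : Spacetime := !₂[energy m p, p 0, p 1, p 2]

/-- The spatial part. -/
def spatial (x : Spacetime) : Mom := !₂[x 1, x 2, x 3]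

theorem spatial_shellVec (m : ℝ) (p : Mom) : spatial (shellVec m p) = p := by
  ext i; fin_cases i <;> rfl

/-- The action of the Lorentz group on the mass shell. -/
def shellAct (m : ℝ) (A : SL2C) (p : Mom) : Mom := spatial (lorentz A (shellVec m p))

theorem shellDot_eq_mink (m : ℝ) (p : Mom) (x : Spacetime) :
    shellDot m p x = mink (shellVec m p) x := by
  simp only [shellDot, mink, shellVec, Fin.sum_univ_three]
  simp
  ring

theorem mink_shellVec (m : ℝ) (p : Mom) : mink (shellVec m p) (shellVec m p) = m ^ 2 := by
  have := energy_sq m p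
  rw [EuclideanSpace.norm_sq_eq, Fin.sum_univ_three] at this
  simp only [Real.norm_eq_abs, sq_abs] at this
  simp [mink, shellVec]
  linarith

/-- The mass-shell equation gives the square of the energy, and its sign selects the root. -/
theorem eq_shellVec {m : ℝ} {x : Spacetime} (h0 : 0 ≤ x 0) (h : mink x x = m ^ 2) :
    x = shellVec m (spatial x) := by
  have h1 := energy_sq m (spatial x)
  rw [EuclideanSpace.norm_sq_eq, Fin.sum_univ_three] at h1
  simp only [Real.norm_eq_abs, sq_abs] at h1
  have e1 : spatial x 0 = x 1 := rfl
  have e2 : spatial x 1 = x 2 := rfl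
  have e3 : spatial x 2 = x 3 := rfl
  rw [e1, e2, e3] at h1
  have h2 : energy m (spatial x) = x 0 := by
    refine (sq_eq_sq₀ (energy_nonneg _ _) h0).1 ?_
    simp only [mink] at h
    linarith
  ext μ
  fin_cases μ
  · exact h2.symm
  · rfl
  · rfl
  · rfl

/-- On the closed forward cone `slash x` has nonnegative diagonal entries and determinant, hence is
positive semidefinite. This serves both to preserve the sign of the energy under `lorentz` and to
make the Fermi norms positive. -/
theorem slash_nonneg {x : Spacetime} (h0 : 0 ≤ x 0) (h : 0 ≤ mink x x) (u v : ℂ) :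
    0 ≤ (conj u * (slash x 0 0 * u + slash x 0 1 * v)
      + conj v * (slash x 1 0 * u + slash x 1 1 * v)).re := by
  rw [slash_eq]
  simp only [Matrix.of_apply, Matrix.cons_val', Matrix.cons_val_zero, Matrix.cons_val_one,
    Matrix.cons_val_fin_one]
  rw [mink] at h
  have h3 : |x 3| ≤ x 0 := abs_le_of_sq_le_sq (by nlinarith [sq_nonneg (x 1), sq_nonneg (x 2)]) h0
  obtain ⟨h4, h5⟩ := abs_le.1 h3
  set a := (x 0 - x 3) * (u.re ^ 2 + u.im ^ 2) with ha
  set b := (x 0 + x 3) * (v.re ^ 2 + v.im ^ 2) with hb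
  set r := u.re * v.re + u.im * v.im with hr
  set t := u.re * v.im - u.im * v.re with ht
  have ha0 : 0 ≤ a := mul_nonneg (by linarith) (by positivity)
  have hb0 : 0 ≤ b := mul_nonneg (by linarith) (by positivity)
  have key : (2 * (x 1 * r + x 2 * t)) ^ 2 ≤ (a + b) ^ 2 := by
    have e1 : (x 1 * r + x 2 * t) ^ 2 ≤ (x 1 ^ 2 + x 2 ^ 2) * (r ^ 2 + t ^ 2) := by
      nlinarith [sq_nonneg (x 1 * t - x 2 * r)]
    have e2 : r ^ 2 + t ^ 2 = (u.re ^ 2 + u.im ^ 2) * (v.re ^ 2 + v.im ^ 2) := by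
      rw [hr, ht]; ring
    have e3 : (x 1 ^ 2 + x 2 ^ 2) * (r ^ 2 + t ^ 2) ≤ a * b := by
      rw [e2, ha, hb]
      have : (x 0 - x 3) * (u.re ^ 2 + u.im ^ 2) * ((x 0 + x 3) * (v.re ^ 2 + v.im ^ 2))
        = (x 0 ^ 2 - x 3 ^ 2) * ((u.re ^ 2 + u.im ^ 2) * (v.re ^ 2 + v.im ^ 2)) := by ring
      rw [this]
      exact mul_le_mul_of_nonneg_right (by linarith) (by positivity)
    nlinarith [sq_nonneg (a - b)]
  have h6 := (abs_le.1 (abs_le_of_sq_le_sq key (add_nonneg ha0 hb0))).2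
  have : (conj u * (((x 0 : ℂ) - x 3) * u + (-x 1 + I * x 2) * v)
      + conj v * ((-x 1 - I * x 2) * u + ((x 0 : ℂ) + x 3) * v)).re
      = a + b - 2 * (x 1 * r + x 2 * t) := by
    rw [ha, hb, hr, ht]
    simp
    ring
  rw [this]
  linarith

/-- The energy is half the trace of `A X Aᴴ`, whose diagonal entries are values of the positive form
of `X` at the conjugated rows of `A`. -/
theorem lorentz_zero_nonneg (A : SL2C) {x : Spacetime} (h0 : 0 ≤ x 0) (h : 0 ≤ mink x x) :
    0 ≤ lorentz A x 0 := by
  have h1 := slash_nonneg h0 h (conj (A.1 0 0)) (conj (A.1 0 1))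
  have h2 := slash_nonneg h0 h (conj (A.1 1 0)) (conj (A.1 1 1))
  have h3 : lorentz A x 0 = ((slash (lorentz A x) 0 0).re + (slash (lorentz A x) 1 1).re) / 2 := by
    rw [slash_eq]
    simp
  rw [h3, slash_lorentz]
  simp only [Matrix.mul_apply, Fin.sum_univ_two, Matrix.conjTranspose_apply, star_def, conj_conj,
    add_mul, add_re] at h1 h2 ⊢
  have e1 : ∀ a b c : ℂ, (a * b * c).re = (a * (b * c)).re := fun a b c => by rw [mul_assoc]
  simp only [mul_add, add_re, e1] at h1 h2 ⊢
  linarith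

theorem shellVec_zero_nonneg (m : ℝ) (p : Mom) : 0 ≤ shellVec m p 0 := energy_nonneg m p

theorem shellVec_shellAct (m : ℝ) (A : SL2C) (p : Mom) :
    shellVec m (shellAct m A p) = lorentz A (shellVec m p) :=
  (eq_shellVec (lorentz_zero_nonneg A (shellVec_zero_nonneg m p)
    (by rw [mink_shellVec]; positivity)) (by rw [mink_lorentz_self, mink_shellVec])).symm

theorem shellAct_mul (m : ℝ) (A B : SL2C) (p : Mom) :
    shellAct m (A * B) p = shellAct m A (shellAct m B p) := by
  conv_rhs => rw [shellAct, shellVec_shellAct, ← lorentz_mul]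
  rfl

theorem shellAct_one (m : ℝ) (p : Mom) : shellAct m 1 p = p := by
  rw [shellAct, lorentz_one, spatial_shellVec]

theorem shellDot_shellAct (m : ℝ) (A : SL2C) (p : Mom) (x : Spacetime) :
    shellDot m (shellAct m A p) (lorentz A x) = shellDot m p x := by
  rw [shellDot_eq_mink, shellDot_eq_mink, shellVec_shellAct, mink_lorentz]

theorem shellTransform_lorentz (m s : ℝ) (A : SL2C) {F G : TestFn}
    (h : ∀ x, G (lorentz A x) = F x) (p : Mom) :
    shellTransform m s G (shellAct m A p) = shellTransform m s F p := by
  rw [shellTransform, shellTransform, ← (measurePreserving_lorentz A).integral_comp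
    (lorentzEquiv A).toHomeomorph.measurableEmbedding]
  simp only [shellDot_shellAct, h]

theorem shellTransform_translate (m s : ℝ) (a : Spacetime) {F G : TestFn}
    (h : ∀ x, G (x + a) = F x) (p : Mom) :
    shellTransform m s G p = cexp (I * ((s * shellDot m p a : ℝ) : ℂ)) * shellTransform m s F p := by
  rw [shellTransform, shellTransform, ← integral_const_mul,
    ← integral_add_right_eq_self _ a]
  refine integral_congr_ae (Filter.Eventually.of_forall fun x => ?_)
  simp only [h]
  rw [← mul_assoc, ← Complex.exp_add]
  congr 2
  simp only [shellDot_eq, PiLp.add_apply, mul_add, Finset.sum_add_distrib]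
  push_cast
  ring

theorem continuous_shellVec (m : ℝ) : Continuous (shellVec m) := by
  refine (PiLp.continuous_toLp 2 _).comp (continuous_pi fun μ => ?_)
  fin_cases μ
  · exact continuous_energy m
  all_goals
    simp
    fun_prop

theorem continuous_spatial : Continuous spatial := by
  refine (PiLp.continuous_toLp 2 _).comp (continuous_pi fun i => ?_)
  fin_cases i <;> simp <;> fun_prop

theorem continuous_shellAct (m : ℝ) (A : SL2C) : Continuous (shellAct m A) :=
  continuous_spatial.comp ((lorentzEquiv A).continuous.comp (continuous_shellVec m))

/-! ### Invariance of the measure -/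

/-- Light-cone coordinates on the mass shell. -/
def lightCone (m : ℝ) (z : ℝ × (Fin 2 → ℝ)) : Mom :=
  !₂[z.2 0, z.2 1, (z.1 - (m ^ 2 + z.2 0 ^ 2 + z.2 1 ^ 2) / z.1) / 2]

/-- The invariant measure in light-cone coordinates. -/
def lightConeMeasure : Measure (ℝ × (Fin 2 → ℝ)) :=
  ((volume.restrict (Set.Ioi (0 : ℝ))).withDensity fun t => ENNReal.ofReal (1 / (2 * t))).prod volume

/-- Substitution `r = (t - c/t) / 2`, with inverse `t = r + √(c + r²)`: then `√(c + r²) = (t + c/t)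
/ 2`, and `dr / √(c + r²)` becomes `dt / t`. -/
theorem lintegral_half_line {c : ℝ} (hc : 0 < c) (g : ℝ → ENNReal) :
    ∫⁻ r : ℝ, ENNReal.ofReal (1 / (2 * Real.sqrt (c + r ^ 2))) * g r
      = ∫⁻ t in Set.Ioi (0 : ℝ), ENNReal.ofReal (1 / (2 * t)) * g ((t - c / t) / 2) := by
  have himage : (fun t : ℝ => (t - c / t) / 2) '' Set.Ioi 0 = Set.univ := by
    refine Set.eq_univ_of_forall fun r => ⟨r + Real.sqrt (c + r ^ 2), ?_, ?_⟩
    · have : |r| < Real.sqrt (c + r ^ 2) := by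
        rw [← Real.sqrt_sq_eq_abs]
        exact Real.sqrt_lt_sqrt (by positivity) (by linarith)
      have := (abs_lt.1 this).1
      rw [Set.mem_Ioi]
      linarith
    · have h1 : Real.sqrt (c + r ^ 2) ^ 2 = c + r ^ 2 := Real.sq_sqrt (by positivity)
      have h2 : r + Real.sqrt (c + r ^ 2) ≠ 0 := by
        intro h
        have : Real.sqrt (c + r ^ 2) = -r := by linarith
        rw [this] at h1
        linarith [h1]
      simp only
      field_simp
      linear_combination h1
  have hinj : Set.InjOn (fun t : ℝ => (t - c / t) / 2) (Set.Ioi 0) := by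
    intro t ht t' ht' h
    have ht0 : 0 < t := ht
    have ht0' : 0 < t' := ht'
    simp only at h
    have h2 : (t - t') * (t * t' + c) = 0 := by
      field_simp at h
      linear_combination h
    rcases mul_eq_zero.1 h2 with h3 | h3
    · linarith
    · have : 0 < t * t' + c := by positivity
      linarith
  have hderiv : ∀ t ∈ Set.Ioi (0 : ℝ), HasDerivWithinAt (fun t : ℝ => (t - c / t) / 2)
      ((1 + c / t ^ 2) / 2) (Set.Ioi 0) t := by
    intro t ht
    have ht0 : t ≠ 0 := ne_of_gt ht
    have h1 := ((hasDerivAt_id t).sub ((hasDerivAt_inv ht0).const_mul c)).div_const 2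
    have h2 : HasDerivAt (fun t : ℝ => (t - c / t) / 2) ((1 - c * -(t ^ 2)⁻¹) / 2) t := by
      simpa [div_eq_mul_inv] using h1
    have h3 : (1 + c / t ^ 2) / 2 = (1 - c * -(t ^ 2)⁻¹) / 2 := by
      rw [div_eq_mul_inv c]
      ring
    rw [h3]
    exact h2.hasDerivWithinAt
  have h := lintegral_image_eq_lintegral_abs_deriv_mul measurableSet_Ioi hderiv hinj
    (fun r => ENNReal.ofReal (1 / (2 * Real.sqrt (c + r ^ 2))) * g r)
  rw [himage, Measure.restrict_univ] at h
  rw [h]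
  refine setLIntegral_congr_fun measurableSet_Ioi fun t ht => ?_
  have ht0 : 0 < t := ht
  rw [← mul_assoc, ← ENNReal.ofReal_mul (abs_nonneg _)]
  congr 2
  have h3 : c + ((t - c / t) / 2) ^ 2 = ((t + c / t) / 2) ^ 2 := by field_simp; ring
  rw [h3, Real.sqrt_sq (by positivity), abs_of_pos (by positivity)]
  field_simp

end

end Hyper

namespace Hyper

noncomputable section

open scoped ComplexConjugate Matrix

theorem measurable_lightCone (m : ℝ) : Measurable (lightCone m) := by
  refine (PiLp.continuous_toLp 2 _).measurable.comp (measurable_pi_iff.2 fun i => ?_)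
  have h0 : Measurable fun z : ℝ × (Fin 2 → ℝ) => z.2 0 := by fun_prop
  have h1 : Measurable fun z : ℝ × (Fin 2 → ℝ) => z.2 1 := by fun_prop
  fin_cases i
  · exact h0
  · exact h1
  · exact (measurable_fst.sub (((measurable_const.add (h0.pow_const 2)).add
      (h1.pow_const 2)).div measurable_fst)).div_const 2

theorem lintegral_mom (g : Mom → ENNReal) (hg : Measurable g) :
    ∫⁻ p, g p = ∫⁻ q : Fin 2 → ℝ, ∫⁻ r : ℝ, g (!₂[q 0, q 1, r]) := by
  rw [← (PiLp.volume_preserving_toLp (Fin 3)).lintegral_comp hg,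
    ← ((volume_preserving_piFinSuccAbove (fun _ : Fin 3 => ℝ) 2).symm _).lintegral_comp
      (f := fun y => g (WithLp.toLp 2 y))
      (hg.comp (PiLp.volume_preserving_toLp (Fin 3)).measurable),
    Measure.volume_eq_prod, lintegral_prod_symm]
  · refine lintegral_congr fun q => lintegral_congr fun r => ?_
    congr 2
    ext i
    fin_cases i <;> rfl
  · exact ((hg.comp (PiLp.volume_preserving_toLp (Fin 3)).measurable).comp
      (MeasurableEquiv.measurable _)).aemeasurable

/-- With `t = ω + p₃` in place of the third momentum component, `d³p / 2ω` becomes `dt / 2t` times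
Lebesgue measure in the transverse momentum `q`, by `lintegral_half_line` at each fixed `q`. -/
theorem map_lightCone (m : ℝ) :
    Measure.map (lightCone m) lightConeMeasure = shellMeasure m := by
  refine Measure.ext_of_lintegral _ fun f hf => ?_
  rw [lintegral_map hf (measurable_lightCone m), lightConeMeasure,
    lintegral_prod_symm (fun a => f (lightCone m a))
    (hf.comp (measurable_lightCone m)).aemeasurable, shellMeasure,
    lintegral_withDensity_eq_lintegral_mul _ (measurable_density m) hf,
    lintegral_mom _ ((measurable_density m).mul hf)]
  -- For `m = 0` the constant `c` of the substitution is positive only at nonzero transverse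
  -- momentum.
  have hae : ∀ᵐ q : Fin 2 → ℝ, q ≠ 0 := by
    simp [ae_iff]
  refine lintegral_congr_ae (hae.mono fun q hq => ?_)
  have hc : 0 < m ^ 2 + q 0 ^ 2 + q 1 ^ 2 := by
    refine lt_of_le_of_ne (by positivity) fun h => hq ?_
    have h0 : q 0 = 0 := by nlinarith [sq_nonneg (q 0), sq_nonneg (q 1), sq_nonneg m]
    have h1 : q 1 = 0 := by nlinarith [sq_nonneg (q 0), sq_nonneg (q 1), sq_nonneg m]
    ext i
    fin_cases i
    · exact h0
    · exact h1
  have hm : Measurable fun t : ℝ => ENNReal.ofReal (1 / (2 * t)) :=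
    ENNReal.measurable_ofReal.comp (measurable_const.div (measurable_const.mul measurable_id))
  have h := lintegral_half_line hc fun r => f (!₂[q 0, q 1, r])
  simp only
  rw [lintegral_withDensity_eq_lintegral_mul (g := fun t => f (lightCone m (t, q))) _ hm (hf.comp
    ((measurable_lightCone m).comp measurable_prodMk_right))]
  refine h.symm.trans (lintegral_congr fun r => ?_)
  simp only [Pi.mul_apply, energy, EuclideanSpace.norm_sq_eq, Fin.sum_univ_three]
  simp [add_assoc]

/-- The shear of the light-cone coordinates. -/
def lightConeShear (z : ℂ) (x : ℝ × (Fin 2 → ℝ)) : ℝ × (Fin 2 → ℝ) :=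
  (x.1, x.2 + ![-(z.re * x.1), z.im * x.1])

theorem measurePreserving_lightConeShear (z : ℂ) :
    MeasurePreserving (lightConeShear z) lightConeMeasure lightConeMeasure := by
  refine MeasurePreserving.skew_product (g := fun t q => q + ![-(z.re * t), z.im * t])
    (MeasurePreserving.id _) ?_ (Filter.Eventually.of_forall fun t => ?_)
  · refine measurable_snd.add (measurable_pi_iff.2 fun i => ?_)
    fin_cases i <;> simp <;> fun_prop
  · exact map_add_right_eq_self _ _

/-- Upper triangular unipotent elements. -/
def upperUnipotent (z : ℂ) : SL2C := ⟨!![1, z; 0, 1], by simp [Matrix.det_fin_two]⟩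

/-- The Weyl element. -/
def weylElement : SL2C := ⟨!![0, 1; -1, 0], by simp [Matrix.det_fin_two]⟩

theorem shellVec_lightCone (m : ℝ) {t : ℝ} (ht : 0 < t) (q : Fin 2 → ℝ) :
    shellVec m (lightCone m (t, q)) = !₂[(t + (m ^ 2 + q 0 ^ 2 + q 1 ^ 2) / t) / 2, q 0, q 1,
      (t - (m ^ 2 + q 0 ^ 2 + q 1 ^ 2) / t) / 2] := by
  symm
  refine eq_shellVec (m := m) ?_ ?_
  · simp
    positivity
  · simp [mink]
    field_simp
    ring

/-- An upper unipotent matrix fixes the lower right entry `t` of the momentum matrix and shifts the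
off-diagonal entries by multiples of `t`. At fixed `t` it therefore translates `q`, which preserves
the measure. -/
theorem shellAct_upperUnipotent (m : ℝ) (z : ℂ) {x : ℝ × (Fin 2 → ℝ)} (ht : 0 < x.1) :
    shellAct m (upperUnipotent z) (lightCone m x) = lightCone m (lightConeShear z x) := by
  obtain ⟨t, q⟩ := x
  have ht' : (t : ℂ) ≠ 0 := by exact_mod_cast (ne_of_gt ht)
  rw [shellAct, ← spatial_shellVec m (lightCone m (lightConeShear z (t, q)))]
  congr 1
  rw [lightConeShear, shellVec_lightCone m ht, shellVec_lightCone m ht]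
  refine slash_injective ?_
  have hz : conj z = z.re - I * z.im := by
    apply Complex.ext <;> simp
  have hz' : z = z.re + I * z.im := by
    apply Complex.ext <;> simp
  have hz2 : (!![1, z; 0, 1] : Matrix (Fin 2) (Fin 2) ℂ)ᴴ = !![1, 0; z.re - I * z.im, 1] := by
    rw [← hz]
    ext i j
    fin_cases i <;> fin_cases j <;> simp [Matrix.conjTranspose_apply]
  rw [slash_lorentz, slash_eq, slash_eq, upperUnipotent, hz2, Matrix.mul_fin_two, Matrix.mul_fin_two]
  conv_lhs => rw [hz']
  ext i j
  fin_cases i <;> fin_cases j <;> simp <;> field_simp <;> ring_nf <;> simp only [I_sq] <;> ring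

theorem measurePreserving_upperUnipotent (m : ℝ) (z : ℂ) :
    MeasurePreserving (shellAct m (upperUnipotent z)) (shellMeasure m) (shellMeasure m) := by
  refine ⟨(continuous_shellAct m _).measurable, ?_⟩
  have hpos : ∀ᵐ x ∂lightConeMeasure, 0 < x.1 := by
    refine Measure.quasiMeasurePreserving_fst.ae ?_
    exact (withDensity_absolutelyContinuous _ _).ae_le
      (ae_restrict_mem measurableSet_Ioi)
  rw [← map_lightCone, Measure.map_map (continuous_shellAct m _).measurable
    (measurable_lightCone m)]
  have h : (shellAct m (upperUnipotent z) ∘ lightCone m)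
      =ᵐ[lightConeMeasure] lightCone m ∘ lightConeShear z :=
    hpos.mono fun x hx => shellAct_upperUnipotent m z hx
  rw [Measure.map_congr h, ← Measure.map_map (measurable_lightCone m)
    (measurePreserving_lightConeShear z).measurable, (measurePreserving_lightConeShear z).map_eq]

theorem shellAct_weylElement (m : ℝ) (p : Mom) :
    shellAct m weylElement p = !₂[-p 0, p 1, -p 2] := by
  have : lorentz weylElement (shellVec m p) = !₂[energy m p, -p 0, p 1, -p 2] := by
    refine slash_injective ?_
    have hz2 : (!![0, 1; -1, 0] : Matrix (Fin 2) (Fin 2) ℂ)ᴴ = !![0, -1; 1, 0] := by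
      ext i j
      fin_cases i <;> fin_cases j <;> simp [Matrix.conjTranspose_apply]
    rw [slash_lorentz, slash_eq, slash_eq, weylElement, hz2, Matrix.mul_fin_two,
      Matrix.mul_fin_two]
    ext i j
    fin_cases i <;> fin_cases j <;> simp [shellVec] <;> ring
  rw [shellAct, this]
  rfl

/-- The rotation of momenta induced by the Weyl element. -/
def weylRotation : Mom ≃ₗᵢ[ℝ] Mom :=
  LinearIsometryEquiv.mk
    { toFun := fun p => !₂[-p 0, p 1, -p 2]
      invFun := fun p => !₂[-p 0, p 1, -p 2]
      map_add' := fun p q => by ext i; fin_cases i <;> simp <;> ring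
      map_smul' := fun c p => by ext i; fin_cases i <;> simp
      left_inv := fun p => by ext i; fin_cases i <;> simp
      right_inv := fun p => by ext i; fin_cases i <;> simp }
    (fun p => by simp [EuclideanSpace.norm_eq, Fin.sum_univ_three])

theorem measurePreserving_weylElement (m : ℝ) :
    MeasurePreserving (shellAct m weylElement) (shellMeasure m) (shellMeasure m) := by
  have h : shellAct m weylElement = weylRotation := funext (shellAct_weylElement m)
  rw [h]
  refine ⟨weylRotation.continuous.measurable, Measure.ext_of_lintegral _ fun f hf => ?_⟩
  rw [lintegral_map hf weylRotation.continuous.measurable, shellMeasure,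
    lintegral_withDensity_eq_lintegral_mul _ (measurable_density m) hf,
    lintegral_withDensity_eq_lintegral_mul (g := fun a => f (weylRotation a)) _
      (measurable_density m) (hf.comp weylRotation.continuous.measurable),
    ← weylRotation.measurePreserving.lintegral_comp ((measurable_density m).mul hf)]
  refine lintegral_congr fun p => ?_
  simp [energy]

theorem measurePreserving_shellAct_mul {m : ℝ} {A B : SL2C}
    (hA : MeasurePreserving (shellAct m A) (shellMeasure m) (shellMeasure m))
    (hB : MeasurePreserving (shellAct m B) (shellMeasure m) (shellMeasure m)) :
    MeasurePreserving (shellAct m (A * B)) (shellMeasure m) (shellMeasure m) := by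
  have : shellAct m (A * B) = shellAct m A ∘ shellAct m B := funext (shellAct_mul m A B)
  rw [this]
  exact hA.comp hB

/-- The big Bruhat cell: if the lower left entry is nonzero, the matrix is an upper, times a lower,
times an upper unipotent. The lower one is a conjugate of an upper one by the Weyl element `w`,
where `w³ = w⁻¹`. -/
theorem eq_unipotent_weyl (A : SL2C) (hc : A.1 1 0 ≠ 0) :
    A = upperUnipotent ((A.1 0 0 - 1) / A.1 1 0) *
      (weylElement * weylElement * weylElement * upperUnipotent (-A.1 1 0) * weylElement) *
      upperUnipotent ((A.1 1 1 - 1) / A.1 1 0) := by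
  have hdet := A.2
  rw [Matrix.det_fin_two] at hdet
  refine Subtype.ext ?_
  have hu : ∀ z, (upperUnipotent z).1 = !![1, z; 0, 1] := fun z => rfl
  have hw : weylElement.1 = !![0, 1; -1, 0] := rfl
  simp only [Matrix.SpecialLinearGroup.coe_mul, hu, hw, Matrix.mul_fin_two]
  rw [Matrix.eta_fin_two A.1]
  ext i j
  fin_cases i <;> fin_cases j <;> simp <;> field_simp <;>
    first | ring1 | linear_combination hdet | linear_combination -hdet

theorem measurePreserving_shellAct (m : ℝ) (A : SL2C) :
    MeasurePreserving (shellAct m A) (shellMeasure m) (shellMeasure m) := by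
  have hw := measurePreserving_weylElement m
  have key : ∀ A : SL2C, A.1 1 0 ≠ 0 →
      MeasurePreserving (shellAct m A) (shellMeasure m) (shellMeasure m) := by
    intro A hA
    rw [eq_unipotent_weyl A hA]
    exact measurePreserving_shellAct_mul (measurePreserving_shellAct_mul (measurePreserving_upperUnipotent m _)
      (measurePreserving_shellAct_mul (measurePreserving_shellAct_mul (measurePreserving_shellAct_mul (measurePreserving_shellAct_mul hw hw) hw)
        (measurePreserving_upperUnipotent m _)) hw)) (measurePreserving_upperUnipotent m _)
  by_cases hA : A.1 1 0 = 0
  -- Outside the big cell, multiplication by the inverse Weyl element moves the upper left entry to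
  -- the lower left place, and it is nonzero because the determinant is one.
  · have h1 : A = weylElement * (weylElement⁻¹ * A) := by group
    rw [h1]
    refine measurePreserving_shellAct_mul hw (key _ ?_)
    have hdet := A.2
    rw [Matrix.det_fin_two, hA] at hdet
    intro h
    have : (weylElement⁻¹ * A).1 1 0 = A.1 0 0 := by
      have hw : weylElement.1 = !![0, 1; -1, 0] := rfl
      rw [Matrix.SpecialLinearGroup.coe_mul, Matrix.SpecialLinearGroup.coe_inv, hw,
        Matrix.adjugate_fin_two_of]
      simp [Matrix.mul_apply, Fin.sum_univ_two]
    rw [this] at h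
    simp [h] at hdet
  · exact key A hA

end

end Hyper

namespace Hyper

noncomputable section

open scoped ComplexConjugate Matrix

/-! ### The charges on one-particle states -/

section Generic

variable {V : Type} [AddCommGroup V] [Module ℂ V]

/-- The action of the supercharge `Q_{ja}` on one-particle states, where `P a b` is the operator
`σ^μ_{a b̄} p_μ`. -/
def supercharge (P : Fin 2 → Fin 2 → V →ₗ[ℂ] V) (j a : Fin 2) : (Comp → V) →ₗ[ℂ] (Comp → V) where
  toFun u
    | .phi k => ∑ b, (2 * I * kron j k) • P a b (u (.chiBar b))
    | .phiStar k => ∑ b, (2 * I * eps j k) • P a b (u (.psiBar b))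
    | .f k => ∑ b, (-2 * eps a b * kron j k) • u (.psi b)
    | .fStar k => ∑ b, (2 * eps j k * eps a b) • u (.chi b)
    | .psi b => ∑ k, (-I * eps j k * kron a b) • u (.phi k)
    | .psiBar c => ∑ b, (-eps b c) • P a b (u (.fStar j))
    | .chi b => (-I * kron a b) • u (.phiStar j)
    | .chiBar c => ∑ k, ∑ b, (eps j k * eps b c) • P a b (u (.f k))
  map_add' u v := by
    ext c
    cases c <;> simp only [Pi.add_apply, map_add, smul_add, Finset.sum_add_distrib]
  map_smul' r u := by
    ext c
    cases c <;> simp only [Pi.smul_apply, map_smul, smul_comm _ r, Finset.smul_sum, RingHom.id_apply]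

/-- The action of the adjoint supercharge on one-particle states. -/
def superchargeBar (P : Fin 2 → Fin 2 → V →ₗ[ℂ] V) (j a : Fin 2) :
    (Comp → V) →ₗ[ℂ] (Comp → V) where
  toFun u
    | .phi k => ∑ b, (2 * I * eps j k) • P b a (u (.psi b))
    | .phiStar k => ∑ b, (2 * I * kron j k) • P b a (u (.chi b))
    | .f k => ∑ b, (2 * eps j k * eps a b) • u (.chiBar b)
    | .fStar k => ∑ b, (-2 * eps a b * kron j k) • u (.psiBar b)
    | .psi c => ∑ b, (-eps b c) • P b a (u (.f j))
    | .psiBar b => ∑ k, (-I * eps j k * kron a b) • u (.phiStar k)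
    | .chi c => ∑ k, ∑ b, (eps j k * eps b c) • P b a (u (.fStar k))
    | .chiBar b => (-I * kron a b) • u (.phi j)
  map_add' u v := by
    ext c
    cases c <;> simp only [Pi.add_apply, map_add, smul_add, Finset.sum_add_distrib]
  map_smul' r u := by
    ext c
    cases c <;> simp only [Pi.smul_apply, map_smul, smul_comm _ r, Finset.smul_sum, RingHom.id_apply]

/-- The action of the central charge on one-particle states of squared mass `q`. -/
def centralCharge (q : ℂ) (P : Fin 2 → Fin 2 → V →ₗ[ℂ] V) : (Comp → V) →ₗ[ℂ] (Comp → V) where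
  toFun u
    | .phi k => (I * q) • u (.f k)
    | .phiStar k => (I * q) • u (.fStar k)
    | .f k => (-I) • u (.phi k)
    | .fStar k => (-I) • u (.phiStar k)
    | .psi c => ∑ a, ∑ b, (-eps b c) • P b a (u (.chiBar a))
    | .psiBar c => ∑ a, ∑ b, (-eps b c) • P a b (u (.chi a))
    | .chi c => ∑ a, ∑ b, eps b c • P b a (u (.psiBar a))
    | .chiBar c => ∑ a, ∑ b, eps b c • P a b (u (.psi a))
  map_add' u v := by
    ext c
    cases c <;> simp only [Pi.add_apply, map_add, smul_add, Finset.sum_add_distrib]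
  map_smul' r u := by
    ext c
    cases c <;> simp only [Pi.smul_apply, map_smul, smul_comm _ r, Finset.smul_sum, RingHom.id_apply]

/-- The operator which defines the inner product of one-particle states of squared mass `q`. -/
def gramOp (q α : ℂ) (β : ℝ) (P : Fin 2 → Fin 2 → V →ₗ[ℂ] V) : (Comp → V) →ₗ[ℂ] (Comp → V) where
  toFun u
    | .phi j => u (.phi j) + (-I * β) • u (.f j) + ∑ k, (-I * conj α * eps j k) • u (.fStar k)
    | .phiStar j => u (.phiStar j) + (I * β) • u (.fStar j) + ∑ k, (I * α * eps j k) • u (.f k)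
    | .f k => q • u (.f k) + (I * β) • u (.phi k) + ∑ j, (-I * conj α * eps j k) • u (.phiStar j)
    | .fStar k => q • u (.fStar k) + (-I * β) • u (.phiStar k) + ∑ j, (I * α * eps j k) • u (.phi j)
    | .psi a => ∑ b, ((2 : ℂ) • P b a (u (.psi b)) + (2 * conj α * eps b a) • u (.psiBar b)
        + (2 * β * eps b a) • u (.chiBar b))
    | .psiBar a => ∑ b, ((2 : ℂ) • P a b (u (.psiBar b)) + (2 * α * eps a b) • u (.psi b)
        + (2 * β * eps a b) • u (.chi b))
    | .chi a => ∑ b, ((2 : ℂ) • P b a (u (.chi b)) + (-2 * α * eps b a) • u (.chiBar b)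
        + (2 * β * eps b a) • u (.psiBar b))
    | .chiBar a => ∑ b, ((2 : ℂ) • P a b (u (.chiBar b)) + (-2 * conj α * eps a b) • u (.chi b)
        + (2 * β * eps a b) • u (.psi b))
  map_add' u v := by
    ext c
    cases c <;> simp only [Pi.add_apply, map_add, smul_add, Finset.sum_add_distrib] <;> abel
  map_smul' r u := by
    ext c
    cases c <;> simp only [Pi.smul_apply, map_smul, smul_comm _ r, Finset.smul_sum, RingHom.id_apply,
      smul_add]

/-- The action of `SU(2)` on one-particle states. -/
def su2Op (U : SU2) : (Comp → V) →ₗ[ℂ] (Comp → V) where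
  toFun u
    | .phi k => ∑ j, (U⁻¹).1 j k • u (.phi j)
    | .f k => ∑ j, (U⁻¹).1 j k • u (.f j)
    | .phiStar k => ∑ j, conj ((U⁻¹).1 j k) • u (.phiStar j)
    | .fStar k => ∑ j, conj ((U⁻¹).1 j k) • u (.fStar j)
    | .psi a => u (.psi a)
    | .psiBar a => u (.psiBar a)
    | .chi a => u (.chi a)
    | .chiBar a => u (.chiBar a)
  map_add' u v := by
    ext c
    cases c <;> simp only [Pi.add_apply, smul_add, Finset.sum_add_distrib]
  map_smul' r u := by
    ext c
    cases c <;> simp only [Pi.smul_apply, smul_comm _ r, Finset.smul_sum, RingHom.id_apply]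

/-- The action of `SL(2, ℂ)` on the spinor indices of one-particle states. -/
def spinorOp (A : SL2C) : (Comp → V) →ₗ[ℂ] (Comp → V) where
  toFun u
    | .psi b => ∑ a, (A⁻¹).1 a b • u (.psi a)
    | .chi b => ∑ a, (A⁻¹).1 a b • u (.chi a)
    | .psiBar b => ∑ a, conj ((A⁻¹).1 a b) • u (.psiBar a)
    | .chiBar b => ∑ a, conj ((A⁻¹).1 a b) • u (.chiBar a)
    | .phi j => u (.phi j)
    | .phiStar j => u (.phiStar j)
    | .f j => u (.f j)
    | .fStar j => u (.fStar j)
  map_add' u v := by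
    ext c
    cases c <;> simp only [Pi.add_apply, smul_add, Finset.sum_add_distrib]
  map_smul' r u := by
    ext c
    cases c <;> simp only [Pi.smul_apply, smul_comm _ r, Finset.smul_sum, RingHom.id_apply]

/-- The parity of one-particle states. -/
def parityOp : (Comp → V) →ₗ[ℂ] (Comp → V) where
  toFun u
    | .psi b => -u (.psi b)
    | .chi b => -u (.chi b)
    | .psiBar b => -u (.psiBar b)
    | .chiBar b => -u (.chiBar b)
    | .phi j => u (.phi j)
    | .phiStar j => u (.phiStar j)
    | .f j => u (.f j)
    | .fStar j => u (.fStar j)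
  map_add' u v := by
    ext c
    cases c <;> simp only [Pi.add_apply, neg_add]
  map_smul' r u := by
    ext c
    cases c <;> simp only [Pi.smul_apply, smul_neg, RingHom.id_apply]

theorem supercharge_apply (P : Fin 2 → Fin 2 → V →ₗ[ℂ] V) (j a : Fin 2) (u : Comp → V) :
    (∀ k, supercharge P j a u (.phi k) = ∑ b, (2 * I * kron j k) • P a b (u (.chiBar b)))
    ∧ (∀ k, supercharge P j a u (.phiStar k) = ∑ b, (2 * I * eps j k) • P a b (u (.psiBar b)))
    ∧ (∀ k, supercharge P j a u (.f k) = ∑ b, (-2 * eps a b * kron j k) • u (.psi b))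
    ∧ (∀ k, supercharge P j a u (.fStar k) = ∑ b, (2 * eps j k * eps a b) • u (.chi b))
    ∧ (∀ b, supercharge P j a u (.psi b) = ∑ k, (-I * eps j k * kron a b) • u (.phi k))
    ∧ (∀ c, supercharge P j a u (.psiBar c) = ∑ b, (-eps b c) • P a b (u (.fStar j)))
    ∧ (∀ b, supercharge P j a u (.chi b) = (-I * kron a b) • u (.phiStar j))
    ∧ (∀ c, supercharge P j a u (.chiBar c) = ∑ k, ∑ b, (eps j k * eps b c) • P a b (u (.f k))) :=
  ⟨fun _ => rfl, fun _ => rfl, fun _ => rfl, fun _ => rfl, fun _ => rfl, fun _ => rfl, fun _ => rfl,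
    fun _ => rfl⟩

theorem superchargeBar_apply (P : Fin 2 → Fin 2 → V →ₗ[ℂ] V) (j a : Fin 2) (u : Comp → V) :
    (∀ k, superchargeBar P j a u (.phi k) = ∑ b, (2 * I * eps j k) • P b a (u (.psi b)))
    ∧ (∀ k, superchargeBar P j a u (.phiStar k) = ∑ b, (2 * I * kron j k) • P b a (u (.chi b)))
    ∧ (∀ k, superchargeBar P j a u (.f k) = ∑ b, (2 * eps j k * eps a b) • u (.chiBar b))
    ∧ (∀ k, superchargeBar P j a u (.fStar k) = ∑ b, (-2 * eps a b * kron j k) • u (.psiBar b))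
    ∧ (∀ c, superchargeBar P j a u (.psi c) = ∑ b, (-eps b c) • P b a (u (.f j)))
    ∧ (∀ b, superchargeBar P j a u (.psiBar b) = ∑ k, (-I * eps j k * kron a b) • u (.phiStar k))
    ∧ (∀ c, superchargeBar P j a u (.chi c) = ∑ k, ∑ b, (eps j k * eps b c) • P b a (u (.fStar k)))
    ∧ (∀ b, superchargeBar P j a u (.chiBar b) = (-I * kron a b) • u (.phi j)) :=
  ⟨fun _ => rfl, fun _ => rfl, fun _ => rfl, fun _ => rfl, fun _ => rfl, fun _ => rfl, fun _ => rfl,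
    fun _ => rfl⟩

theorem centralCharge_apply (q : ℂ) (P : Fin 2 → Fin 2 → V →ₗ[ℂ] V) (u : Comp → V) :
    (∀ k, centralCharge q P u (.phi k) = (I * q) • u (.f k))
    ∧ (∀ k, centralCharge q P u (.phiStar k) = (I * q) • u (.fStar k))
    ∧ (∀ k, centralCharge q P u (.f k) = (-I) • u (.phi k))
    ∧ (∀ k, centralCharge q P u (.fStar k) = (-I) • u (.phiStar k))
    ∧ (∀ c, centralCharge q P u (.psi c) = ∑ a, ∑ b, (-eps b c) • P b a (u (.chiBar a)))
    ∧ (∀ c, centralCharge q P u (.psiBar c) = ∑ a, ∑ b, (-eps b c) • P a b (u (.chi a)))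
    ∧ (∀ c, centralCharge q P u (.chi c) = ∑ a, ∑ b, eps b c • P b a (u (.psiBar a)))
    ∧ (∀ c, centralCharge q P u (.chiBar c) = ∑ a, ∑ b, eps b c • P a b (u (.psi a))) :=
  ⟨fun _ => rfl, fun _ => rfl, fun _ => rfl, fun _ => rfl, fun _ => rfl, fun _ => rfl, fun _ => rfl,
    fun _ => rfl⟩

theorem gramOp_apply (q α : ℂ) (β : ℝ) (P : Fin 2 → Fin 2 → V →ₗ[ℂ] V) (u : Comp → V) :
    (∀ j, gramOp q α β P u (.phi j) =
        u (.phi j) + (-I * β) • u (.f j) + ∑ k, (-I * conj α * eps j k) • u (.fStar k))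
    ∧ (∀ j, gramOp q α β P u (.phiStar j) =
        u (.phiStar j) + (I * β) • u (.fStar j) + ∑ k, (I * α * eps j k) • u (.f k))
    ∧ (∀ k, gramOp q α β P u (.f k) =
        q • u (.f k) + (I * β) • u (.phi k) + ∑ j, (-I * conj α * eps j k) • u (.phiStar j))
    ∧ (∀ k, gramOp q α β P u (.fStar k) =
        q • u (.fStar k) + (-I * β) • u (.phiStar k) + ∑ j, (I * α * eps j k) • u (.phi j))
    ∧ (∀ a, gramOp q α β P u (.psi a) =
        ∑ b, ((2 : ℂ) • P b a (u (.psi b)) + (2 * conj α * eps b a) • u (.psiBar b)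
          + (2 * β * eps b a) • u (.chiBar b)))
    ∧ (∀ a, gramOp q α β P u (.psiBar a) =
        ∑ b, ((2 : ℂ) • P a b (u (.psiBar b)) + (2 * α * eps a b) • u (.psi b)
          + (2 * β * eps a b) • u (.chi b)))
    ∧ (∀ a, gramOp q α β P u (.chi a) =
        ∑ b, ((2 : ℂ) • P b a (u (.chi b)) + (-2 * α * eps b a) • u (.chiBar b)
          + (2 * β * eps b a) • u (.psiBar b)))
    ∧ (∀ a, gramOp q α β P u (.chiBar a) =
        ∑ b, ((2 : ℂ) • P a b (u (.chiBar b)) + (-2 * conj α * eps a b) • u (.chi b)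
          + (2 * β * eps a b) • u (.psi b))) :=
  ⟨fun _ => rfl, fun _ => rfl, fun _ => rfl, fun _ => rfl, fun _ => rfl, fun _ => rfl, fun _ => rfl,
    fun _ => rfl⟩

theorem su2Op_apply (U : SU2) (u : Comp → V) :
    (∀ k, su2Op U u (.phi k) = ∑ j, (U⁻¹).1 j k • u (.phi j))
    ∧ (∀ k, su2Op U u (.f k) = ∑ j, (U⁻¹).1 j k • u (.f j))
    ∧ (∀ k, su2Op U u (.phiStar k) = ∑ j, conj ((U⁻¹).1 j k) • u (.phiStar j))
    ∧ (∀ k, su2Op U u (.fStar k) = ∑ j, conj ((U⁻¹).1 j k) • u (.fStar j))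
    ∧ (∀ a, su2Op U u (.psi a) = u (.psi a))
    ∧ (∀ a, su2Op U u (.psiBar a) = u (.psiBar a))
    ∧ (∀ a, su2Op U u (.chi a) = u (.chi a))
    ∧ (∀ a, su2Op U u (.chiBar a) = u (.chiBar a)) :=
  ⟨fun _ => rfl, fun _ => rfl, fun _ => rfl, fun _ => rfl, fun _ => rfl, fun _ => rfl, fun _ => rfl,
    fun _ => rfl⟩

theorem spinorOp_apply (A : SL2C) (u : Comp → V) :
    (∀ b, spinorOp A u (.psi b) = ∑ a, (A⁻¹).1 a b • u (.psi a))
    ∧ (∀ b, spinorOp A u (.chi b) = ∑ a, (A⁻¹).1 a b • u (.chi a))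
    ∧ (∀ b, spinorOp A u (.psiBar b) = ∑ a, conj ((A⁻¹).1 a b) • u (.psiBar a))
    ∧ (∀ b, spinorOp A u (.chiBar b) = ∑ a, conj ((A⁻¹).1 a b) • u (.chiBar a))
    ∧ (∀ j, spinorOp A u (.phi j) = u (.phi j))
    ∧ (∀ j, spinorOp A u (.phiStar j) = u (.phiStar j))
    ∧ (∀ j, spinorOp A u (.f j) = u (.f j))
    ∧ (∀ j, spinorOp A u (.fStar j) = u (.fStar j)) :=
  ⟨fun _ => rfl, fun _ => rfl, fun _ => rfl, fun _ => rfl, fun _ => rfl, fun _ => rfl, fun _ => rfl,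
    fun _ => rfl⟩

theorem parityOp_apply  (u : Comp → V) :
    (∀ b, parityOp u (.psi b) = -u (.psi b))
    ∧ (∀ b, parityOp u (.chi b) = -u (.chi b))
    ∧ (∀ b, parityOp u (.psiBar b) = -u (.psiBar b))
    ∧ (∀ b, parityOp u (.chiBar b) = -u (.chiBar b))
    ∧ (∀ j, parityOp u (.phi j) = u (.phi j))
    ∧ (∀ j, parityOp u (.phiStar j) = u (.phiStar j))
    ∧ (∀ j, parityOp u (.f j) = u (.f j))
    ∧ (∀ j, parityOp u (.fStar j) = u (.fStar j)) :=
  ⟨fun _ => rfl, fun _ => rfl, fun _ => rfl, fun _ => rfl, fun _ => rfl, fun _ => rfl, fun _ => rfl,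
    fun _ => rfl⟩

variable {V' : Type} [AddCommGroup V'] [Module ℂ V'] (f : V →ₗ[ℂ] V')
  {P : Fin 2 → Fin 2 → V →ₗ[ℂ] V} {P' : Fin 2 → Fin 2 → V' →ₗ[ℂ] V'}

/-- The charges are defined over any module with operators `P a b`, and linear maps that intertwine
these operators carry one instance to another. For evaluation at a momentum this reduces identities
of one-particle operators to identities over `ℂ`. -/
theorem supercharge_comp (h : ∀ a b x, f (P a b x) = P' a b (f x)) (j a : Fin 2) (u : Comp → V) :
    f ∘ supercharge P j a u = supercharge P' j a (f ∘ u) := by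
  ext c
  cases c <;> simp only [Function.comp_apply, supercharge_apply, map_sum,
    map_smul, h]

theorem superchargeBar_comp (h : ∀ a b x, f (P a b x) = P' a b (f x)) (j a : Fin 2)
    (u : Comp → V) : f ∘ superchargeBar P j a u = superchargeBar P' j a (f ∘ u) := by
  ext c
  cases c <;> simp only [Function.comp_apply, superchargeBar_apply,
    map_sum, map_smul, h]

theorem centralCharge_comp (h : ∀ a b x, f (P a b x) = P' a b (f x)) (q : ℂ) (u : Comp → V) :
    f ∘ centralCharge q P u = centralCharge q P' (f ∘ u) := by
  ext c
  cases c <;> simp only [Function.comp_apply, centralCharge_apply,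
    map_sum, map_smul, h]

theorem gramOp_comp (h : ∀ a b x, f (P a b x) = P' a b (f x)) (q α : ℂ) (β : ℝ) (u : Comp → V) :
    f ∘ gramOp q α β P u = gramOp q α β P' (f ∘ u) := by
  ext c
  cases c <;> simp only [Function.comp_apply, gramOp_apply,
    map_sum, map_smul, map_add, h]

theorem su2Op_comp (U : SU2) (u : Comp → V) : f ∘ su2Op U u = su2Op U (f ∘ u) := by
  ext c
  cases c <;> simp only [Function.comp_apply, su2Op_apply,
    map_sum, map_smul]

theorem spinorOp_comp (A : SL2C) (u : Comp → V) : f ∘ spinorOp A u = spinorOp A (f ∘ u) := by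
  ext c
  cases c <;> simp only [Function.comp_apply, spinorOp_apply,
    map_sum, map_smul]

theorem parityOp_comp (u : Comp → V) : f ∘ parityOp u = parityOp (f ∘ u) := by
  ext c
  cases c <;> simp only [Function.comp_apply, parityOp_apply, map_neg]

theorem parityOp_parityOp (u : Comp → V) : parityOp (parityOp u) = u := by
  ext c
  cases c <;> simp only [parityOp_apply, neg_neg]

theorem supercharge_parityOp (j a : Fin 2) (u : Comp → V) :
    supercharge P j a (parityOp u) = -parityOp (supercharge P j a u) := by
  ext c
  cases c <;> simp only [Pi.neg_apply, supercharge_apply, parityOp_apply,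
    map_neg, smul_neg, Finset.sum_neg_distrib, neg_neg]

theorem superchargeBar_parityOp (j a : Fin 2) (u : Comp → V) :
    superchargeBar P j a (parityOp u) = -parityOp (superchargeBar P j a u) := by
  ext c
  cases c <;> simp only [Pi.neg_apply, superchargeBar_apply, parityOp_apply,
    map_neg, smul_neg, Finset.sum_neg_distrib, neg_neg]

theorem centralCharge_parityOp (q : ℂ) (u : Comp → V) :
    centralCharge q P (parityOp u) = parityOp (centralCharge q P u) := by
  ext c
  cases c <;> simp only [centralCharge_apply, parityOp_apply,
    map_neg, smul_neg, Finset.sum_neg_distrib]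

theorem su2Op_parityOp (U : SU2) (u : Comp → V) :
    su2Op U (parityOp u) = parityOp (su2Op U u) := by
  ext c
  cases c <;> simp only [su2Op_apply, parityOp_apply]

theorem spinorOp_parityOp (A : SL2C) (u : Comp → V) :
    spinorOp A (parityOp u) = parityOp (spinorOp A u) := by
  ext c
  cases c <;> simp only [spinorOp_apply, parityOp_apply,
    smul_neg, Finset.sum_neg_distrib]

end Generic

/-! ### The charges at a fixed momentum -/

/-- Multiplication by the entries of a matrix. -/
def entryMul (M : Matrix (Fin 2) (Fin 2) ℂ) (a b : Fin 2) : ℂ →ₗ[ℂ] ℂ := M a b • LinearMap.id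

theorem entryMul_apply (M : Matrix (Fin 2) (Fin 2) ℂ) (a b : Fin 2) (z : ℂ) :
    entryMul M a b z = M a b * z := rfl

/-- The inner product of one-particle states at a fixed momentum. -/
def gram (α : ℂ) (β : ℝ) (M : Matrix (Fin 2) (Fin 2) ℂ) (u v : Comp → ℂ) : ℂ :=
  ∑ j : Fin 2, (conj (u (.phi j)) * gramOp M.det α β (entryMul M) v (.phi j)
    + conj (u (.phiStar j)) * gramOp M.det α β (entryMul M) v (.phiStar j)
    + conj (u (.f j)) * gramOp M.det α β (entryMul M) v (.f j)
    + conj (u (.fStar j)) * gramOp M.det α β (entryMul M) v (.fStar j)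
    + conj (u (.psi j)) * gramOp M.det α β (entryMul M) v (.psi j)
    + conj (u (.psiBar j)) * gramOp M.det α β (entryMul M) v (.psiBar j)
    + conj (u (.chi j)) * gramOp M.det α β (entryMul M) v (.chi j)
    + conj (u (.chiBar j)) * gramOp M.det α β (entryMul M) v (.chiBar j))

end

end Hyper

namespace Hyper

noncomputable section

open scoped ComplexConjugate Matrix

theorem eps_apply : eps 0 0 = 0 ∧ eps 0 1 = 1 ∧ eps 1 0 = -1 ∧ eps 1 1 = 0 := by
  simp [eps]

theorem kron_apply : kron 0 0 = 1 ∧ kron 0 1 = 0 ∧ kron 1 0 = 0 ∧ kron 1 1 = 1 := by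
  simp [kron]

variable (M : Matrix (Fin 2) (Fin 2) ℂ)

/-- A finite check of polynomial identities in the entries of `M`. Neither hermiticity nor the
mass-shell condition is needed, since `M.det` stands for `m²`. -/
theorem supercharge_supercharge (j a k b : Fin 2) (u : Comp → ℂ) :
    supercharge (entryMul M) j a (supercharge (entryMul M) k b u)
      + supercharge (entryMul M) k b (supercharge (entryMul M) j a u)
      = (2 * eps a b * eps j k) • centralCharge M.det (entryMul M) u := by
  ext c
  cases c <;>
  · simp only [Pi.add_apply, Pi.smul_apply, supercharge_apply, centralCharge_apply, entryMul_apply,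
      Fin.sum_univ_two, smul_eq_mul, Matrix.det_fin_two]
    rename_i c
    revert c j a k b
    simp only [Fin.forall_fin_two, eps_apply, kron_apply]
    refine ⟨⟨⟨⟨⟨?_, ?_⟩, ?_, ?_⟩, ⟨?_, ?_⟩, ?_, ?_⟩, ⟨⟨?_, ?_⟩, ?_, ?_⟩, ⟨?_, ?_⟩, ?_, ?_⟩,
      ⟨⟨⟨?_, ?_⟩, ?_, ?_⟩, ⟨?_, ?_⟩, ?_, ?_⟩, ⟨⟨?_, ?_⟩, ?_, ?_⟩, ⟨?_, ?_⟩, ?_, ?_⟩ <;>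
      first | ring1 | (ring_nf; simp only [I_sq]; ring1)


theorem supercharge_superchargeBar (j a k b : Fin 2) (u : Comp → ℂ) :
    supercharge (entryMul M) j a (superchargeBar (entryMul M) k b u)
      + superchargeBar (entryMul M) k b (supercharge (entryMul M) j a u)
      = (2 * kron j k * M a b) • u := by
  ext c
  cases c <;>
  · simp only [Pi.add_apply, Pi.smul_apply, supercharge_apply, superchargeBar_apply, entryMul_apply,
      Fin.sum_univ_two, smul_eq_mul]
    rename_i c
    revert c j a k b
    simp only [Fin.forall_fin_two, eps_apply, kron_apply]
    refine ⟨⟨⟨⟨⟨?_, ?_⟩, ?_, ?_⟩, ⟨?_, ?_⟩, ?_, ?_⟩, ⟨⟨?_, ?_⟩, ?_, ?_⟩, ⟨?_, ?_⟩, ?_, ?_⟩,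
      ⟨⟨⟨?_, ?_⟩, ?_, ?_⟩, ⟨?_, ?_⟩, ?_, ?_⟩, ⟨⟨?_, ?_⟩, ?_, ?_⟩, ⟨?_, ?_⟩, ?_, ?_⟩ <;>
      first | ring1 | (ring_nf; simp only [I_sq]; ring1)

theorem centralCharge_supercharge (j a : Fin 2) (u : Comp → ℂ) :
    centralCharge M.det (entryMul M) (supercharge (entryMul M) j a u)
      = supercharge (entryMul M) j a (centralCharge M.det (entryMul M) u) := by
  ext c
  cases c <;>
  · simp only [supercharge_apply, centralCharge_apply, entryMul_apply,
      Fin.sum_univ_two, smul_eq_mul, Matrix.det_fin_two]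
    rename_i c
    revert c j a
    simp only [Fin.forall_fin_two, eps_apply, kron_apply]
    refine ⟨⟨⟨?_, ?_⟩, ?_, ?_⟩, ⟨?_, ?_⟩, ?_, ?_⟩ <;>
      first | ring1 | (ring_nf; simp only [I_sq]; ring1)

theorem centralCharge_superchargeBar (j a : Fin 2) (u : Comp → ℂ) :
    centralCharge M.det (entryMul M) (superchargeBar (entryMul M) j a u)
      = superchargeBar (entryMul M) j a (centralCharge M.det (entryMul M) u) := by
  ext c
  cases c <;>
  · simp only [superchargeBar_apply, centralCharge_apply, entryMul_apply,
      Fin.sum_univ_two, smul_eq_mul, Matrix.det_fin_two]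
    rename_i c
    revert c j a
    simp only [Fin.forall_fin_two, eps_apply, kron_apply]
    refine ⟨⟨⟨?_, ?_⟩, ?_, ?_⟩, ⟨?_, ?_⟩, ?_, ?_⟩ <;>
      first | ring1 | (ring_nf; simp only [I_sq]; ring1)

variable {M} (α : ℂ) (β : ℝ)

theorem conj_gram (hM : ∀ a b, conj (M a b) = M b a) (u v : Comp → ℂ) : conj (gram α β M u v) = gram α β M v u := by
  simp only [gram, gramOp_apply, entryMul_apply, Fin.sum_univ_two, smul_eq_mul, Matrix.det_fin_two,
    eps_apply, map_add, map_mul, map_sub, map_neg, conj_conj, hM, conj_I, conj_ofReal, map_ofNat,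
    map_zero, map_one]
  ring

/-- The odd charges compare the Bose block of `gramOp` with its Fermi block. The `α` and `β` entries
match identically, so supersymmetry puts no condition on the parameters; only positivity does. -/
theorem gram_supercharge (hM : ∀ a b, conj (M a b) = M b a) (j a : Fin 2)
    (u v : Comp → ℂ) :
    gram α β M (superchargeBar (entryMul M) j a u) v
      = gram α β M u (supercharge (entryMul M) j a v) := by
  revert j a
  simp only [gram, gramOp_apply, entryMul_apply, supercharge_apply, superchargeBar_apply,
    Fin.sum_univ_two, smul_eq_mul, Matrix.det_fin_two, Fin.forall_fin_two,
    eps_apply, kron_apply, map_add, map_mul, map_neg, hM, conj_I, map_ofNat,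
    map_zero, map_one]
  refine ⟨⟨?_, ?_⟩, ?_, ?_⟩ <;>
  · ring_nf
    simp only [I_sq]
    ring1

theorem gram_centralCharge (hM : ∀ a b, conj (M a b) = M b a) (u v : Comp → ℂ) :
    gram α β M (centralCharge M.det (entryMul M) u) v
      = gram α β M u (centralCharge M.det (entryMul M) v) := by
  simp only [gram, gramOp_apply, entryMul_apply, centralCharge_apply,
    Fin.sum_univ_two, smul_eq_mul, Matrix.det_fin_two,
    eps_apply, map_add, map_mul, map_sub, map_neg, hM, conj_I,
    map_zero, map_one]
  ring_nf

end

end Hyper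

/-! ### Symmetry and positivity of the inner product at a fixed momentum. -/

namespace Hyper

noncomputable section

open scoped ComplexConjugate Matrix

/-- For a unitary matrix of determinant one the adjoint is the adjugate. -/
theorem su2_form (U : SU2) : U.1 1 1 = conj (U.1 0 0) ∧ U.1 1 0 = -conj (U.1 0 1)
    ∧ U.1 0 0 * conj (U.1 0 0) + U.1 0 1 * conj (U.1 0 1) = 1 := by
  have hU := Matrix.mem_specialUnitaryGroup_iff.1 U.2
  have h1 : star U.1 * U.1 = 1 := Matrix.mem_unitaryGroup_iff'.1 hU.1
  have h2 : U.1 * star U.1 = 1 := Matrix.mem_unitaryGroup_iff.1 hU.1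
  have h3 : star U.1 = U.1.adjugate := by
    calc star U.1 = star U.1 * (U.1 * U.1.adjugate) := by rw [Matrix.mul_adjugate, hU.2]; simp
      _ = U.1.adjugate := by rw [← Matrix.mul_assoc, h1, Matrix.one_mul]
  rw [Matrix.adjugate_fin_two] at h3
  have e1 := congrFun (congrFun h3 0) 0
  have e2 := congrFun (congrFun h3 1) 0
  have e3 := congrFun (congrFun h2 0) 0
  simp [Matrix.star_apply, Matrix.mul_apply, Fin.sum_univ_two] at e1 e2 e3
  exact ⟨e1.symm, by rw [e2, neg_neg], e3⟩

variable (M : Matrix (Fin 2) (Fin 2) ℂ) (α : ℂ) (β : ℝ)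

theorem gram_su2Op (U : SU2) (u v : Comp → ℂ) :
    gram α β M (su2Op U u) (su2Op U v) = gram α β M u v := by
  obtain ⟨h1, h2, h⟩ := su2_form U⁻¹
  simp only [gram, gramOp_apply, entryMul_apply, su2Op_apply, Fin.sum_univ_two, smul_eq_mul,
    eps_apply, map_add, map_mul, map_neg, conj_conj, h1, h2]
  generalize M.det = q
  generalize (U⁻¹).1 0 0 = x at h ⊢
  generalize (U⁻¹).1 0 1 = y at h ⊢
  -- The two sides differ by a multiple of `|x|² + |y|² - 1`, and the coefficient is the Bose part
  -- of `gram`.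
  linear_combination (conj (u (.phi 0)) * (v (.phi 0) - I * β * v (.f 0) - I * conj α * v (.fStar 1))
    + conj (u (.phi 1)) * (v (.phi 1) - I * β * v (.f 1) + I * conj α * v (.fStar 0))
    + conj (u (.phiStar 0)) * (v (.phiStar 0) + I * β * v (.fStar 0) + I * α * v (.f 1))
    + conj (u (.phiStar 1)) * (v (.phiStar 1) + I * β * v (.fStar 1) - I * α * v (.f 0))
    + conj (u (.f 0)) * (q * v (.f 0) + I * β * v (.phi 0) + I * conj α * v (.phiStar 1))
    + conj (u (.f 1)) * (q * v (.f 1) + I * β * v (.phi 1) - I * conj α * v (.phiStar 0))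
    + conj (u (.fStar 0)) * (q * v (.fStar 0) - I * β * v (.phiStar 0) - I * α * v (.phi 1))
    + conj (u (.fStar 1)) * (q * v (.fStar 1) - I * β * v (.phiStar 1) + I * α * v (.phi 0))) * h

theorem su2Op_supercharge (U : SU2) (j a : Fin 2) (u : Comp → ℂ) :
    su2Op U (supercharge (entryMul M) j a u)
      = ∑ k, (U⁻¹).1 j k • supercharge (entryMul M) k a (su2Op U u) := by
  obtain ⟨h1, h2, h⟩ := su2_form U⁻¹
  ext c
  cases c <;>
  · rename_i c
    revert c j a
    simp only [supercharge_apply, su2Op_apply, entryMul_apply, Finset.sum_apply, Pi.smul_apply,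
      Fin.sum_univ_two, smul_eq_mul, Fin.forall_fin_two, eps_apply, kron_apply, h1, h2, map_neg,
      conj_conj]
    generalize (U⁻¹).1 0 0 = x at h ⊢
    generalize (U⁻¹).1 0 1 = y at h ⊢
    refine ⟨⟨⟨?_, ?_⟩, ?_, ?_⟩, ⟨?_, ?_⟩, ?_, ?_⟩ <;>
      grind

/-- The spinor matrices are absorbed in `M`, while the `eps` terms are invariant because the
determinant is one. This is Lorentz invariance at a fixed momentum. -/
theorem gram_spinorOp (A : SL2C) (u v : Comp → ℂ) :
    gram α β M (spinorOp A u) (spinorOp A v) = gram α β ((A⁻¹).1 * M * (A⁻¹).1ᴴ) u v := by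
  have h := (A⁻¹).2
  have hd : ((A⁻¹).1 * M * (A⁻¹).1ᴴ).det = M.det := by
    rw [Matrix.det_mul, Matrix.det_mul, Matrix.det_conjTranspose, h]
    simp
  simp only [gram, gramOp_apply, entryMul_apply, spinorOp_apply, hd]
  generalize M.det = q
  generalize (A⁻¹).1 = B at h ⊢
  rw [Matrix.det_fin_two] at h
  have h' := congrArg conj h
  simp only [Matrix.mul_apply, Matrix.conjTranspose_apply, star_def, Fin.sum_univ_two, smul_eq_mul,
    eps_apply, map_add, map_mul, map_sub, map_one, conj_conj] at h' ⊢
  linear_combination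
    (2 * α * (conj (u (.psiBar 0)) * v (.psi 1) - conj (u (.psiBar 1)) * v (.psi 0))
      + 2 * β * (conj (u (.psiBar 0)) * v (.chi 1) - conj (u (.psiBar 1)) * v (.chi 0))
      - 2 * conj α * (conj (u (.chiBar 0)) * v (.chi 1) - conj (u (.chiBar 1)) * v (.chi 0))
      + 2 * β * (conj (u (.chiBar 0)) * v (.psi 1) - conj (u (.chiBar 1)) * v (.psi 0))) * h
    - (2 * conj α * (conj (u (.psi 0)) * v (.psiBar 1) - conj (u (.psi 1)) * v (.psiBar 0))
      + 2 * β * (conj (u (.psi 0)) * v (.chiBar 1) - conj (u (.psi 1)) * v (.chiBar 0))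
      - 2 * α * (conj (u (.chi 0)) * v (.chiBar 1) - conj (u (.chi 1)) * v (.chiBar 0))
      + 2 * β * (conj (u (.chi 0)) * v (.psiBar 1) - conj (u (.chi 1)) * v (.psiBar 0))) * h'

theorem spinorOp_supercharge (A : SL2C) (j a : Fin 2) (u : Comp → ℂ) :
    spinorOp A (supercharge (entryMul ((A⁻¹).1 * M * (A⁻¹).1ᴴ)) j a u)
      = ∑ b, (A⁻¹).1 a b • supercharge (entryMul M) j b (spinorOp A u) := by
  have h := (A⁻¹).2
  rw [Matrix.det_fin_two] at h
  have h' := congrArg conj h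
  simp only [map_sub, map_mul, map_one] at h'
  ext c
  cases c <;>
  · rename_i c
    revert c j a
    simp only [supercharge_apply, spinorOp_apply, entryMul_apply, Finset.sum_apply, Pi.smul_apply,
      Fin.sum_univ_two, smul_eq_mul, Fin.forall_fin_two, eps_apply, kron_apply, Matrix.mul_apply,
      Matrix.conjTranspose_apply, star_def]
    generalize (A⁻¹).1 = B at h h' ⊢
    refine ⟨⟨⟨?_, ?_⟩, ?_, ?_⟩, ⟨?_, ?_⟩, ?_, ?_⟩ <;>
      first | ring1 | grind

/-- Sufficiency of the bound at a fixed momentum. Bose and Fermi components decouple. Completing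
squares in `φ` and `φ*` leaves `m² - |α|² - β²` times the squares of `f` and `f*`. In the Fermi
block with `m ≠ 0`, squares are completed in `ψ̄` and `χ̄` with respect to `M`; what is left is `(m²
- |α|² - β²) / m²` times the diagonal terms of `ψ` and `χ`. -/
theorem gram_self_nonneg {m : ℝ} (hM : ∀ a b, conj (M a b) = M b a) (hdet : M.det = (m : ℂ) ^ 2)
    (hpos : ∀ x y : ℂ, 0 ≤ (conj x * (M 0 0 * x + M 0 1 * y)
      + conj y * (M 1 0 * x + M 1 1 * y)).re)
    (h : ‖α‖ ^ 2 + β ^ 2 ≤ m ^ 2) (u : Comp → ℂ) : 0 ≤ (gram α β M u u).re := by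
  set n : ℂ → ℂ → ℂ := fun x y =>
    conj x * (M 0 0 * x + M 0 1 * y) + conj y * (M 1 0 * x + M 1 1 * y) with hn
  have hα : α * conj α = (‖α‖ ^ 2 : ℝ) := by rw [mul_conj, normSq_eq_norm_sq]
  have hsq : ∀ x : ℂ, 0 ≤ (conj x * x).re := fun x => by
    rw [mul_comm, mul_conj]
    exact_mod_cast normSq_nonneg x
  have hbose : 0 ≤ (∑ j : Fin 2, (conj (u (.phi j)) * gramOp M.det α β (entryMul M) u (.phi j)
      + conj (u (.phiStar j)) * gramOp M.det α β (entryMul M) u (.phiStar j)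
      + conj (u (.f j)) * gramOp M.det α β (entryMul M) u (.f j)
      + conj (u (.fStar j)) * gramOp M.det α β (entryMul M) u (.fStar j))).re := by
    have key : (∑ j : Fin 2, (conj (u (.phi j)) * gramOp M.det α β (entryMul M) u (.phi j)
        + conj (u (.phiStar j)) * gramOp M.det α β (entryMul M) u (.phiStar j)
        + conj (u (.f j)) * gramOp M.det α β (entryMul M) u (.f j)
        + conj (u (.fStar j)) * gramOp M.det α β (entryMul M) u (.fStar j)))
        = conj (u (.phi 0) - I * β * u (.f 0) - I * conj α * u (.fStar 1))
          * (u (.phi 0) - I * β * u (.f 0) - I * conj α * u (.fStar 1))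
        + conj (u (.phi 1) - I * β * u (.f 1) + I * conj α * u (.fStar 0))
          * (u (.phi 1) - I * β * u (.f 1) + I * conj α * u (.fStar 0))
        + conj (u (.phiStar 0) + I * β * u (.fStar 0) + I * α * u (.f 1))
          * (u (.phiStar 0) + I * β * u (.fStar 0) + I * α * u (.f 1))
        + conj (u (.phiStar 1) + I * β * u (.fStar 1) - I * α * u (.f 0))
          * (u (.phiStar 1) + I * β * u (.fStar 1) - I * α * u (.f 0))
        + ((m ^ 2 - ‖α‖ ^ 2 - β ^ 2 : ℝ) : ℂ) * (conj (u (.f 0)) * u (.f 0)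
          + conj (u (.f 1)) * u (.f 1) + conj (u (.fStar 0)) * u (.fStar 0)
          + conj (u (.fStar 1)) * u (.fStar 1)) := by
      have e : ((m ^ 2 - ‖α‖ ^ 2 - β ^ 2 : ℝ) : ℂ) = (m : ℂ) ^ 2 - α * conj α - (β : ℂ) ^ 2 := by
        rw [hα]; push_cast; ring
      rw [e]
      simp only [gramOp_apply, hdet, Fin.sum_univ_two, smul_eq_mul, eps_apply, map_add, map_sub,
        map_mul, conj_I, conj_ofReal, conj_conj]
      ring_nf
      simp only [I_sq]
      ring1
    rw [key]
    simp only [add_re, re_ofReal_mul]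
    have := hsq
    have h0 : 0 ≤ m ^ 2 - ‖α‖ ^ 2 - β ^ 2 := by linarith
    have h1 := mul_nonneg h0 (add_nonneg (add_nonneg (add_nonneg (hsq (u (.f 0))) (hsq (u (.f 1))))
      (hsq (u (.fStar 0)))) (hsq (u (.fStar 1))))
    exact add_nonneg (add_nonneg (add_nonneg (add_nonneg (hsq _) (hsq _)) (hsq _)) (hsq _)) h1
  have hfermi : 0 ≤ (∑ j : Fin 2, (conj (u (.psi j)) * gramOp M.det α β (entryMul M) u (.psi j)
      + conj (u (.psiBar j)) * gramOp M.det α β (entryMul M) u (.psiBar j)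
      + conj (u (.chi j)) * gramOp M.det α β (entryMul M) u (.chi j)
      + conj (u (.chiBar j)) * gramOp M.det α β (entryMul M) u (.chiBar j))).re := by
    -- In the massless case `M` is singular, but the bound forces `α = β = 0` and the mixed terms
    -- disappear.
    by_cases hm : m = 0
    · have hα0 : α = 0 := by
        rw [← norm_eq_zero]
        rw [hm] at h
        nlinarith [sq_nonneg ‖α‖, sq_nonneg β]
      have hβ0 : β = 0 := by
        rw [hm] at h
        nlinarith [sq_nonneg ‖α‖, sq_nonneg β]
      have key : (∑ j : Fin 2, (conj (u (.psi j)) * gramOp M.det α β (entryMul M) u (.psi j)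
          + conj (u (.psiBar j)) * gramOp M.det α β (entryMul M) u (.psiBar j)
          + conj (u (.chi j)) * gramOp M.det α β (entryMul M) u (.chi j)
          + conj (u (.chiBar j)) * gramOp M.det α β (entryMul M) u (.chiBar j)))
          = ((2 : ℝ) : ℂ) * (n (u (.psiBar 0)) (u (.psiBar 1)) + n (u (.chiBar 0)) (u (.chiBar 1))
            + n (conj (u (.psi 0))) (conj (u (.psi 1)))
            + n (conj (u (.chi 0))) (conj (u (.chi 1)))) := by
        simp only [hn, gramOp_apply, entryMul_apply, Fin.sum_univ_two, smul_eq_mul, eps_apply, hα0,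
          hβ0, conj_conj, map_zero, ofReal_zero]
        push_cast
        ring1
      rw [key, re_ofReal_mul, add_re, add_re, add_re]
      exact mul_nonneg zero_le_two (add_nonneg (add_nonneg (add_nonneg (hpos _ _) (hpos _ _))
        (hpos _ _)) (hpos _ _))
    -- `s` and `t` are the combinations of `ψ` and `χ` that couple to `ψ̄` and to `χ̄`.
    · set s₀ := α * u (.psi 0) + β * u (.chi 0) with hs0
      set s₁ := α * u (.psi 1) + β * u (.chi 1) with hs1
      set t₀ := β * u (.psi 0) - conj α * u (.chi 0) with ht0
      set t₁ := β * u (.psi 1) - conj α * u (.chi 1) with ht1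
      -- The factor `m⁴ = (det M)²` clears the inverse of `M`: the completed squares contain the
      -- adjugate, which is `det M` times that inverse.
      have key : ((m ^ 4 : ℝ) : ℂ) * (∑ j : Fin 2,
          (conj (u (.psi j)) * gramOp M.det α β (entryMul M) u (.psi j)
          + conj (u (.psiBar j)) * gramOp M.det α β (entryMul M) u (.psiBar j)
          + conj (u (.chi j)) * gramOp M.det α β (entryMul M) u (.chi j)
          + conj (u (.chiBar j)) * gramOp M.det α β (entryMul M) u (.chiBar j)))
          = ((2 : ℝ) : ℂ) * (n (M.det * u (.psiBar 0) + (M 0 1 * s₀ + M 1 1 * s₁))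
              (M.det * u (.psiBar 1) - (M 0 0 * s₀ + M 1 0 * s₁))
            + n (M.det * u (.chiBar 0) + (M 0 1 * t₀ + M 1 1 * t₁))
              (M.det * u (.chiBar 1) - (M 0 0 * t₀ + M 1 0 * t₁))
            + ((m ^ 2 * (m ^ 2 - ‖α‖ ^ 2 - β ^ 2) : ℝ) : ℂ)
              * (n (conj (u (.psi 0))) (conj (u (.psi 1)))
                + n (conj (u (.chi 0))) (conj (u (.chi 1))))) := by
        have e : ((m ^ 2 * (m ^ 2 - ‖α‖ ^ 2 - β ^ 2) : ℝ) : ℂ)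
            = M.det * (M.det - α * conj α - (β : ℂ) ^ 2) := by
          rw [hα, hdet]; push_cast; ring
        have e' : ((m ^ 4 : ℝ) : ℂ) = M.det ^ 2 := by
          rw [hdet]; push_cast; ring
        rw [e, e', ofReal_ofNat]
        simp only [hn, hs0, hs1, ht0, ht1, Matrix.det_fin_two, gramOp_apply, entryMul_apply,
          Fin.sum_univ_two, smul_eq_mul, eps_apply, map_add, map_sub,
          map_mul, conj_ofReal, conj_conj, hM]
        ring1
      have h4 : 0 < m ^ 4 := by positivity
      have h0 : 0 ≤ m ^ 2 * (m ^ 2 - ‖α‖ ^ 2 - β ^ 2) := mul_nonneg (sq_nonneg _) (by linarith)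
      have hre := congrArg Complex.re key
      rw [re_ofReal_mul, re_ofReal_mul, add_re, add_re, re_ofReal_mul, add_re] at hre
      refine nonneg_of_mul_nonneg_right ?_ h4
      rw [hre]
      exact mul_nonneg zero_le_two (add_nonneg (add_nonneg (hpos _ _) (hpos _ _))
        (mul_nonneg h0 (add_nonneg (hpos _ _) (hpos _ _))))
  have hsplit : gram α β M u u
      = (∑ j : Fin 2, (conj (u (.phi j)) * gramOp M.det α β (entryMul M) u (.phi j)
      + conj (u (.phiStar j)) * gramOp M.det α β (entryMul M) u (.phiStar j)
      + conj (u (.f j)) * gramOp M.det α β (entryMul M) u (.f j)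
      + conj (u (.fStar j)) * gramOp M.det α β (entryMul M) u (.fStar j)))
      + ∑ j : Fin 2, (conj (u (.psi j)) * gramOp M.det α β (entryMul M) u (.psi j)
      + conj (u (.psiBar j)) * gramOp M.det α β (entryMul M) u (.psiBar j)
      + conj (u (.chi j)) * gramOp M.det α β (entryMul M) u (.chi j)
      + conj (u (.chiBar j)) * gramOp M.det α β (entryMul M) u (.chiBar j)) := by
    rw [gram, ← Finset.sum_add_distrib]
    exact Finset.sum_congr rfl fun j _ => by ring
  rw [hsplit, add_re]
  exact add_nonneg hbose hfermi

end

end Hyper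

namespace Hyper

noncomputable section

open scoped ComplexConjugate Matrix

/-! ### Functions on the mass shell -/

/-- The restriction of the Fourier transform to the mass shell. -/
def hatLin (m : ℝ) : TestFn →ₗ[ℂ] (Mom → ℂ) where
  toFun F := shellTransform m 1 F
  map_add' F G := funext (shellTransform_add m 1 F G)
  map_smul' c F := funext (shellTransform_smul m 1 c F)

/-- The functions on the mass shell. -/
def shellFn (m : ℝ) : Submodule ℂ (Mom → ℂ) := LinearMap.range (hatLin m)

variable {m : ℝ}

/-- The function on the mass shell given by a test function. -/
def hat (m : ℝ) : TestFn →ₗ[ℂ] shellFn m := (hatLin m).rangeRestrict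

theorem hat_apply (F : TestFn) (p : Mom) : (hat m F).1 p = shellTransform m 1 F p := rfl

theorem hat_surjective : Function.Surjective (hat m) := (hatLin m).surjective_rangeRestrict

theorem shellFn_ext {g h : shellFn m} (e : ∀ p, g.1 p = h.1 p) : g = h := Subtype.ext (funext e)

theorem shellFn_continuous (g : shellFn m) : Continuous g.1 := by
  obtain ⟨F, rfl⟩ := hat_surjective g
  exact continuous_shellTransform m 1 F

theorem shellFn_bounded (g : shellFn m) : ∃ C, ∀ p, ‖g.1 p‖ ≤ C := by
  obtain ⟨F, rfl⟩ := hat_surjective g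
  exact ⟨_, norm_shellTransform_le m 1 F⟩

theorem shellFn_integrable (g : shellFn m) : Integrable g.1 (shellMeasure m) := by
  obtain ⟨F, rfl⟩ := hat_surjective g
  obtain ⟨C, -, hC⟩ := exists_shellTransform_bound m (s := 1) (by norm_num) F 4
  exact integrable_shellMeasure_of_bound (continuous_shellTransform m 1 F).aestronglyMeasurable hC

theorem integrable_conj_mul {f : Mom → ℂ} (hf : Continuous f) (g : shellFn m) {C : ℝ}
    (hC : ∀ p, ‖f p‖ ≤ C) : Integrable (fun p => conj (g.1 p) * f p) (shellMeasure m) := by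
  refine ((shellFn_integrable g).norm.mul_const C).mono'
    ((continuous_conj.comp (shellFn_continuous g)).mul hf).aestronglyMeasurable
    (Filter.Eventually.of_forall fun p => ?_)
  rw [norm_mul, RCLike.norm_conj]
  exact mul_le_mul_of_nonneg_left (hC p) (norm_nonneg _)

theorem integrable_shellFn_mul (g h : shellFn m) :
    Integrable (fun p => conj (g.1 p) * h.1 p) (shellMeasure m) := by
  obtain ⟨C, hC⟩ := shellFn_bounded h
  exact integrable_conj_mul (shellFn_continuous h) g hC

/-- The normalization of the inner product. -/
def shellConst : ℝ := 1 / (2 * Real.pi) ^ 3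

theorem shellConst_pos : 0 < shellConst := by
  have := Real.pi_pos
  unfold shellConst
  positivity

/-- The inner product of functions on the mass shell. -/
def shellInner (m : ℝ) : shellFn m →ₗ⋆[ℂ] shellFn m →ₗ[ℂ] ℂ :=
  LinearMap.mk₂'ₛₗ (starRingEnd ℂ) (RingHom.id ℂ)
    (fun g h => (shellConst : ℂ) * ∫ p, conj (g.1 p) * h.1 p ∂shellMeasure m)
    (fun g g' h => by
      rw [← mul_add, ← integral_add (integrable_shellFn_mul _ _) (integrable_shellFn_mul _ _)]
      simp only [Submodule.coe_add, Pi.add_apply, map_add, add_mul])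
    (fun c g h => by
      rw [smul_eq_mul, mul_left_comm, ← integral_const_mul ((starRingEnd ℂ) c)]
      simp only [Submodule.coe_smul, Pi.smul_apply, smul_eq_mul, map_mul, mul_assoc])
    (fun g h h' => by
      rw [← mul_add, ← integral_add (integrable_shellFn_mul _ _) (integrable_shellFn_mul _ _)]
      simp only [Submodule.coe_add, Pi.add_apply, mul_add])
    (fun c g h => by
      rw [RingHom.id_apply, smul_eq_mul, mul_left_comm, ← integral_const_mul c]
      simp only [Submodule.coe_smul, Pi.smul_apply, smul_eq_mul, mul_left_comm])

theorem shellInner_apply (g h : shellFn m) :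
    shellInner m g h = (shellConst : ℂ) * ∫ p, conj (g.1 p) * h.1 p ∂shellMeasure m := rfl

theorem shellInner_hat_conjFn (F G : TestFn) : shellInner m (hat m (conjFn F)) (hat m G)
    = (shellConst : ℂ) * ∫ p, shellTransform m (-1) F p * shellTransform m 1 G p ∂shellMeasure m := by
  simp only [shellInner_apply, hat_apply, shellTransform_conjFn, conj_conj]

/-- The Pauli-Jordan distribution is `i` times the antisymmetrized two-point function; this links
the positive inner product with the causal commutators. -/
theorem pauliJordan_eq_shellInner (F G : TestFn) : pauliJordan m F G
    = I * (shellInner m (hat m (conjFn F)) (hat m G)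
      - shellInner m (hat m (conjFn G)) (hat m F)) := by
  rw [pauliJordan_eq, shellInner_hat_conjFn, shellInner_hat_conjFn, shellConst]
  simp only [mul_comm (shellTransform m (-1) G _)]
  push_cast
  ring

/-- Temperedness rests on the bound of mass-shell transforms by the `L¹` norm. The map is only
required to be additive so that the antilinear `F ↦ hat m (conjFn F)` is covered. -/
theorem continuous_shellInner_of_le (g : shellFn m) (L : TestFn →+ shellFn m)
    (hL : ∀ F p, ‖(L F).1 p‖ ≤ ‖F.toLp 1‖) : Continuous fun F => shellInner m g (L F) := by
  have hb : ∀ F, ‖shellInner m g (L F)‖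
      ≤ shellConst * (∫ p, ‖g.1 p‖ ∂shellMeasure m) * ‖F.toLp 1‖ := by
    intro F
    rw [shellInner_apply, norm_mul, norm_real, Real.norm_of_nonneg shellConst_pos.le, mul_assoc,
      ← integral_mul_const]
    refine mul_le_mul_of_nonneg_left (norm_integral_le_of_norm_le
      ((shellFn_integrable g).norm.mul_const _) (Filter.Eventually.of_forall fun p => ?_))
      shellConst_pos.le
    rw [norm_mul, RCLike.norm_conj]
    exact mul_le_mul_of_nonneg_left (hL F p) (norm_nonneg _)
  refine continuous_of_continuousAt_zero ((shellInner m g).toAddMonoidHom.comp L) ?_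
  rw [ContinuousAt, map_zero, tendsto_zero_iff_norm_tendsto_zero]
  refine squeeze_zero (fun _ => norm_nonneg _) hb ?_
  have h1 : Continuous fun F : TestFn =>
      shellConst * (∫ p, ‖g.1 p‖ ∂shellMeasure m) * ‖F.toLp 1‖ :=
    continuous_const.mul (toLpCLM ℂ ℂ 1 (volume : Measure Spacetime)).continuous.norm
  have h2 := h1.tendsto 0
  have h0 : (0 : TestFn).toLp 1 (volume : Measure Spacetime) = 0 :=
    (toLpCLM ℂ ℂ 1 (volume : Measure Spacetime)).map_zero
  rwa [h0, norm_zero, mul_zero] at h2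

theorem continuous_shellInner_hat (g : shellFn m) : Continuous fun F => shellInner m g (hat m F) :=
  continuous_shellInner_of_le g (hat m).toAddMonoidHom (norm_shellTransform_le m 1)

theorem continuous_shellInner_hat_conjFn (g : shellFn m) :
    Continuous fun F => shellInner m g (hat m (conjFn F)) :=
  continuous_shellInner_of_le g
    (AddMonoidHom.mk' (fun F => hat m (conjFn F)) fun F G => by rw [conjFn_add, map_add])
    fun F p => by
      change ‖shellTransform m 1 (conjFn F) p‖ ≤ _
      rw [shellTransform_conjFn, RCLike.norm_conj]
      exact norm_shellTransform_le m _ F p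

/-- Evaluation at a momentum. -/
def evalAt (p : Mom) : shellFn m →ₗ[ℂ] ℂ := (LinearMap.proj p).comp (shellFn m).subtype

theorem evalAt_apply (p : Mom) (g : shellFn m) : evalAt p g = g.1 p := rfl

/-- Multiplication by a component of the four-momentum. -/
def mulMom (μ : Fin 4) : shellFn m →ₗ[ℂ] shellFn m :=
  LinearMap.restrict (p := shellFn m) (q := shellFn m)
    { toFun := fun (g : Mom → ℂ) p => (kcov m p μ : ℂ) * g p
      map_add' := fun g h => funext fun p => mul_add _ _ _
      map_smul' := fun c g => funext fun p => mul_left_comm _ _ _ }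
    (by
      rintro _ ⟨F, rfl⟩
      refine ⟨I • pd μ F, funext fun p => ?_⟩
      change shellTransform m 1 (I • pd μ F) p = kcov m p μ * shellTransform m 1 F p
      rw [shellTransform_smul, shellTransform_pd]
      push_cast
      linear_combination -(kcov m p μ : ℂ) * shellTransform m 1 F p * I_sq)

theorem mulMom_apply (μ : Fin 4) (g : shellFn m) (p : Mom) :
    (mulMom μ g).1 p = kcov m p μ * g.1 p := rfl

theorem hat_neg_pd (μ : Fin 4) (F : TestFn) : hat m (-(pd μ F)) = I • mulMom μ (hat m F) := by
  refine shellFn_ext fun p => ?_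
  rw [map_neg, Submodule.coe_neg, Pi.neg_apply, hat_apply, shellTransform_pd, Submodule.coe_smul,
    Pi.smul_apply, mulMom_apply, hat_apply, smul_eq_mul]
  push_cast
  ring

theorem conjFn_neg (F : TestFn) : conjFn (-F) = -conjFn F := by
  have := conjFn_smul (-1) F
  simpa using this

theorem hat_dAlembert (F : TestFn) : hat m (dAlembert F) = -((m : ℂ) ^ 2 • hat m F) := by
  have h : ∀ μ (G : TestFn) p, shellTransform m 1 (pd μ (pd μ G)) p
      = -(kcov m p μ : ℂ) ^ 2 * shellTransform m 1 G p := by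
    intro μ G p
    rw [shellTransform_pd, shellTransform_pd]
    push_cast
    linear_combination (kcov m p μ : ℂ) ^ 2 * shellTransform m 1 G p * I_sq
  refine shellFn_ext fun p => ?_
  have hk : ((kcov m p 0 ^ 2 - kcov m p 1 ^ 2 - kcov m p 2 ^ 2 - kcov m p 3 ^ 2 : ℝ) : ℂ)
      = (m ^ 2 : ℝ) := by rw [kcov_sq]
  push_cast at hk
  rw [dAlembert, Fin.sum_univ_three, map_sub, map_add, map_add]
  simp only [Submodule.coe_sub, Submodule.coe_add, Submodule.coe_neg, Submodule.coe_smul,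
    Pi.sub_apply, Pi.add_apply, Pi.neg_apply, Pi.smul_apply, hat_apply, h, smul_eq_mul]
  change -(kcov m p 0 : ℂ) ^ 2 * _ - (-(kcov m p 1 : ℂ) ^ 2 * _ + -(kcov m p 2 : ℂ) ^ 2 * _
    + -(kcov m p 3 : ℂ) ^ 2 * _) = _
  linear_combination -shellTransform m 1 F p * hk

/-- The matrix `σ^μ p_μ` on the mass shell. -/
def shellMatrix (m : ℝ) (p : Mom) : Matrix (Fin 2) (Fin 2) ℂ := slash (shellVec m p)

theorem shellMatrix_apply (p : Mom) (a b : Fin 2) :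
    shellMatrix m p a b = ∑ μ, pauli μ a b * kcov m p μ := by
  conv_rhs => rw [Fin.sum_univ_succ]
  rw [shellMatrix, slash, Matrix.sub_apply, Matrix.sum_apply, sub_eq_add_neg,
    ← Finset.sum_neg_distrib]
  congr 1
  · simp [shellVec, kcov_zero, mul_comm]
  · refine Finset.sum_congr rfl fun i _ => ?_
    rw [kcov_succ, Matrix.smul_apply, smul_eq_mul, ofReal_neg, mul_neg, mul_comm]
    fin_cases i <;> rfl

theorem conj_shellMatrix (p : Mom) (a b : Fin 2) : conj (shellMatrix m p a b) = shellMatrix m p b a :=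
  (slash_isHermitian (shellVec m p)).apply b a

theorem det_shellMatrix (p : Mom) : (shellMatrix m p).det = (m : ℂ) ^ 2 := by
  rw [shellMatrix, det_slash, mink_shellVec]
  push_cast
  rfl

theorem shellMatrix_nonneg (p : Mom) (x y : ℂ) :
    0 ≤ (conj x * (shellMatrix m p 0 0 * x + shellMatrix m p 0 1 * y)
      + conj y * (shellMatrix m p 1 0 * x + shellMatrix m p 1 1 * y)).re :=
  slash_nonneg (shellVec_zero_nonneg m p) (by rw [mink_shellVec]; positivity) x y

theorem shellMatrix_shellAct (A : SL2C) (p : Mom) :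
    shellMatrix m (shellAct m A p) = A.1 * shellMatrix m p * A.1ᴴ := by
  rw [shellMatrix, shellVec_shellAct, slash_lorentz, shellMatrix]

/-- The operators `σ^μ_{a b̄} p_μ`. -/
def mulSlash (a b : Fin 2) : shellFn m →ₗ[ℂ] shellFn m := ∑ μ, pauli μ a b • mulMom μ

theorem evalAt_mulSlash (p : Mom) (a b : Fin 2) (g : shellFn m) :
    evalAt p (mulSlash a b g) = entryMul (shellMatrix m p) a b (evalAt p g) := by
  rw [entryMul_apply, shellMatrix_apply, mulSlash, LinearMap.sum_apply, map_sum, Finset.sum_mul]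
  refine Finset.sum_congr rfl fun μ _ => ?_
  rw [LinearMap.smul_apply, map_smul, evalAt_apply, mulMom_apply, evalAt_apply, smul_eq_mul,
    mul_assoc]

/-- The action of the translations on functions on the mass shell. -/
def phase (a : Spacetime) : shellFn m →ₗ[ℂ] shellFn m :=
  LinearMap.restrict (p := shellFn m) (q := shellFn m)
    { toFun := fun (g : Mom → ℂ) p => cexp (I * (shellDot m p a : ℂ)) * g p
      map_add' := fun g h => funext fun p => mul_add _ _ _
      map_smul' := fun c g => funext fun p => mul_left_comm _ _ _ }
    (by
      rintro _ ⟨F, rfl⟩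
      refine ⟨compSubConstCLM ℂ a F, funext fun p => ?_⟩
      refine (shellTransform_translate m 1 a (F := F) (fun x => ?_) p).trans ?_
      · rw [compSubConstCLM_apply, add_sub_cancel_right]
      · rw [one_mul]; rfl)

theorem phase_apply (a : Spacetime) (g : shellFn m) (p : Mom) :
    (phase a g).1 p = cexp (I * (shellDot m p a : ℂ)) * g.1 p := rfl

theorem phase_hat (a : Spacetime) {F G : TestFn} (h : ∀ x, G (x + a) = F x) :
    phase a (hat m F) = hat m G := shellFn_ext fun p => by
  rw [phase_apply, hat_apply, hat_apply, shellTransform_translate m 1 a h, one_mul]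

/-- The action of the Lorentz group on functions on the mass shell. -/
def boost (A : SL2C) : shellFn m →ₗ[ℂ] shellFn m :=
  LinearMap.restrict (p := shellFn m) (q := shellFn m)
    { toFun := fun (g : Mom → ℂ) p => g (shellAct m A⁻¹ p)
      map_add' := fun g h => rfl
      map_smul' := fun c g => rfl }
    (by
      rintro _ ⟨F, rfl⟩
      refine ⟨compCLMOfContinuousLinearEquiv ℂ (lorentzEquiv A⁻¹) F, funext fun p => ?_⟩
      refine Eq.trans ?_ (shellTransform_lorentz m 1 A (F := F)
        (G := compCLMOfContinuousLinearEquiv ℂ (lorentzEquiv A⁻¹) F) (fun x => ?_)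
        (shellAct m A⁻¹ p))
      · rw [← shellAct_mul, mul_inv_cancel, shellAct_one]; rfl
      · change F (lorentz A⁻¹ (lorentz A x)) = F x
        rw [← lorentz_mul, inv_mul_cancel, lorentz_one])

theorem boost_apply (A : SL2C) (g : shellFn m) (p : Mom) :
    (boost A g).1 p = g.1 (shellAct m A⁻¹ p) := rfl

theorem boost_hat (A : SL2C) {F G : TestFn} (h : ∀ x, G (lorentz A x) = F x) :
    boost A (hat m F) = hat m G := shellFn_ext fun p => by
  rw [boost_apply, hat_apply, hat_apply, ← shellTransform_lorentz m 1 A h, ← shellAct_mul,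
    mul_inv_cancel, shellAct_one]

theorem continuous_lorentz (x : Spacetime) : Continuous fun A : SL2C => lorentz A x := by
  unfold lorentz
  have h : Continuous fun A : SL2C => A.1 := continuous_subtype_val
  fun_prop

/-- Dominated convergence in the group parameter needs a first countable topology. -/
instance : FirstCountableTopology SL2C :=
  inferInstanceAs (FirstCountableTopology {A : Fin 2 → Fin 2 → ℂ // Matrix.det A = 1})

/-- A bound of `h` is also a bound of every boost of `h`, so `C ‖g‖` dominates uniformly in `A`. -/
theorem continuous_shellInner_boost (g h : shellFn m) :
    Continuous fun A : SL2C => shellInner m g (boost A h) := by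
  obtain ⟨C, hC⟩ := shellFn_bounded h
  refine continuous_const.mul (continuous_of_dominated
    (fun A => (integrable_shellFn_mul g (boost A h)).aestronglyMeasurable)
    (bound := fun p => ‖g.1 p‖ * C) (fun A => Filter.Eventually.of_forall fun p => ?_)
    ((shellFn_integrable g).norm.mul_const C) (Filter.Eventually.of_forall fun p => ?_))
  · rw [norm_mul, RCLike.norm_conj]
    exact mul_le_mul_of_nonneg_left (hC _) (norm_nonneg _)
  · exact continuous_const.mul ((shellFn_continuous h).comp (continuous_spatial.comp
      ((continuous_lorentz _).comp continuous_inv)))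

theorem continuous_shellInner_phase (g h : shellFn m) :
    Continuous fun a : Spacetime => shellInner m g (phase a h) := by
  obtain ⟨C, hC⟩ := shellFn_bounded h
  refine continuous_const.mul (continuous_of_dominated
    (fun A => (integrable_shellFn_mul g (phase A h)).aestronglyMeasurable)
    (bound := fun p => ‖g.1 p‖ * C) (fun A => Filter.Eventually.of_forall fun p => ?_)
    ((shellFn_integrable g).norm.mul_const C) (Filter.Eventually.of_forall fun p => ?_))
  · rw [norm_mul, RCLike.norm_conj, phase_apply, norm_mul, mul_comm I, norm_exp_ofReal_mul_I, one_mul]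
    exact mul_le_mul_of_nonneg_left (hC _) (norm_nonneg _)
  · simp only [phase_apply, shellDot_eq]
    fun_prop

end

end Hyper

namespace Hyper

noncomputable section

open scoped ComplexConjugate Matrix
open SuperFock

/-! ### The one-particle space -/

/-- The sum over the components. -/
def compSum (x : Comp → ℂ) : ℂ :=
  ∑ j : Fin 2, (x (.phi j) + x (.phiStar j) + x (.f j) + x (.fStar j) + x (.psi j) + x (.psiBar j)
    + x (.chi j) + x (.chiBar j))

theorem gram_eq_compSum (α : ℂ) (β : ℝ) (M : Matrix (Fin 2) (Fin 2) ℂ) (u v : Comp → ℂ) :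
    gram α β M u v = compSum fun c => conj (u c) * gramOp M.det α β (entryMul M) v c := rfl

theorem compSum_add (x y : Comp → ℂ) : compSum (fun c => x c + y c) = compSum x + compSum y := by
  simp only [compSum, Fin.sum_univ_two]
  ring

theorem compSum_mul (r : ℂ) (x : Comp → ℂ) : compSum (fun c => r * x c) = r * compSum x := by
  simp only [compSum, Fin.sum_univ_two]
  ring

theorem continuous_compSum {X : Type} [TopologicalSpace X] {x : X → Comp → ℂ}
    (h : ∀ c, Continuous fun t => x t c) : Continuous fun t => compSum (x t) := by
  unfold compSum
  exact continuous_finsetSum _ fun j _ => (((((((h _).add (h _)).add (h _)).add (h _)).add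
    (h _)).add (h _)).add (h _)).add (h _)

theorem integrable_compSum {ν : Measure Mom} {x : Mom → Comp → ℂ}
    (h : ∀ c, Integrable (fun t => x t c) ν) : Integrable (fun t => compSum (x t)) ν :=
  integrable_finsetSum _ fun _ _ => (((((((h _).add (h _)).add (h _)).add (h _)).add
    (h _)).add (h _)).add (h _)).add (h _)

theorem integral_compSum {ν : Measure Mom} {x : Mom → Comp → ℂ}
    (h : ∀ c, Integrable (fun t => x t c) ν) :
    ∫ t, compSum (x t) ∂ν = compSum fun c => ∫ t, x t c ∂ν := by
  have h2 := fun j => (h (.phi j)).add (h (.phiStar j))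
  have h3 := fun j => (h2 j).add (h (.f j))
  have h4 := fun j => (h3 j).add (h (.fStar j))
  have h5 := fun j => (h4 j).add (h (.psi j))
  have h6 := fun j => (h5 j).add (h (.psiBar j))
  have h7 := fun j => (h6 j).add (h (.chi j))
  have h8 := fun j => (h7 j).add (h (.chiBar j))
  unfold compSum
  refine (integral_finsetSum _ fun j _ => h8 j).trans (Finset.sum_congr rfl fun j _ => ?_)
  refine (integral_add (h7 j) (h _)).trans ?_
  congr 1
  refine (integral_add (h6 j) (h _)).trans ?_
  congr 1
  refine (integral_add (h5 j) (h _)).trans ?_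
  congr 1
  refine (integral_add (h4 j) (h _)).trans ?_
  congr 1
  refine (integral_add (h3 j) (h _)).trans ?_
  congr 1
  refine (integral_add (h2 j) (h _)).trans ?_
  congr 1
  exact integral_add (h _) (h _)

variable {m : ℝ}

/-- One-particle states. -/
abbrev OneParticle (m : ℝ) : Type := Comp → shellFn m

/-- The value of a one-particle state at a momentum. -/
def valueAt (p : Mom) (u : OneParticle m) : Comp → ℂ := evalAt p ∘ u

theorem valueAt_apply (p : Mom) (u : OneParticle m) (c : Comp) : valueAt p u c = (u c).1 p := rfl

theorem valueAt_add (p : Mom) (u v : OneParticle m) :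
    valueAt p (u + v) = valueAt p u + valueAt p v := rfl

theorem valueAt_smul (p : Mom) (r : ℂ) (u : OneParticle m) :
    valueAt p (r • u) = r • valueAt p u := rfl

theorem oneParticle_ext {u v : OneParticle m} (h : ∀ p, valueAt p u = valueAt p v) : u = v :=
  funext fun c => shellFn_ext fun p => congrFun (h p) c

/-- The operator which defines the inner product of one-particle states. -/
def oneGram (m : ℝ) (α : ℂ) (β : ℝ) : OneParticle m →ₗ[ℂ] OneParticle m :=
  gramOp ((m : ℂ) ^ 2) α β mulSlash

theorem valueAt_oneGram (p : Mom) (α : ℂ) (β : ℝ) (u : OneParticle m) :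
    valueAt p (oneGram m α β u) = gramOp (shellMatrix m p).det α β (entryMul (shellMatrix m p))
      (valueAt p u) := by
  rw [det_shellMatrix]
  exact gramOp_comp (evalAt p) (evalAt_mulSlash p) _ α β u

/-- The inner product of one-particle states. -/
def oneForm (m : ℝ) (α : ℂ) (β : ℝ) : OneParticle m →ₗ⋆[ℂ] OneParticle m →ₗ[ℂ] ℂ :=
  LinearMap.mk₂'ₛₗ (starRingEnd ℂ) (RingHom.id ℂ)
    (fun u v => compSum fun c => shellInner m (u c) (oneGram m α β v c))
    (fun u u' v => by
      rw [← compSum_add]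
      simp only [Pi.add_apply, map_add, LinearMap.add_apply])
    (fun r u v => by
      rw [smul_eq_mul, ← compSum_mul]
      simp only [Pi.smul_apply, LinearMap.map_smulₛₗ, LinearMap.smul_apply, smul_eq_mul])
    (fun u v v' => by
      rw [← compSum_add]
      simp only [Pi.add_apply, map_add])
    (fun r u v => by
      rw [RingHom.id_apply, smul_eq_mul, ← compSum_mul]
      simp only [Pi.smul_apply, map_smul, smul_eq_mul])

theorem oneForm_apply (α : ℂ) (β : ℝ) (u v : OneParticle m) :
    oneForm m α β u v = compSum fun c => shellInner m (u c) (oneGram m α β v c) := rfl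

/-- Adjointness and invariance on the one-particle space can be verified momentum by momentum,
through `gram`. -/
theorem oneForm_eq_integral (α : ℂ) (β : ℝ) (u v : OneParticle m) : oneForm m α β u v
    = (shellConst : ℂ)
      * ∫ p, gram α β (shellMatrix m p) (valueAt p u) (valueAt p v) ∂shellMeasure m := by
  simp only [gram_eq_compSum, ← valueAt_oneGram, valueAt_apply]
  rw [integral_compSum fun c => integrable_shellFn_mul (u c) (oneGram m α β v c), ← compSum_mul]
  rfl

theorem conj_oneForm (α : ℂ) (β : ℝ) (u v : OneParticle m) :
    conj (oneForm m α β u v) = oneForm m α β v u := by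
  rw [oneForm_eq_integral, oneForm_eq_integral, map_mul, conj_ofReal, ← integral_conj]
  simp only [conj_gram α β (conj_shellMatrix _)]

theorem conj_compSum (x : Comp → ℂ) : conj (compSum x) = compSum fun c => conj (x c) := by
  simp only [compSum, map_sum, map_add]

theorem conj_shellInner (g h : shellFn m) : conj (shellInner m g h) = shellInner m h g := by
  rw [shellInner_apply, shellInner_apply, map_mul, conj_ofReal, ← integral_conj]
  simp only [map_mul, conj_conj, mul_comm]

/-- Hermiticity moves `oneGram` to the left argument, so that continuity in the right one follows
component by component. -/
theorem oneForm_apply' (α : ℂ) (β : ℝ) (u v : OneParticle m) :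
    oneForm m α β u v = compSum fun c => shellInner m (oneGram m α β u c) (v c) := by
  rw [← conj_oneForm, oneForm_apply, conj_compSum]
  simp only [conj_shellInner]

open Classical in
/-- The one-particle states with a single component. -/
def single (c : Comp) : shellFn m →ₗ[ℂ] OneParticle m := LinearMap.single ℂ (fun _ => shellFn m) c

open Classical in
theorem single_apply (c d : Comp) (g : shellFn m) : single c g d = if d = c then g else 0 := by
  rw [single, LinearMap.single_apply, Pi.single_apply]

theorem compSum_single (c : Comp) (g : shellFn m) (L : Comp → shellFn m →ₗ[ℂ] ℂ) :
    compSum (fun d => L d (single c g d)) = L c g := by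
  classical
  cases c <;> rename_i c <;> fin_cases c <;> simp [compSum, single_apply]

theorem oneForm_single_right (α : ℂ) (β : ℝ) (u : OneParticle m) (c : Comp) (g : shellFn m) :
    oneForm m α β u (single c g) = shellInner m (oneGram m α β u c) g := by
  rw [oneForm_apply', compSum_single c g fun d => shellInner m (oneGram m α β u d)]

theorem oneForm_single_left (α : ℂ) (β : ℝ) (v : OneParticle m) (c : Comp) (g : shellFn m) :
    oneForm m α β (single c g) v = shellInner m g (oneGram m α β v c) := by
  rw [← conj_oneForm, oneForm_single_right, conj_shellInner]

theorem gram_parityOp (α : ℂ) (β : ℝ) (M : Matrix (Fin 2) (Fin 2) ℂ) (u v : Comp → ℂ) :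
    gram α β M (parityOp u) v = gram α β M u (parityOp v) := by
  simp only [gram, gramOp_apply, parityOp_apply, Fin.sum_univ_two, smul_eq_mul, map_neg]
  ring

/-- The one-particle space of the hyper-multiplet. -/
def oneParticle (m : ℝ) (α : ℂ) (β : ℝ) (h : ‖α‖ ^ 2 + β ^ 2 ≤ m ^ 2) :
    GradedForm (OneParticle m) where
  s := oneForm m α β
  γ := parityOp
  γ_γ := parityOp_parityOp
  symm := conj_oneForm α β
  nonneg u := by
    have hi : Integrable (fun p => gram α β (shellMatrix m p) (valueAt p u) (valueAt p u))
        (shellMeasure m) := by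
      simp only [gram_eq_compSum, ← valueAt_oneGram]
      exact integrable_compSum fun c => integrable_shellFn_mul (u c) (oneGram m α β u c)
    rw [oneForm_eq_integral, re_ofReal_mul]
    refine mul_nonneg shellConst_pos.le ?_
    have h1 := integral_re hi
    simp only [RCLike.re_to_complex] at h1
    rw [← h1]
    exact integral_nonneg fun p => gram_self_nonneg _ α β (conj_shellMatrix p) (det_shellMatrix p)
      (shellMatrix_nonneg p) h _
  γ_s u v := by
    rw [oneForm_eq_integral, oneForm_eq_integral]
    have e : ∀ p (w : OneParticle m), valueAt p (parityOp w) = parityOp (valueAt p w) :=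
      fun p w => parityOp_comp (evalAt p) w
    simp only [e, gram_parityOp]

/-! ### The charges and the symmetries on the one-particle space -/

/-- The supercharges on the one-particle space. -/
def oneQ (j a : Fin 2) : OneParticle m →ₗ[ℂ] OneParticle m := supercharge mulSlash j a

/-- The adjoint supercharges on the one-particle space. -/
def oneQbar (j a : Fin 2) : OneParticle m →ₗ[ℂ] OneParticle m := superchargeBar mulSlash j a

/-- The central charge on the one-particle space. -/
def oneZ : OneParticle m →ₗ[ℂ] OneParticle m := centralCharge ((m : ℂ) ^ 2) mulSlash

/-- The momentum operators on the one-particle space. -/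
def oneP (μ : Fin 4) : OneParticle m →ₗ[ℂ] OneParticle m := (mulMom μ).compLeft Comp

theorem valueAt_oneQ (p : Mom) (j a : Fin 2) (u : OneParticle m) :
    valueAt p (oneQ j a u) = supercharge (entryMul (shellMatrix m p)) j a (valueAt p u) :=
  supercharge_comp (evalAt p) (evalAt_mulSlash p) j a u

theorem valueAt_oneQbar (p : Mom) (j a : Fin 2) (u : OneParticle m) :
    valueAt p (oneQbar j a u) = superchargeBar (entryMul (shellMatrix m p)) j a (valueAt p u) :=
  superchargeBar_comp (evalAt p) (evalAt_mulSlash p) j a u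

theorem valueAt_oneZ (p : Mom) (u : OneParticle m) : valueAt p (oneZ u)
    = centralCharge (shellMatrix m p).det (entryMul (shellMatrix m p)) (valueAt p u) := by
  rw [det_shellMatrix]
  exact centralCharge_comp (evalAt p) (evalAt_mulSlash p) _ u

theorem valueAt_oneP (p : Mom) (μ : Fin 4) (u : OneParticle m) :
    valueAt p (oneP μ u) = (kcov m p μ : ℂ) • valueAt p u := rfl

theorem oneQ_oneQ (j a k b : Fin 2) :
    (oneQ j a * oneQ k b + oneQ k b * oneQ j a : Module.End ℂ (OneParticle m))
      = (2 * eps a b * eps j k) • oneZ :=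
  LinearMap.ext fun u => oneParticle_ext fun p => by
    rw [LinearMap.add_apply, valueAt_add, Module.End.mul_apply, Module.End.mul_apply,
      LinearMap.smul_apply, valueAt_smul, valueAt_oneZ]
    simp only [valueAt_oneQ, supercharge_supercharge]

theorem oneQ_oneQbar (j a k b : Fin 2) :
    (oneQ j a * oneQbar k b + oneQbar k b * oneQ j a : Module.End ℂ (OneParticle m))
      = (2 * kron j k) • ∑ μ, pauli μ a b • oneP μ :=
  LinearMap.ext fun u => oneParticle_ext fun p => by
    have e : valueAt p ((∑ μ, pauli μ a b • oneP μ : Module.End ℂ (OneParticle m)) u)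
        = shellMatrix m p a b • valueAt p u := by
      ext c
      rw [valueAt_apply, LinearMap.sum_apply, Finset.sum_apply, shellMatrix_apply, Pi.smul_apply,
        smul_eq_mul, Finset.sum_mul, Submodule.coe_sum, Finset.sum_apply]
      exact Finset.sum_congr rfl fun μ _ => (mul_assoc _ _ _).symm
    rw [LinearMap.add_apply, valueAt_add, Module.End.mul_apply, Module.End.mul_apply,
      LinearMap.smul_apply, valueAt_smul, e, smul_smul]
    simp only [valueAt_oneQ, valueAt_oneQbar, supercharge_superchargeBar]

theorem oneZ_oneQ (j a : Fin 2) :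
    (oneZ * oneQ j a : Module.End ℂ (OneParticle m)) = oneQ j a * oneZ :=
  LinearMap.ext fun u => oneParticle_ext fun p => by
    rw [Module.End.mul_apply, Module.End.mul_apply, valueAt_oneZ, valueAt_oneQ, valueAt_oneQ,
      valueAt_oneZ, centralCharge_supercharge]

theorem oneZ_oneQbar (j a : Fin 2) :
    (oneZ * oneQbar j a : Module.End ℂ (OneParticle m)) = oneQbar j a * oneZ :=
  LinearMap.ext fun u => oneParticle_ext fun p => by
    rw [Module.End.mul_apply, Module.End.mul_apply, valueAt_oneZ, valueAt_oneQbar, valueAt_oneQbar,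
      valueAt_oneZ, centralCharge_superchargeBar]

theorem oneQ_oneP (j a : Fin 2) (μ : Fin 4) :
    (oneQ j a * oneP μ : Module.End ℂ (OneParticle m)) = oneP μ * oneQ j a :=
  LinearMap.ext fun u => oneParticle_ext fun p => by
    rw [Module.End.mul_apply, Module.End.mul_apply, valueAt_oneQ, valueAt_oneP, valueAt_oneP,
      valueAt_oneQ, map_smul]

theorem oneZ_oneP (μ : Fin 4) :
    (oneZ * oneP μ : Module.End ℂ (OneParticle m)) = oneP μ * oneZ :=
  LinearMap.ext fun u => oneParticle_ext fun p => by
    rw [Module.End.mul_apply, Module.End.mul_apply, valueAt_oneZ, valueAt_oneP, valueAt_oneP,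
      valueAt_oneZ, map_smul]

theorem oneForm_oneQ (α : ℂ) (β : ℝ) (j a : Fin 2) (u v : OneParticle m) :
    oneForm m α β (oneQbar j a u) v = oneForm m α β u (oneQ j a v) := by
  rw [oneForm_eq_integral, oneForm_eq_integral]
  simp only [valueAt_oneQ, valueAt_oneQbar, gram_supercharge α β (conj_shellMatrix _)]

theorem oneForm_oneZ (α : ℂ) (β : ℝ) (u v : OneParticle m) :
    oneForm m α β (oneZ u) v = oneForm m α β u (oneZ v) := by
  rw [oneForm_eq_integral, oneForm_eq_integral]
  simp only [valueAt_oneZ, gram_centralCharge α β (conj_shellMatrix _)]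

theorem gram_smul_left (α : ℂ) (β : ℝ) (M : Matrix (Fin 2) (Fin 2) ℂ) (r : ℂ) (u v : Comp → ℂ) :
    gram α β M (r • u) v = conj r * gram α β M u v := by
  rw [gram_eq_compSum, gram_eq_compSum, ← compSum_mul]
  simp only [Pi.smul_apply, smul_eq_mul, map_mul, mul_assoc]

theorem gram_smul_right (α : ℂ) (β : ℝ) (M : Matrix (Fin 2) (Fin 2) ℂ) (r : ℂ) (u v : Comp → ℂ) :
    gram α β M u (r • v) = r * gram α β M u v := by
  rw [gram_eq_compSum, gram_eq_compSum, ← compSum_mul]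
  simp only [map_smul, Pi.smul_apply, smul_eq_mul, mul_left_comm]

theorem oneForm_oneP (α : ℂ) (β : ℝ) (μ : Fin 4) (u v : OneParticle m) :
    oneForm m α β (oneP μ u) v = oneForm m α β u (oneP μ v) := by
  rw [oneForm_eq_integral, oneForm_eq_integral]
  simp only [valueAt_oneP, gram_smul_left, gram_smul_right, conj_ofReal]

/-- The representation of the translations on the one-particle space. -/
def oneTransl : Multiplicative Spacetime →* Module.End ℂ (OneParticle m) where
  toFun a := (phase a.toAdd).compLeft Comp
  map_one' := LinearMap.ext fun u => funext fun c => shellFn_ext fun p => by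
    change cexp (I * (shellDot m p 0 : ℂ)) * (u c).1 p = (u c).1 p
    simp [shellDot_eq]
  map_mul' a b := LinearMap.ext fun u => funext fun c => shellFn_ext fun p => by
    change cexp (I * (shellDot m p (a.toAdd + b.toAdd) : ℂ)) * (u c).1 p
      = cexp (I * (shellDot m p a.toAdd : ℂ)) * (cexp (I * (shellDot m p b.toAdd : ℂ)) * (u c).1 p)
    rw [← mul_assoc, ← Complex.exp_add, ← mul_add]
    simp only [shellDot_eq, PiLp.add_apply, mul_add, Finset.sum_add_distrib, ofReal_add]

theorem valueAt_oneTransl (p : Mom) (a : Multiplicative Spacetime) (u : OneParticle m) :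
    valueAt p (oneTransl a u) = cexp (I * (shellDot m p a.toAdd : ℂ)) • valueAt p u := rfl

/-- The representation of `SU(2)` on the one-particle space. -/
def oneSU2 : SU2 →* Module.End ℂ (OneParticle m) where
  toFun U := su2Op U
  map_one' := by
    refine LinearMap.ext fun u => funext fun c => ?_
    cases c <;> rename_i c <;> fin_cases c <;> simp [su2Op_apply]
  map_mul' U V := by
    refine LinearMap.ext fun u => funext fun c => ?_
    cases c <;> rw [Module.End.mul_apply] <;>
      simp only [su2Op_apply, mul_inv_rev, Submonoid.coe_mul, Matrix.mul_apply, Fin.sum_univ_two,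
        map_add, map_mul] <;> module

theorem valueAt_oneSU2 (p : Mom) (U : SU2) (u : OneParticle m) :
    valueAt p (oneSU2 U u) = su2Op U (valueAt p u) := su2Op_comp (evalAt p) U u

/-- The representation of `SL(2, ℂ)` on the one-particle space. -/
def oneLor : SL2C →* Module.End ℂ (OneParticle m) where
  toFun A := (spinorOp A).comp ((boost A).compLeft Comp)
  map_one' := by
    have h : ∀ g : shellFn m, boost 1 g = g := fun g => shellFn_ext fun p => by
      rw [boost_apply, inv_one, shellAct_one]
    refine LinearMap.ext fun u => funext fun c => ?_
    cases c <;> rename_i c <;> fin_cases c <;> simp [spinorOp_apply, h]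
  map_mul' A B := by
    have h : ∀ g : shellFn m, boost (A * B) g = boost A (boost B g) := fun g =>
      shellFn_ext fun p => by
        rw [boost_apply, boost_apply, boost_apply, mul_inv_rev, shellAct_mul]
    refine LinearMap.ext fun u => funext fun c => ?_
    cases c <;> rw [Module.End.mul_apply] <;>
      simp only [LinearMap.comp_apply, LinearMap.compLeft_apply, Function.comp_apply,
        spinorOp_apply, mul_inv_rev, Matrix.SpecialLinearGroup.coe_mul, Matrix.mul_apply,
        Fin.sum_univ_two, map_add, map_mul, map_smul, h] <;> module

theorem valueAt_oneLor (p : Mom) (A : SL2C) (u : OneParticle m) :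
    valueAt p (oneLor A u) = spinorOp A (valueAt (shellAct m A⁻¹ p) u) :=
  spinorOp_comp (evalAt p) A _

theorem oneForm_oneTransl (α : ℂ) (β : ℝ) (a : Multiplicative Spacetime) (u v : OneParticle m) :
    oneForm m α β (oneTransl a u) (oneTransl a v) = oneForm m α β u v := by
  rw [oneForm_eq_integral, oneForm_eq_integral]
  have e : ∀ t : ℝ, ∀ z : ℂ, cexp (I * t) * (conj (cexp (I * t)) * z) = z := fun t z => by
    rw [← mul_assoc, ← exp_conj, ← Complex.exp_add]
    simp
  simp only [valueAt_oneTransl, gram_smul_left, gram_smul_right, e]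

theorem oneForm_oneSU2 (α : ℂ) (β : ℝ) (U : SU2) (u v : OneParticle m) :
    oneForm m α β (oneSU2 U u) (oneSU2 U v) = oneForm m α β u v := by
  rw [oneForm_eq_integral, oneForm_eq_integral]
  simp only [valueAt_oneSU2, gram_su2Op]

/-- The spinor transformation replaces the momentum matrix at `p` by the one at `shellAct m A⁻¹ p`.
The integrand is then a function of that momentum alone, and the measure is invariant. -/
theorem oneForm_oneLor (α : ℂ) (β : ℝ) (A : SL2C) (u v : OneParticle m) :
    oneForm m α β (oneLor A u) (oneLor A v) = oneForm m α β u v := by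
  rw [oneForm_eq_integral, oneForm_eq_integral]
  simp only [valueAt_oneLor, gram_spinorOp, ← shellMatrix_shellAct]
  congr 1
  have hinv : ∀ B C : SL2C, B * C = 1 → ∀ p, shellAct m B (shellAct m C p) = p := fun B C h p => by
    rw [← shellAct_mul, h, shellAct_one]
  let e : Mom ≃ₜ Mom :=
    { toFun := shellAct m A⁻¹
      invFun := shellAct m A
      left_inv := hinv _ _ (mul_inv_cancel A)
      right_inv := hinv _ _ (inv_mul_cancel A)
      continuous_toFun := continuous_shellAct m _
      continuous_invFun := continuous_shellAct m _ }
  exact (measurePreserving_shellAct m A⁻¹).integral_comp e.measurableEmbedding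
    (fun p => gram α β (shellMatrix m p) (valueAt p u) (valueAt p v))

theorem oneLor_oneQ (A : SL2C) (j a : Fin 2) (u : OneParticle m) :
    oneLor A (oneQ j a u) = ∑ b, (A⁻¹).1 a b • oneQ j b (oneLor A u) :=
  oneParticle_ext fun p => by
    have e : valueAt p (∑ b, (A⁻¹).1 a b • oneQ j b (oneLor A u))
        = ∑ b, (A⁻¹).1 a b • valueAt p (oneQ j b (oneLor A u)) := by
      rw [Fin.sum_univ_two, Fin.sum_univ_two]; rfl
    rw [e, valueAt_oneLor, valueAt_oneQ, shellMatrix_shellAct, spinorOp_supercharge]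
    simp only [valueAt_oneQ, valueAt_oneLor]

theorem oneSU2_oneQ (U : SU2) (j a : Fin 2) (u : OneParticle m) :
    oneSU2 U (oneQ j a u) = ∑ k, (U⁻¹).1 j k • oneQ k a (oneSU2 U u) :=
  oneParticle_ext fun p => by
    have e : valueAt p (∑ k, (U⁻¹).1 j k • oneQ k a (oneSU2 U u))
        = ∑ k, (U⁻¹).1 j k • valueAt p (oneQ k a (oneSU2 U u)) := by
      rw [Fin.sum_univ_two, Fin.sum_univ_two]; rfl
    rw [e, valueAt_oneSU2, valueAt_oneQ, su2Op_supercharge]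
    simp only [valueAt_oneQ, valueAt_oneSU2]

theorem oneSU2_oneLor (U : SU2) (A : SL2C) :
    (oneSU2 U * oneLor A : Module.End ℂ (OneParticle m)) = oneLor A * oneSU2 U := by
  refine LinearMap.ext fun u => funext fun c => ?_
  cases c <;>
    simp only [Module.End.mul_apply, oneSU2, oneLor, MonoidHom.coe_mk, OneHom.coe_mk,
      LinearMap.comp_apply, LinearMap.compLeft_apply, Function.comp_apply, spinorOp_apply,
      su2Op_apply, map_sum, map_smul]

theorem oneSU2_oneTransl (U : SU2) (a : Multiplicative Spacetime) :
    (oneSU2 U * oneTransl a : Module.End ℂ (OneParticle m)) = oneTransl a * oneSU2 U :=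
  LinearMap.ext fun u => oneParticle_ext fun p => by
    rw [Module.End.mul_apply, Module.End.mul_apply, valueAt_oneSU2, valueAt_oneTransl,
      valueAt_oneTransl, valueAt_oneSU2, map_smul]

theorem oneLor_oneTransl (A : SL2C) (a : Spacetime) :
    (oneLor A * oneTransl (Multiplicative.ofAdd a) : Module.End ℂ (OneParticle m))
      = oneTransl (Multiplicative.ofAdd (lorentz A a)) * oneLor A :=
  LinearMap.ext fun u => oneParticle_ext fun p => by
    rw [Module.End.mul_apply, Module.End.mul_apply, valueAt_oneLor, valueAt_oneTransl,
      valueAt_oneTransl, valueAt_oneLor, map_smul, toAdd_ofAdd, toAdd_ofAdd]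
    congr 4
    conv_rhs => rw [← shellAct_one m p, ← mul_inv_cancel A, shellAct_mul, shellDot_shellAct]

theorem continuous_oneTransl (α : ℂ) (β : ℝ) (u v : OneParticle m) :
    Continuous fun a : Multiplicative Spacetime => oneForm m α β u (oneTransl a v) := by
  simp only [oneForm_apply']
  exact continuous_compSum fun c =>
    (continuous_shellInner_phase (oneGram m α β u c) (v c)).comp continuous_toAdd

theorem continuous_oneLor (α : ℂ) (β : ℝ) (u v : OneParticle m) :
    Continuous fun A : SL2C => oneForm m α β u (oneLor A v) := by
  have hi : Continuous fun A : SL2C => A⁻¹ := continuous_inv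
  have hA : ∀ a b, Continuous fun A : SL2C => (A⁻¹).1 a b := fun a b =>
    (continuous_subtype_val.comp hi).matrix_elem a b
  have hA' : ∀ a b, Continuous fun A : SL2C => conj ((A⁻¹).1 a b) := fun a b =>
    continuous_conj.comp (hA a b)
  simp only [oneForm_apply']
  refine continuous_compSum fun c => ?_
  have hb := fun d => continuous_shellInner_boost (oneGram m α β u c) (v d)
  cases c <;>
    simp only [oneLor, MonoidHom.coe_mk, OneHom.coe_mk, LinearMap.comp_apply,
      LinearMap.compLeft_apply, spinorOp_apply, Function.comp_apply, map_sum, map_smul, smul_eq_mul]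
  all_goals first
    | exact hb _
    | exact continuous_finsetSum _ fun a _ => (hA _ _).mul (hb _)
    | exact continuous_finsetSum _ fun a _ => (hA' _ _).mul (hb _)

theorem continuous_oneSU2 (α : ℂ) (β : ℝ) (u v : OneParticle m) :
    Continuous fun U : SU2 => oneForm m α β u (oneSU2 U v) := by
  have hA : ∀ a b, Continuous fun U : SU2 => (U⁻¹).1 a b := fun a b =>
    continuous_conj.comp (continuous_subtype_val.matrix_elem b a)
  have hA' : ∀ a b, Continuous fun U : SU2 => conj ((U⁻¹).1 a b) := fun a b =>
    continuous_conj.comp (hA a b)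
  simp only [oneForm_apply']
  refine continuous_compSum fun c => ?_
  cases c <;>
    simp only [oneSU2, MonoidHom.coe_mk, OneHom.coe_mk, su2Op_apply, map_sum, map_smul,
      smul_eq_mul]
  all_goals first
    | exact continuous_const
    | exact continuous_finsetSum _ fun a _ => (hA _ _).mul continuous_const
    | exact continuous_finsetSum _ fun a _ => (hA' _ _).mul continuous_const

end

end Hyper

/-! ### Fields and symmetries as operators on the domain of the Fock space. -/

namespace SuperFock

open TensorAlgebra
open scoped ComplexConjugate

noncomputable section

variable {W : Type} [AddCommGroup W] [Module ℂ W]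

namespace GradedForm

variable (G : GradedForm W)

theorem isParity_false {X : W →ₗ[ℂ] W} (h : ∀ w, G.γ (X w) = X (G.γ w)) : G.IsParity false X := by
  intro d w hw
  rw [Bool.false_xor, IsHom, h, show G.γ w = _ from hw]
  cases d <;> simp

theorem isParity_true {X : W →ₗ[ℂ] W} (h : ∀ w, G.γ (X w) = -X (G.γ w)) : G.IsParity true X := by
  intro d w hw
  rw [Bool.true_xor, IsHom, h, show G.γ w = _ from hw]
  cases d <;> simp

/-- The field operator on the domain. -/
def opField (u v : W) : Module.End ℂ G.dom := G.op (G.fieldOp u v)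

theorem opField_dvec (u v : W) (x : T W) :
    G.opField u v (G.dvec x) = G.dvec (G.fieldOp u v x) := G.op_dvec (G.hasAdj_fieldOp u v) x

theorem opField_add (u v u' v' : W) :
    G.opField (u + u') (v + v') = G.opField u v + G.opField u' v' := G.end_ext fun x => by
  rw [LinearMap.add_apply, opField_dvec, opField_dvec, opField_dvec, fieldOp_add,
    LinearMap.add_apply, map_add]

theorem opField_smul (c : ℂ) (u v : W) :
    G.opField (c • u) (conj c • v) = c • G.opField u v := G.end_ext fun x => by
  rw [LinearMap.smul_apply, opField_dvec, opField_dvec, fieldOp_smul, LinearMap.smul_apply,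
    map_smul]

theorem opField_sum {J : Type*} (t : Finset J) (u v : J → W) :
    G.opField (∑ i ∈ t, u i) (∑ i ∈ t, v i) = ∑ i ∈ t, G.opField (u i) (v i) := by
  classical
  induction t using Finset.induction_on with
  | empty =>
    refine G.end_ext fun x => ?_
    rw [Finset.sum_empty, Finset.sum_empty, Finset.sum_empty, opField_dvec, fieldOp_zero]
    simp
  | insert i t hi ih => rw [Finset.sum_insert hi, Finset.sum_insert hi, Finset.sum_insert hi,
      opField_add, ih]

theorem opField_zero : G.opField 0 0 = 0 := G.opField_sum (∅ : Finset Empty) (fun _ => 0) fun _ => 0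

theorem inner_opField (u v : W) (x y : G.dom) :
    inner ℂ (G.opField u v x : G.Hilb) (y : G.Hilb) = inner ℂ (x : G.Hilb) (G.opField v u y) :=
  G.inner_op (G.form_fieldOp u v) x y

section Continuity

variable {X : Type} [TopologicalSpace X]

/-- Expanding the annihilation operator along `x` involves the moving vector only through its inner
products with fixed one-particle vectors. Temperedness on the Fock space follows from this. -/
theorem continuous_form_ann {L : X → W} {e : Bool} (hL : ∀ t, G.IsHom e (L t))
    (hc : ∀ w, Continuous fun t => G.s (L t) w) (x y : T W) :
    Continuous fun t => G.form y (G.ann (L t) x) := by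
  induction x using G.induction_hom generalizing y with
  | h1 => simpa only [ann_one, map_zero] using continuous_const
  | hadd x x' hx hx' =>
    simp only [map_add]
    exact (hx y).add (hx' y)
  | hsmul c x hx =>
    simp only [map_smul, LinearMap.map_smulₛₗ, smul_eq_mul]
    exact continuous_const.mul (hx y)
  | hmul d w x hw hx =>
    simp only [(hL _).ann_mul hw, map_add, LinearMap.map_smulₛₗ, form_mul_right, smul_eq_mul]
    exact ((continuous_conj.comp (hc w)).mul continuous_const).add (continuous_const.mul (hx _))

theorem continuous_inner_opField {L L' : X → W} {e : Bool} (hL : ∀ t, G.IsHom e (L t))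
    (hL' : ∀ t, G.IsHom e (L' t)) (hc : ∀ w, Continuous fun t => G.s (L t) w)
    (hc' : ∀ w, Continuous fun t => G.s (L' t) w) (u v : G.dom) :
    Continuous fun t => inner ℂ (u : G.Hilb) (G.opField (L t) (L' t) v : G.Hilb) := by
  obtain ⟨x, rfl⟩ := G.dvec_surjective u
  obtain ⟨y, rfl⟩ := G.dvec_surjective v
  have e : ∀ t, inner ℂ (G.dvec x : G.Hilb) (G.opField (L t) (L' t) (G.dvec y) : G.Hilb)
      = G.form y (G.ann (L t) x) + G.form (G.ann (L' t) y) x := fun t => by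
    rw [opField_dvec, coe_dvec, coe_dvec, inner_vec, fieldOp_apply, map_add, LinearMap.add_apply,
      form_mul]
  simp only [e]
  refine (G.continuous_form_ann hL hc x y).add ?_
  simp only [← G.conj_form x]
  exact continuous_conj.comp (G.continuous_form_ann hL' hc' y x)

end Continuity

section Symmetry

variable {Γ Γ₁ Γ₂ Γ₃ Γ₄ : Type} [Group Γ] [Group Γ₁] [Group Γ₂] [Group Γ₃] [Group Γ₄]

theorem unitary_dvec (ρ : Γ →* Module.End ℂ W) (hρ : ∀ g, G.IsSymm (ρ g)) (g : Γ) (x : T W) :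
    (⟨_, G.unitary_mem ρ hρ g (G.dvec x)⟩ : G.dom) = G.dvec (second (ρ g) x) :=
  Subtype.ext (G.unitary_vec ρ hρ g x)

theorem unitary_opField (ρ : Γ →* Module.End ℂ W) (hρ : ∀ g, G.IsSymm (ρ g)) (g : Γ) {e : Bool}
    (u : W) {v : W} (hv : G.IsHom e v) (w : G.dom) :
    G.unitary ρ hρ g (G.opField u v w : G.Hilb)
      = (G.opField (ρ g u) (ρ g v) ⟨_, G.unitary_mem ρ hρ g w⟩ : G.Hilb) := by
  obtain ⟨x, rfl⟩ := G.dvec_surjective w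
  rw [unitary_dvec, opField_dvec, opField_dvec, coe_dvec, coe_dvec, unitary_vec,
    (hρ g).fieldOp u hv]

theorem unitary_op_der (ρ : Γ →* Module.End ℂ W) (hρ : ∀ g, G.IsSymm (ρ g)) (g : Γ) {e : Bool}
    {X X' : W →ₗ[ℂ] W} (h : ∀ w, ρ g (X w) = X' (ρ g w)) (hX : G.HasAdj (G.der e X)) (w : G.dom) :
    ∀ x, G.dvec x = w → G.unitary ρ hρ g (G.op (G.der e X) w : G.Hilb)
      = G.vec (G.der e X' (second (ρ g) x)) := by
  rintro x rfl
  rw [op_dvec G hX, coe_dvec, unitary_vec, G.second_der (hρ g).even h]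

theorem unitary_mul_eq {ρ₁ : Γ₁ →* Module.End ℂ W} {ρ₂ : Γ₂ →* Module.End ℂ W}
    {ρ₃ : Γ₃ →* Module.End ℂ W} {ρ₄ : Γ₄ →* Module.End ℂ W} (h₁ : ∀ g, G.IsSymm (ρ₁ g))
    (h₂ : ∀ g, G.IsSymm (ρ₂ g)) (h₃ : ∀ g, G.IsSymm (ρ₃ g)) (h₄ : ∀ g, G.IsSymm (ρ₄ g))
    {g₁ : Γ₁} {g₂ : Γ₂} {g₃ : Γ₃} {g₄ : Γ₄} (h : ρ₁ g₁ * ρ₂ g₂ = ρ₃ g₃ * ρ₄ g₄) :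
    G.unitary ρ₁ h₁ g₁ * G.unitary ρ₂ h₂ g₂ = G.unitary ρ₃ h₃ g₃ * G.unitary ρ₄ h₄ g₄ :=
  G.isometry_ext fun x => by
    change G.unitary ρ₁ h₁ g₁ (G.unitary ρ₂ h₂ g₂ (G.vec x))
      = G.unitary ρ₃ h₃ g₃ (G.unitary ρ₄ h₄ g₄ (G.vec x))
    simp only [unitary_vec]
    have e := congrArg second h
    rw [second_comp, second_comp] at e
    exact congrArg G.vec (DFunLike.congr_fun e x)

end Symmetry

end GradedForm

end

end SuperFock

namespace Hyper

noncomputable section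

open scoped ComplexConjugate Matrix
open SuperFock

/-! ### The fields -/

/-- The parity of a component. -/
def Comp.odd : Comp → Bool
  | .phi _ | .phiStar _ | .f _ | .fStar _ => false
  | .psi _ | .psiBar _ | .chi _ | .chiBar _ => true

theorem Comp.odd_adj (c : Comp) : c.adj.odd = c.odd := by cases c <;> rfl

theorem Comp.adj_adj (c : Comp) : c.adj.adj = c := by cases c <;> rfl

variable {m : ℝ} {α : ℂ} {β : ℝ} (h : ‖α‖ ^ 2 + β ^ 2 ≤ m ^ 2)

theorem isHom_single (c : Comp) (g : shellFn m) :
    (oneParticle m α β h).IsHom c.odd (single c g) := by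
  classical
  change parityOp (single c g) = if c.odd then -single c g else single c g
  ext1 d
  cases c <;> cases d <;> simp [parityOp_apply, single_apply, Comp.odd]

theorem isHom_single_adj (c : Comp) (g : shellFn m) :
    (oneParticle m α β h).IsHom c.odd (single c.adj g) := by
  rw [← c.odd_adj]
  exact isHom_single h _ g

theorem isSymm_oneTransl (a : Multiplicative Spacetime) :
    (oneParticle m α β h).IsSymm (oneTransl a) where
  even := (oneParticle m α β h).isParity_false fun w =>
    (parityOp_comp (phase a.toAdd) w).symm
  iso := oneForm_oneTransl α β a

theorem isSymm_oneSU2 (U : SU2) : (oneParticle m α β h).IsSymm (oneSU2 U) where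
  even := (oneParticle m α β h).isParity_false fun w => (su2Op_parityOp U w).symm
  iso := oneForm_oneSU2 α β U

theorem isSymm_oneLor (A : SL2C) : (oneParticle m α β h).IsSymm (oneLor A) where
  even := (oneParticle m α β h).isParity_false fun w => by
    refine Eq.trans (spinorOp_parityOp A _).symm (congrArg (spinorOp A) ?_)
    exact (parityOp_comp (boost A) w).symm
  iso := oneForm_oneLor α β A

theorem isParity_oneQ (j a : Fin 2) : (oneParticle m α β h).IsParity true (oneQ j a) :=
  (oneParticle m α β h).isParity_true fun w => by
    change _ = -supercharge mulSlash j a (parityOp w)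
    rw [supercharge_parityOp, neg_neg]
    rfl

theorem isParity_oneQbar (j a : Fin 2) : (oneParticle m α β h).IsParity true (oneQbar j a) :=
  (oneParticle m α β h).isParity_true fun w => by
    change _ = -superchargeBar mulSlash j a (parityOp w)
    rw [superchargeBar_parityOp, neg_neg]
    rfl

theorem isParity_oneZ : (oneParticle m α β h).IsParity false oneZ :=
  (oneParticle m α β h).isParity_false fun w => (centralCharge_parityOp _ w).symm

theorem isParity_oneP (μ : Fin 4) : (oneParticle m α β h).IsParity false (oneP μ) :=
  (oneParticle m α β h).isParity_false fun w => (parityOp_comp (mulMom μ) w).symm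

/-- The fields of the hyper-multiplet on its Fock space. -/
def hyperField (c : Comp) : OpDist (oneParticle m α β h).dom where
  -- The annihilated vector is the one created by the adjoint component smeared with the conjugate
  -- function. Since annihilation is antilinear, the field is linear in `F`, and its adjoint has the
  -- required form.
  toFun F := (oneParticle m α β h).opField (single c (hat m F)) (single c.adj (hat m (conjFn F)))
  map_add' F F' := by
    rw [conjFn_add, map_add, map_add, map_add, map_add, GradedForm.opField_add]
  map_smul' r F := by
    rw [conjFn_smul, map_smul, map_smul, map_smul, map_smul, GradedForm.opField_smul,
      RingHom.id_apply]

theorem hyperField_apply (c : Comp) (F : TestFn) : hyperField h c F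
    = (oneParticle m α β h).opField (single c (hat m F)) (single c.adj (hat m (conjFn F))) := rfl

theorem eq_sum_single (u : OneParticle m) :
    u = ∑ j : Fin 2, (single (.phi j) (u (.phi j)) + single (.phiStar j) (u (.phiStar j))
      + single (.f j) (u (.f j)) + single (.fStar j) (u (.fStar j))
      + single (.psi j) (u (.psi j)) + single (.psiBar j) (u (.psiBar j))
      + single (.chi j) (u (.chi j)) + single (.chiBar j) (u (.chiBar j))) := by
  classical
  ext1 c
  cases c <;> rename_i c <;> fin_cases c <;> simp [single_apply]

theorem span_single : Submodule.span ℂ (Set.range fun j : Comp × TestFn =>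
    (single j.1 (hat m j.2) : OneParticle m)) = ⊤ := by
  refine eq_top_iff.2 fun u _ => ?_
  have hs : ∀ c (g : shellFn m), single c g ∈ Submodule.span ℂ
      (Set.range fun j : Comp × TestFn => (single j.1 (hat m j.2) : OneParticle m)) := by
    intro c g
    obtain ⟨F, rfl⟩ := hat_surjective g
    exact Submodule.subset_span ⟨(c, F), rfl⟩
  rw [eq_sum_single u]
  exact sum_mem fun j _ => add_mem (add_mem (add_mem (add_mem (add_mem (add_mem (add_mem
    (hs _ _) (hs _ _)) (hs _ _)) (hs _ _)) (hs _ _)) (hs _ _)) (hs _ _)) (hs _ _)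

theorem oneTransl_single (a : Spacetime) (c : Comp) {F G : TestFn} (e : ∀ x, G (x + a) = F x) :
    oneTransl (Multiplicative.ofAdd a) (single c (hat m F)) = single c (hat m G) := by
  classical
  ext1 d
  change phase a (single c (hat m F) d) = _
  rw [single_apply, single_apply, apply_ite (phase a), map_zero, phase_hat a e]

theorem oneLor_single (A : SL2C) (c : Comp) {F G : TestFn} (e : ∀ x, G (lorentz A x) = F x) :
    oneLor A (single c (hat m F)) = lorentzMix A (fun d => single d (hat m G)) c := by
  classical
  have h1 : (boost A).compLeft Comp (single c (hat m F)) = single c (hat m G) := by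
    ext1 d
    rw [LinearMap.compLeft_apply, Function.comp_apply, single_apply, single_apply,
      apply_ite (boost A), map_zero, boost_hat A e]
  change spinorOp A ((boost A).compLeft Comp (single c (hat m F))) = _
  rw [h1]
  ext1 d
  cases c <;> cases d <;> simp [spinorOp_apply, single_apply, lorentzMix, eq_comm]

theorem oneSU2_single (U : SU2) (c : Comp) (g : shellFn m) :
    oneSU2 U (single c g) = su2Mix U (fun d => single d g) c := by
  classical
  change su2Op U (single c g) = _
  ext1 d
  cases c <;> cases d <;> simp [su2Op_apply, single_apply, su2Mix, eq_comm]

/-- The annihilated vector must carry the conjugate coefficients, and these are the ones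
`lorentzMix` uses for the adjoint component; both parts recombine into one combination of fields. -/
theorem opField_lorentzMix (A : SL2C) (c : Comp) (F : TestFn) (w : (oneParticle m α β h).dom) :
    (oneParticle m α β h).opField (lorentzMix A (fun d => single d (hat m F)) c)
        (lorentzMix A (fun d => single d (hat m (conjFn F))) c.adj) w
      = lorentzMix A (fun d => hyperField h d F w) c := by
  have hc : ∀ (r : ℂ) (u v : OneParticle m), (oneParticle m α β h).opField (conj r • u) (r • v)
      = conj r • (oneParticle m α β h).opField u v := fun r u v => by
    rw [← GradedForm.opField_smul, conj_conj]
  cases c <;> simp only [lorentzMix, Comp.adj, GradedForm.opField_sum, GradedForm.opField_smul, hc,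
    LinearMap.sum_apply, LinearMap.smul_apply] <;> rfl

theorem opField_su2Mix (U : SU2) (c : Comp) (F : TestFn) (w : (oneParticle m α β h).dom) :
    (oneParticle m α β h).opField (su2Mix U (fun d => single d (hat m F)) c)
        (su2Mix U (fun d => single d (hat m (conjFn F))) c.adj) w
      = su2Mix U (fun d => hyperField h d F w) c := by
  have hc : ∀ (r : ℂ) (u v : OneParticle m), (oneParticle m α β h).opField (conj r • u) (r • v)
      = conj r • (oneParticle m α β h).opField u v := fun r u v => by
    rw [← GradedForm.opField_smul, conj_conj]
  cases c <;> simp only [su2Mix, Comp.adj, GradedForm.opField_sum, GradedForm.opField_smul, hc,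
    LinearMap.sum_apply, LinearMap.smul_apply] <;> rfl

theorem map_lorentzMix {V V' : Type} [AddCommGroup V] [Module ℂ V] [AddCommGroup V'] [Module ℂ V']
    (f : V →ₗ[ℂ] V') (A : SL2C) (X : Comp → V) (c : Comp) :
    f (lorentzMix A X c) = lorentzMix A (fun d => f (X d)) c := by
  cases c <;> simp only [lorentzMix, map_sum, map_smul]

theorem map_su2Mix {V V' : Type} [AddCommGroup V] [Module ℂ V] [AddCommGroup V'] [Module ℂ V']
    (f : V →ₗ[ℂ] V') (U : SU2) (X : Comp → V) (c : Comp) :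
    f (su2Mix U X c) = su2Mix U (fun d => f (X d)) c := by
  cases c <;> simp only [su2Mix, map_sum, map_smul]

theorem conjFn_dAlembert (F : TestFn) : conjFn (dAlembert F) = dAlembert (conjFn F) := by
  have hs : ∀ F G : TestFn, conjFn (F - G) = conjFn F - conjFn G := fun F G => by
    rw [sub_eq_add_neg, sub_eq_add_neg, conjFn_add, conjFn_neg]
  simp only [dAlembert, Fin.sum_univ_three, hs, conjFn_add, pd_conjFn]

theorem continuous_oneForm_single (α : ℂ) (β : ℝ) (c : Comp) {L : TestFn → shellFn m}
    (hL : ∀ g, Continuous fun F => shellInner m g (L F)) (w : OneParticle m) :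
    Continuous fun F => oneForm m α β (single c (L F)) w := by
  simp only [oneForm_single_left, ← conj_shellInner (oneGram m α β w c)]
  exact continuous_conj.comp (hL _)

/-- The free fields of the hyper-multiplet. -/
def hyperFields : FreeFields m (oneParticle m α β h).Hilb where
  dom := (oneParticle m α β h).dom
  dom_dense := (oneParticle m α β h).denseRange_vec
  vac := (oneParticle m α β h).dvec 1
  vac_norm := by
    have e : inner ℂ ((oneParticle m α β h).vec 1) ((oneParticle m α β h).vec 1) = (1 : ℂ) := by
      rw [GradedForm.inner_vec, GradedForm.form_one, map_one, map_one]
    rw [GradedForm.coe_dvec, norm_eq_sqrt_re_inner (𝕜 := ℂ), e]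
    simp
  field := hyperField h
  tempered c u v := (oneParticle m α β h).continuous_inner_opField (fun F => isHom_single h c _)
    (fun F => isHom_single_adj h c _)
    (continuous_oneForm_single α β c continuous_shellInner_hat)
    (continuous_oneForm_single α β c.adj continuous_shellInner_hat_conjFn) u v
  field_adj c F F' e u v := by
    obtain rfl : F' = conjFn F := SchwartzMap.ext fun x => e x
    rw [hyperField_apply, hyperField_apply, GradedForm.inner_opField, c.adj_adj, conjFn_conjFn]
  klein_gordon c F := by
    have h0 : ∀ F : TestFn, hat m (dAlembert F + (m : ℂ) ^ 2 • F) = 0 := fun F => by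
      rw [map_add, hat_dAlembert, map_smul, neg_add_cancel]
    have h1 : conjFn (dAlembert F + (m : ℂ) ^ 2 • F)
        = dAlembert (conjFn F) + (m : ℂ) ^ 2 • conjFn F := by
      rw [conjFn_add, conjFn_dAlembert, conjFn_smul, map_pow, conj_ofReal]
    rw [hyperField_apply, h1, h0, h0, map_zero, map_zero, GradedForm.opField_zero]
  fock c F hF := by
    have h0 : hat m F = 0 := shellFn_ext hF
    rw [hyperField_apply, GradedForm.opField_dvec, GradedForm.fieldOp_apply, h0,
      GradedForm.ann_one]
    simp
  cyclic S h1 hS := (oneParticle m α β h).cyclic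
    (fun j : Comp × TestFn => (single j.1 (hat m j.2), single j.1.adj (hat m (conjFn j.2))))
    (fun j => ⟨_, isHom_single h _ _⟩) span_single S h1 fun j u hu => hS j.1 j.2 u hu
  transl := (oneParticle m α β h).unitary oneTransl (isSymm_oneTransl h)
  lor := (oneParticle m α β h).unitary oneLor (isSymm_oneLor h)
  su2 := (oneParticle m α β h).unitary oneSU2 (isSymm_oneSU2 h)
  transl_cont v := ((oneParticle m α β h).continuous_unitary (isSymm_oneTransl h)
    (continuous_oneTransl α β) v).comp continuous_ofAdd
  lor_cont := (oneParticle m α β h).continuous_unitary (isSymm_oneLor h) (continuous_oneLor α β)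
  su2_cont := (oneParticle m α β h).continuous_unitary (isSymm_oneSU2 h) (continuous_oneSU2 α β)
  lor_transl A a := GradedForm.unitary_mul_eq _ _ _ _ _ (oneLor_oneTransl A a)
  su2_transl U a := GradedForm.unitary_mul_eq _ _ _ _ _ (oneSU2_oneTransl U _)
  su2_lor U A := GradedForm.unitary_mul_eq _ _ _ _ _ (oneSU2_oneLor U A)
  transl_dom := (oneParticle m α β h).unitary_mem _ _
  lor_dom := (oneParticle m α β h).unitary_mem _ _
  su2_dom := (oneParticle m α β h).unitary_mem _ _
  transl_vac a := by
    rw [GradedForm.coe_dvec, GradedForm.unitary_vec, map_one]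
  lor_vac A := by
    rw [GradedForm.coe_dvec, GradedForm.unitary_vec, map_one]
  su2_vac U := by
    rw [GradedForm.coe_dvec, GradedForm.unitary_vec, map_one]
  transl_field a c F F' e u := by
    have e' : ∀ x, conjFn F' (x + a) = conjFn F x := fun x => by
      rw [conjFn_apply, conjFn_apply, e]
    rw [hyperField_apply, GradedForm.unitary_opField _ _ _ _ _ (isHom_single h _ _),
      oneTransl_single a _ e, oneTransl_single a _ e']
    rfl
  lor_field A c F F' e u := by
    have e' : ∀ x, conjFn F' (lorentz A x) = conjFn F x := fun x => by
      rw [conjFn_apply, conjFn_apply, e]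
    rw [hyperField_apply, GradedForm.unitary_opField _ _ _ _ _ (isHom_single h _ _),
      oneLor_single A _ e, oneLor_single A _ e', opField_lorentzMix]
    exact map_lorentzMix (oneParticle m α β h).dom.subtype A _ c
  su2_field U c F u := by
    rw [hyperField_apply, GradedForm.unitary_opField _ _ _ _ _ (isHom_single h _ _),
      oneSU2_single, oneSU2_single, opField_su2Mix]
    exact map_su2Mix (oneParticle m α β h).dom.subtype U _ c

end

end Hyper

namespace Hyper

noncomputable section

open scoped ComplexConjugate Matrix
open SuperFock

variable {m : ℝ}

/-! ### The action of the charges on single components -/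

theorem kron_eq (i j : Fin 2) : kron i j = if i = j then 1 else 0 := Matrix.one_apply

section Single

variable (j a k b : Fin 2) (g : shellFn m)

theorem oneQ_phi : oneQ j a (single (.phi k) g) = (-I * eps j k) • single (.psi a) g := by
  classical
  ext1 d
  cases d <;> simp [oneQ, supercharge_apply, single_apply, kron_eq, eq_comm]
  all_goals split_ifs <;> module

theorem oneQ_phiStar : oneQ j a (single (.phiStar k) g) = (-I * kron j k) • single (.chi a) g := by
  classical
  ext1 d
  cases d <;> simp [oneQ, supercharge_apply, single_apply, kron_eq, eq_comm, ← ite_and, and_comm]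
  all_goals split_ifs <;> module

theorem oneQ_f : oneQ j a (single (.f k) g)
    = ∑ b, ∑ c, (eps j k * eps b c) • single (.chiBar c) (mulSlash a b g) := by
  classical
  ext1 d
  cases d <;> simp [oneQ, supercharge_apply, single_apply, apply_ite (mulSlash _ _)]
  all_goals
    rename_i d
    fin_cases d <;> simp [eps_apply, add_comm] <;> module

theorem oneQ_fStar : oneQ j a (single (.fStar k) g)
    = ∑ b, ∑ c, (-kron j k * eps b c) • single (.psiBar c) (mulSlash a b g) := by
  classical
  ext1 d
  cases d <;> simp [oneQ, supercharge_apply, single_apply, kron_eq, apply_ite (mulSlash _ _)]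
  all_goals
    rename_i d
    fin_cases d <;> simp [eps_apply, add_comm] <;> split_ifs <;> module

theorem oneQ_psi : oneQ j a (single (.psi b) g) = (-2 * eps a b) • single (.f j) g := by
  classical
  ext1 d
  cases d <;> simp [oneQ, supercharge_apply, single_apply, kron_eq, eq_comm]
  all_goals split_ifs <;> module

theorem oneQ_psiBar : oneQ j a (single (.psiBar b) g)
    = ∑ k, (2 * I * eps j k) • single (.phiStar k) (mulSlash a b g) := by
  classical
  ext1 d
  cases d <;> simp [oneQ, supercharge_apply, single_apply, apply_ite (mulSlash _ _)]

theorem oneQ_chi : oneQ j a (single (.chi b) g)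
    = ∑ k, (2 * eps j k * eps a b) • single (.fStar k) g := by
  classical
  ext1 d
  cases d <;> simp [oneQ, supercharge_apply, single_apply]

theorem oneQ_chiBar : oneQ j a (single (.chiBar b) g)
    = (2 * I) • single (.phi j) (mulSlash a b g) := by
  classical
  ext1 d
  cases d <;> simp [oneQ, supercharge_apply, single_apply, kron_eq, apply_ite (mulSlash _ _),
    eq_comm]

theorem oneQbar_phi : oneQbar j a (single (.phi k) g) = (-I * kron j k) • single (.chiBar a) g := by
  classical
  ext1 d
  cases d <;> simp [oneQbar, superchargeBar_apply, single_apply, kron_eq, eq_comm]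
  all_goals split_ifs <;> module

theorem oneQbar_phiStar : oneQbar j a (single (.phiStar k) g)
    = (-I * eps j k) • single (.psiBar a) g := by
  classical
  ext1 d
  cases d <;> simp [oneQbar, superchargeBar_apply, single_apply, kron_eq, eq_comm]
  all_goals split_ifs <;> module

theorem oneQbar_f : oneQbar j a (single (.f k) g)
    = ∑ b, ∑ c, (-kron j k * eps b c) • single (.psi c) (mulSlash b a g) := by
  classical
  ext1 d
  cases d <;> simp [oneQbar, superchargeBar_apply, single_apply, kron_eq, apply_ite (mulSlash _ _)]
  all_goals
    rename_i d
    fin_cases d <;> simp [eps_apply, add_comm] <;> split_ifs <;> module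

theorem oneQbar_fStar : oneQbar j a (single (.fStar k) g)
    = ∑ b, ∑ c, (eps j k * eps b c) • single (.chi c) (mulSlash b a g) := by
  classical
  ext1 d
  cases d <;> simp [oneQbar, superchargeBar_apply, single_apply, apply_ite (mulSlash _ _)]
  all_goals
    rename_i d
    fin_cases d <;> simp [eps_apply, add_comm] <;> module

theorem oneQbar_psi : oneQbar j a (single (.psi b) g)
    = ∑ k, (2 * I * eps j k) • single (.phi k) (mulSlash b a g) := by
  classical
  ext1 d
  cases d <;> simp [oneQbar, superchargeBar_apply, single_apply, apply_ite (mulSlash _ _)]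

theorem oneQbar_psiBar : oneQbar j a (single (.psiBar b) g)
    = (-2 * eps a b) • single (.fStar j) g := by
  classical
  ext1 d
  cases d <;> simp [oneQbar, superchargeBar_apply, single_apply, kron_eq, eq_comm]
  all_goals split_ifs <;> module

theorem oneQbar_chi : oneQbar j a (single (.chi b) g)
    = (2 * I) • single (.phiStar j) (mulSlash b a g) := by
  classical
  ext1 d
  cases d <;> simp [oneQbar, superchargeBar_apply, single_apply, kron_eq, apply_ite (mulSlash _ _),
    eq_comm]

theorem oneQbar_chiBar : oneQbar j a (single (.chiBar b) g)
    = ∑ k, (2 * eps j k * eps a b) • single (.f k) g := by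
  classical
  ext1 d
  cases d <;> simp [oneQbar, superchargeBar_apply, single_apply]

theorem oneZ_phi : oneZ (single (.phi k) g) = (-I) • single (.f k) g := by
  classical
  ext1 d
  cases d <;> simp [oneZ, centralCharge_apply, single_apply]
  all_goals split_ifs <;> module

theorem oneZ_phiStar : oneZ (single (.phiStar k) g) = (-I) • single (.fStar k) g := by
  classical
  ext1 d
  cases d <;> simp [oneZ, centralCharge_apply, single_apply]
  all_goals split_ifs <;> module

theorem oneZ_f : oneZ (single (.f k) g) = (I * (m : ℂ) ^ 2) • single (.phi k) g := by
  classical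
  ext1 d
  cases d <;> simp [oneZ, centralCharge_apply, single_apply]

theorem oneZ_fStar : oneZ (single (.fStar k) g) = (I * (m : ℂ) ^ 2) • single (.phiStar k) g := by
  classical
  ext1 d
  cases d <;> simp [oneZ, centralCharge_apply, single_apply]

theorem oneZ_psi : oneZ (single (.psi a) g)
    = ∑ b, ∑ c, eps b c • single (.chiBar c) (mulSlash a b g) := by
  classical
  ext1 d
  cases d <;> simp [oneZ, centralCharge_apply, single_apply, apply_ite (mulSlash _ _)]
  all_goals
    rename_i d
    fin_cases d <;> simp [eps_apply, add_comm] <;> module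

theorem oneZ_psiBar : oneZ (single (.psiBar a) g)
    = ∑ b, ∑ c, eps b c • single (.chi c) (mulSlash b a g) := by
  classical
  ext1 d
  cases d <;> simp [oneZ, centralCharge_apply, single_apply, apply_ite (mulSlash _ _)]
  all_goals
    rename_i d
    fin_cases d <;> simp [eps_apply, add_comm] <;> module

theorem oneZ_chi : oneZ (single (.chi a) g)
    = ∑ b, ∑ c, (-eps b c) • single (.psiBar c) (mulSlash a b g) := by
  classical
  ext1 d
  cases d <;> simp [oneZ, centralCharge_apply, single_apply, apply_ite (mulSlash _ _)]
  all_goals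
    rename_i d
    fin_cases d <;> simp [eps_apply, add_comm] <;> module

theorem oneZ_chiBar : oneZ (single (.chiBar a) g)
    = ∑ b, ∑ c, (-eps b c) • single (.psi c) (mulSlash b a g) := by
  classical
  ext1 d
  cases d <;> simp [oneZ, centralCharge_apply, single_apply, apply_ite (mulSlash _ _)]
  all_goals
    rename_i d
    fin_cases d <;> simp [eps_apply, add_comm] <;> module

theorem oneP_single (μ : Fin 4) (c : Comp) : oneP μ (single c g) = single c (mulMom μ g) := by
  classical
  ext1 d
  change mulMom μ (single c g d) = _
  rw [single_apply, single_apply, apply_ite (mulMom μ), map_zero]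

end Single

end

end Hyper

namespace Hyper

noncomputable section

open scoped ComplexConjugate Matrix
open SuperFock

variable {m : ℝ} {α : ℂ} {β : ℝ} (h : ‖α‖ ^ 2 + β ^ 2 ≤ m ^ 2)

/-! ### The causal relations -/

/-- The (anti)commutator of two fields is a number given by entries of `oneGram`. The causal
relations are read off from `gramOp` in this way. -/
theorem hyperField_mul_sub (c d : Comp) (F G : TestFn) :
    hyperField h c F * hyperField h d G
        - sgn c.odd d.odd • (hyperField h d G * hyperField h c F)
      = (shellInner m (hat m (conjFn F)) (oneGram m α β (single d (hat m G)) c.adj)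
          - sgn c.odd d.odd
            * shellInner m (hat m (conjFn G)) (oneGram m α β (single c (hat m F)) d.adj)) • 1 := by
  rw [← oneForm_single_left, ← oneForm_single_left]
  exact (oneParticle m α β h).op_fieldOp_comm (isHom_single h _ _) (isHom_single_adj h _ _)
    (isHom_single h _ _) (isHom_single_adj h _ _)

theorem comm_hyperField (c d : Comp) (hcd : sgn c.odd d.odd = 1) (F G : TestFn) :
    comm (hyperField h c F) (hyperField h d G)
      = (shellInner m (hat m (conjFn F)) (oneGram m α β (single d (hat m G)) c.adj)
          - shellInner m (hat m (conjFn G)) (oneGram m α β (single c (hat m F)) d.adj)) • 1 := by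
  have := hyperField_mul_sub h c d F G
  rwa [hcd, one_smul, one_mul] at this

theorem acomm_hyperField (c d : Comp) (hcd : sgn c.odd d.odd = -1) (F G : TestFn) :
    acomm (hyperField h c F) (hyperField h d G)
      = (shellInner m (hat m (conjFn F)) (oneGram m α β (single d (hat m G)) c.adj)
          + shellInner m (hat m (conjFn G)) (oneGram m α β (single c (hat m F)) d.adj)) • 1 := by
  have := hyperField_mul_sub h c d F G
  rw [hcd, neg_one_mul, sub_neg_eq_add] at this
  rw [← this, acomm]
  module

theorem shellInner_mulMom (μ : Fin 4) (g g' : shellFn m) :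
    shellInner m (mulMom μ g) g' = shellInner m g (mulMom μ g') := by
  rw [shellInner_apply, shellInner_apply]
  simp only [mulMom_apply, map_mul, conj_ofReal, mul_assoc, mul_left_comm]

/-- The derivative multiplies the two frequency parts by `p_μ` with opposite signs, which turns the
difference in the Pauli-Jordan distribution into the sum required by anticommutators. -/
theorem sigmaPauliJordan_eq (a b : Fin 2) (F G : TestFn) : sigmaPauliJordan m a b F G
    = shellInner m (hat m (conjFn F)) (mulSlash a b (hat m G))
      + shellInner m (hat m (conjFn G)) (mulSlash a b (hat m F)) := by
  simp only [sigmaPauliJordan, mulSlash, LinearMap.sum_apply, LinearMap.smul_apply, map_sum,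
    map_smul, ← Finset.sum_add_distrib]
  refine Finset.sum_congr rfl fun μ _ => ?_
  rw [pauliJordan_eq_shellInner, conjFn_neg, ← pd_conjFn, hat_neg_pd, hat_neg_pd,
    LinearMap.map_smulₛₗ, map_smul, LinearMap.smul_apply, shellInner_mulMom, conj_I]
  simp only [smul_eq_mul]
  linear_combination -pauli μ a b * (shellInner m (hat m (conjFn F)) (mulMom μ (hat m G))
    + shellInner m (hat m (conjFn G)) (mulMom μ (hat m F))) * I_sq

theorem sgn_bose (e : Bool) : sgn false e = 1 := by simp [sgn]

theorem sgn_fermi : sgn true true = -1 := by simp [sgn]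

theorem hyperFields_causal : (hyperFields h).Causal α β where
  phi_phi j k F G := by
    refine (comm_hyperField h (.phi j) (.phi k) (sgn_bose _) F G).trans ?_
    simp [oneGram, gramOp_apply, single_apply, Comp.adj]
    rfl
  phi_phiStar j k F G := by
    refine (comm_hyperField h (.phi j) (.phiStar k) (sgn_bose _) F G).trans ?_
    congr 1
    rw [pauliJordan_eq_shellInner]
    revert j k
    simp [Fin.forall_fin_two, oneGram, gramOp_apply, single_apply, Comp.adj, kron_apply]
    ring_nf
    simp only [I_sq]
    ring1
  f_f j k F G := by
    refine (comm_hyperField h (.f j) (.f k) (sgn_bose _) F G).trans ?_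
    simp [oneGram, gramOp_apply, single_apply, Comp.adj]
    rfl
  f_fStar j k F G := by
    refine (comm_hyperField h (.f j) (.fStar k) (sgn_bose _) F G).trans ?_
    congr 1
    rw [pauliJordan_eq_shellInner]
    revert j k
    simp [Fin.forall_fin_two, oneGram, gramOp_apply, single_apply, Comp.adj, kron_apply]
    ring_nf
    simp only [I_sq]
    ring1
  phi_f j k F G := by
    refine (comm_hyperField h (.phi j) (.f k) (sgn_bose _) F G).trans ?_
    congr 1
    rw [pauliJordan_eq_shellInner]
    revert j k
    simp [Fin.forall_fin_two, oneGram, gramOp_apply, single_apply, Comp.adj, eps_apply]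
    constructor <;> ring1
  phi_fStar j k F G := by
    refine (comm_hyperField h (.phi j) (.fStar k) (sgn_bose _) F G).trans ?_
    congr 1
    rw [pauliJordan_eq_shellInner]
    revert j k
    simp [Fin.forall_fin_two, oneGram, gramOp_apply, single_apply, Comp.adj, kron_apply]
    ring1
  psi_psi a b F G := by
    refine (acomm_hyperField h (.psi a) (.psi b) sgn_fermi F G).trans ?_
    congr 1
    rw [pauliJordan_eq_shellInner]
    revert a b
    simp [Fin.forall_fin_two, oneGram, gramOp_apply, single_apply, Comp.adj, eps_apply]
    constructor <;>
    · ring_nf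
      simp only [I_sq]
      ring1
  psi_psiBar a b F G := by
    refine (acomm_hyperField h (.psi a) (.psiBar b) sgn_fermi F G).trans ?_
    rw [sigmaPauliJordan_eq]
    simp [oneGram, gramOp_apply, single_apply, Comp.adj, apply_ite (mulSlash _ _)]
    rw [mul_add]
    rfl
  chi_chi a b F G := by
    refine (acomm_hyperField h (.chi a) (.chi b) sgn_fermi F G).trans ?_
    congr 1
    rw [pauliJordan_eq_shellInner]
    revert a b
    simp [Fin.forall_fin_two, oneGram, gramOp_apply, single_apply, Comp.adj, eps_apply]
    constructor <;>
    · ring_nf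
      simp only [I_sq]
      ring1
  chi_chiBar a b F G := by
    refine (acomm_hyperField h (.chi a) (.chiBar b) sgn_fermi F G).trans ?_
    rw [sigmaPauliJordan_eq]
    simp [oneGram, gramOp_apply, single_apply, Comp.adj, apply_ite (mulSlash _ _)]
    rw [mul_add]
    rfl
  psi_chi a b F G := by
    refine (acomm_hyperField h (.psi a) (.chi b) sgn_fermi F G).trans ?_
    congr 1
    rw [pauliJordan_eq_shellInner]
    revert a b
    simp [Fin.forall_fin_two, oneGram, gramOp_apply, single_apply, Comp.adj, eps_apply]
    constructor <;>
    · ring_nf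
      simp only [I_sq]
      ring1
  psi_chiBar a b F G := by
    refine (acomm_hyperField h (.psi a) (.chiBar b) sgn_fermi F G).trans ?_
    simp [oneGram, gramOp_apply, single_apply, Comp.adj]
    rfl
  bose_fermi c d hc hd F G := by
    have hc' : c.odd = false := by cases c <;> simp_all [Comp.IsFermi, Comp.odd]
    have hd' : d.odd = true := by cases d <;> simp_all [Comp.IsFermi, Comp.odd]
    refine (comm_hyperField h c d (by rw [hc', sgn_bose]) F G).trans ?_
    -- One-particle states of opposite parity are orthogonal, so both terms of the commutator
    -- vanish.
    have e : ∀ (c d : Comp) (g g' : shellFn m), c.odd ≠ d.odd →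
        shellInner m g (oneGram m α β (single d g') c) = 0 := fun c d g g' hcd => by
      rw [← oneForm_single_left]
      exact (isHom_single h c g).s_eq_zero (isHom_single h d g') hcd
    rw [e _ _ _ _ (by simp [c.odd_adj, hc', hd']), e _ _ _ _ (by simp [d.odd_adj, hc', hd']),
      sub_zero, zero_smul]
    rfl

end

end Hyper

/-! ### Graded commutators of second quantized operators. -/

namespace SuperFock.GradedForm

noncomputable section

variable {W : Type} [AddCommGroup W] [Module ℂ W] (G : GradedForm W)

theorem op_der_comm {e : Bool} {X X' Y Y' : W →ₗ[ℂ] W} (hX : G.IsParity false X)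
    (hX' : G.IsParity false X') (h : ∀ u v, G.s (X' u) v = G.s u (X v)) (hY : G.IsParity e Y)
    (hY' : G.IsParity e Y') (h' : ∀ u v, G.s (Y' u) v = G.s u (Y v)) (hXY : X * Y = Y * X) :
    G.op (G.der false X) * G.op (G.der e Y) = G.op (G.der e Y) * G.op (G.der false X) := by
  -- With coefficient `0` the third operator is irrelevant; `Y` is taken because its parity and
  -- adjoint are at hand.
  have := G.op_der_der hX hX' h hY hY' h' (Z := Y) (Z' := Y') (c := 0) (by simpa using hY)
    (by simpa using hY') h' (by simp [sgn, hXY])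
  simpa [sgn, sub_eq_zero] using this

theorem op_der_anticomm {X X' Y Y' Z Z' : W →ₗ[ℂ] W} (hX : G.IsParity true X)
    (hX' : G.IsParity true X') (h : ∀ u v, G.s (X' u) v = G.s u (X v)) (hY : G.IsParity true Y)
    (hY' : G.IsParity true Y') (h' : ∀ u v, G.s (Y' u) v = G.s u (Y v))
    (hZ : G.IsParity false Z) (hZ' : G.IsParity false Z')
    (hh : ∀ u v, G.s (Z' u) v = G.s u (Z v)) {c : ℂ} (hXY : X * Y + Y * X = c • Z) :
    G.op (G.der true X) * G.op (G.der true Y) + G.op (G.der true Y) * G.op (G.der true X)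
      = c • G.op (G.der false Z) := by
  have := G.op_der_der hX hX' h hY hY' h' (Z := Z) (Z' := Z') (c := c) hZ hZ' hh
    (by simp [sgn, hXY])
  refine Eq.trans ?_ this
  rw [show sgn true true = -1 by simp [sgn]]
  module

end

end SuperFock.GradedForm

namespace Hyper

noncomputable section

open scoped ComplexConjugate Matrix
open SuperFock

variable {m : ℝ} {α : ℂ} {β : ℝ} (h : ‖α‖ ^ 2 + β ^ 2 ≤ m ^ 2)

/-! ### Derivatives of the fields -/

theorem conj_pauli (μ : Fin 4) (a b : Fin 2) : conj (pauli μ a b) = pauli μ b a := by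
  fin_cases μ <;> fin_cases a <;> fin_cases b <;> simp [pauli]

theorem conj_eps (a b : Fin 2) : conj (eps a b) = eps a b := by
  fin_cases a <;> fin_cases b <;> simp [eps]

theorem conj_kron (a b : Fin 2) : conj (kron a b) = kron a b := by
  rw [kron_eq]
  split_ifs <;> simp

theorem dField_hyperField (μ : Fin 4) (c : Comp) (F : TestFn) : dField μ (hyperField h c) F
    = I • (oneParticle m α β h).opField (single c (mulMom μ (hat m F)))
      (-single c.adj (mulMom μ (hat m (conjFn F)))) := by
  rw [dField, hyperField_apply, conjFn_neg, ← pd_conjFn, hat_neg_pd, hat_neg_pd, map_smul, map_smul,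
    ← GradedForm.opField_smul, conj_I, neg_smul_neg]

theorem sigmaD_hyperField (a b : Fin 2) (c : Comp) (F : TestFn) : sigmaD a b (hyperField h c) F
    = I • (oneParticle m α β h).opField (single c (mulSlash a b (hat m F)))
      (-single c.adj (mulSlash b a (hat m (conjFn F)))) := by
  simp only [sigmaD, dField_hyperField, smul_comm _ I, ← Finset.smul_sum,
    ← GradedForm.opField_smul, ← GradedForm.opField_sum, conj_pauli, smul_neg,
    Finset.sum_neg_distrib, mulSlash, LinearMap.sum_apply, LinearMap.smul_apply, map_sum, map_smul]
  rw [Finset.smul_sum, Finset.smul_sum]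
  simp only [smul_comm _ (conj I)]

section Dirac

variable {E : Type} [AddCommGroup E] [Module ℂ E]

theorem diracBar_eq (A : Fin 2 → OpDist E) (a : Fin 2) (F : TestFn) :
    diracBar A a F = ∑ b, ∑ c, (-eps b c) • sigmaD a b (A c) F := by
  simp only [diracBar, sigmaD, dField, raise, LinearMap.add_apply, LinearMap.smul_apply,
    Fin.sum_univ_two, Fin.sum_univ_four]
  module

theorem diracUnbar_eq (A : Fin 2 → OpDist E) (a : Fin 2) (F : TestFn) :
    diracUnbar A a F = ∑ b, ∑ c, (-eps b c) • sigmaD b a (A c) F := by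
  simp only [diracUnbar, sigmaD, dField, raise, LinearMap.add_apply, LinearMap.smul_apply,
    Fin.sum_univ_two, Fin.sum_univ_four]
  module

end Dirac

/-! ### The charges -/

/-- The supercharges. -/
def hyperQ (j a : Fin 2) : Module.End ℂ (oneParticle m α β h).dom :=
  (oneParticle m α β h).op ((oneParticle m α β h).der true (oneQ j a))

/-- The adjoint supercharges. -/
def hyperQbar (j a : Fin 2) : Module.End ℂ (oneParticle m α β h).dom :=
  (oneParticle m α β h).op ((oneParticle m α β h).der true (oneQbar j a))

/-- The central charge. -/
def hyperZ : Module.End ℂ (oneParticle m α β h).dom :=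
  (oneParticle m α β h).op ((oneParticle m α β h).der false oneZ)

/-- The generators of the translations. -/
def hyperP (μ : Fin 4) : Module.End ℂ (oneParticle m α β h).dom :=
  (oneParticle m α β h).op ((oneParticle m α β h).der false (oneP μ))

theorem oneForm_oneQbar (α : ℂ) (β : ℝ) (j a : Fin 2) (u v : OneParticle m) :
    oneForm m α β (oneQ j a u) v = oneForm m α β u (oneQbar j a v) := by
  rw [← conj_oneForm, ← oneForm_oneQ, conj_oneForm]

/-- The charge moves the created vector and its adjoint moves the annihilated one, with a sign. The
transformation laws of the fields thus reduce to the action on single components. -/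
theorem comm_hyperQ (j a : Fin 2) (c : Comp) (hc : c.odd = false) (F : TestFn) :
    comm (hyperQ h j a) (hyperField h c F)
      = (oneParticle m α β h).opField (oneQ j a (single c (hat m F)))
        (-oneQbar j a (single c.adj (hat m (conjFn F)))) := by
  have := (oneParticle m α β h).op_der_fieldOp (isParity_oneQ h j a) (isParity_oneQbar h j a)
    (oneForm_oneQ α β j a) (isHom_single h c (hat m F)) (isHom_single_adj h c (hat m (conjFn F)))
  rw [hc, sgn_comm, sgn_bose, one_smul] at this
  refine this.trans ?_
  rw [GradedForm.opField]
  congr 2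
  module

theorem acomm_hyperQ (j a : Fin 2) (c : Comp) (hc : c.odd = true) (F : TestFn) :
    acomm (hyperQ h j a) (hyperField h c F)
      = (oneParticle m α β h).opField (oneQ j a (single c (hat m F)))
        (oneQbar j a (single c.adj (hat m (conjFn F)))) := by
  have := (oneParticle m α β h).op_der_fieldOp (isParity_oneQ h j a) (isParity_oneQbar h j a)
    (oneForm_oneQ α β j a) (isHom_single h c (hat m F)) (isHom_single_adj h c (hat m (conjFn F)))
  rw [hc, sgn_fermi, neg_neg, one_smul] at this
  rw [GradedForm.opField, ← this, acomm]
  change hyperQ h j a * hyperField h c F + hyperField h c F * hyperQ h j a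
    = hyperQ h j a * hyperField h c F - (-1 : ℂ) • (hyperField h c F * hyperQ h j a)
  module

theorem comm_hyperQbar (j a : Fin 2) (c : Comp) (hc : c.odd = false) (F : TestFn) :
    comm (hyperQbar h j a) (hyperField h c F)
      = (oneParticle m α β h).opField (oneQbar j a (single c (hat m F)))
        (-oneQ j a (single c.adj (hat m (conjFn F)))) := by
  have := (oneParticle m α β h).op_der_fieldOp (isParity_oneQbar h j a) (isParity_oneQ h j a)
    (oneForm_oneQbar α β j a) (isHom_single h c (hat m F)) (isHom_single_adj h c (hat m (conjFn F)))
  rw [hc, sgn_comm, sgn_bose, one_smul] at this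
  refine this.trans ?_
  rw [GradedForm.opField]
  congr 2
  module

theorem comm_hyperZ (c : Comp) (F : TestFn) : comm (hyperZ h) (hyperField h c F)
    = (oneParticle m α β h).opField (oneZ (single c (hat m F)))
      (-oneZ (single c.adj (hat m (conjFn F)))) := by
  have := (oneParticle m α β h).op_der_fieldOp (isParity_oneZ h) (isParity_oneZ h)
    (oneForm_oneZ α β) (isHom_single h c (hat m F)) (isHom_single_adj h c (hat m (conjFn F)))
  rw [sgn_bose, one_smul] at this
  refine this.trans ?_
  rw [GradedForm.opField]
  congr 2
  module

theorem comm_hyperP (μ : Fin 4) (c : Comp) (F : TestFn) : comm (hyperP h μ) (hyperField h c F)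
    = (oneParticle m α β h).opField (oneP μ (single c (hat m F)))
      (-oneP μ (single c.adj (hat m (conjFn F)))) := by
  have := (oneParticle m α β h).op_der_fieldOp (isParity_oneP h μ) (isParity_oneP h μ)
    (oneForm_oneP α β μ) (isHom_single h c (hat m F)) (isHom_single_adj h c (hat m (conjFn F)))
  rw [sgn_bose, one_smul] at this
  refine this.trans ?_
  rw [GradedForm.opField]
  congr 2
  module

theorem hyperP_mul_hyperQ (j a : Fin 2) (μ : Fin 4) :
    hyperP h μ * hyperQ h j a = hyperQ h j a * hyperP h μ :=
  (oneParticle m α β h).op_der_comm (isParity_oneP h μ) (isParity_oneP h μ) (oneForm_oneP α β μ)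
    (isParity_oneQ h j a) (isParity_oneQbar h j a) (oneForm_oneQ α β j a) (oneQ_oneP j a μ).symm

theorem hyperZ_mul_hyperQ (j a : Fin 2) : hyperZ h * hyperQ h j a = hyperQ h j a * hyperZ h :=
  (oneParticle m α β h).op_der_comm (isParity_oneZ h) (isParity_oneZ h) (oneForm_oneZ α β)
    (isParity_oneQ h j a) (isParity_oneQbar h j a) (oneForm_oneQ α β j a) (oneZ_oneQ j a)

theorem hyperZ_mul_hyperQbar (j a : Fin 2) :
    hyperZ h * hyperQbar h j a = hyperQbar h j a * hyperZ h :=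
  (oneParticle m α β h).op_der_comm (isParity_oneZ h) (isParity_oneZ h) (oneForm_oneZ α β)
    (isParity_oneQbar h j a) (isParity_oneQ h j a) (oneForm_oneQbar α β j a) (oneZ_oneQbar j a)

theorem hyperZ_mul_hyperP (μ : Fin 4) : hyperZ h * hyperP h μ = hyperP h μ * hyperZ h :=
  (oneParticle m α β h).op_der_comm (isParity_oneZ h) (isParity_oneZ h) (oneForm_oneZ α β)
    (isParity_oneP h μ) (isParity_oneP h μ) (oneForm_oneP α β μ) (oneZ_oneP μ)

theorem acomm_hyperQ_hyperQ (j a k b : Fin 2) : acomm (hyperQ h j a) (hyperQ h k b)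
    = (2 * eps a b * eps j k) • hyperZ h :=
  (oneParticle m α β h).op_der_anticomm (isParity_oneQ h j a) (isParity_oneQbar h j a)
    (oneForm_oneQ α β j a) (isParity_oneQ h k b) (isParity_oneQbar h k b) (oneForm_oneQ α β k b)
    (isParity_oneZ h) (isParity_oneZ h) (oneForm_oneZ α β) (oneQ_oneQ j a k b)

theorem hasAdj_oneP (μ : Fin 4) : (oneParticle m α β h).HasAdj
    ((oneParticle m α β h).der false (oneP μ)) :=
  (oneParticle m α β h).hasAdj_der (isParity_oneP h μ) (isParity_oneP h μ) (oneForm_oneP α β μ)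

theorem hasAdj_oneQ (j a : Fin 2) : (oneParticle m α β h).HasAdj
    ((oneParticle m α β h).der true (oneQ j a)) :=
  (oneParticle m α β h).hasAdj_der (isParity_oneQ h j a) (isParity_oneQbar h j a)
    (oneForm_oneQ α β j a)

theorem hasAdj_oneQbar (j a : Fin 2) : (oneParticle m α β h).HasAdj
    ((oneParticle m α β h).der true (oneQbar j a)) :=
  (oneParticle m α β h).hasAdj_der (isParity_oneQbar h j a) (isParity_oneQ h j a)
    (oneForm_oneQbar α β j a)

theorem acomm_hyperQ_hyperQbar (j a k b : Fin 2) : acomm (hyperQ h j a) (hyperQbar h k b)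
    = (2 * kron j k) • ∑ μ, pauli μ a b • hyperP h μ := by
  have hp : ∀ a b, (oneParticle m α β h).IsParity false (∑ μ, pauli μ a b • oneP μ) :=
    fun a b => (oneParticle m α β h).isParity_false fun w => by
      simp only [LinearMap.sum_apply, LinearMap.smul_apply, map_sum, map_smul]
      exact Finset.sum_congr rfl fun μ _ => congrArg _ (parityOp_comp (mulMom μ) w).symm
  -- The matrices `σ^μ` are Hermitian, so the adjoint exchanges `a` and `b`.
  have ha : ∀ u v, oneForm m α β ((∑ μ, pauli μ b a • oneP μ : Module.End ℂ _) u) v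
      = oneForm m α β u ((∑ μ, pauli μ a b • oneP μ : Module.End ℂ _) v) := fun u v => by
    simp only [LinearMap.sum_apply, LinearMap.smul_apply, map_sum, map_smul, LinearMap.map_smulₛₗ,
      oneForm_oneP, conj_pauli]
  refine ((oneParticle m α β h).op_der_anticomm (isParity_oneQ h j a) (isParity_oneQbar h j a)
    (oneForm_oneQ α β j a) (isParity_oneQbar h k b) (isParity_oneQ h k b) (oneForm_oneQbar α β k b)
    (hp a b) (hp b a) ha (oneQ_oneQbar j a k b)).trans (congrArg _ ?_)
  refine (oneParticle m α β h).end_ext fun x => ?_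
  rw [GradedForm.op_dvec _ ((oneParticle m α β h).hasAdj_der (hp a b) (hp b a) ha)]
  simp only [LinearMap.sum_apply, LinearMap.smul_apply,
    map_sum, map_smul, hyperP, GradedForm.op_dvec _ (hasAdj_oneP h _)]

theorem lor_hyperQ (A : SL2C) (j a : Fin 2) (u : (oneParticle m α β h).dom) :
    (oneParticle m α β h).unitary oneLor (isSymm_oneLor h) A (hyperQ h j a u)
      = ((∑ b, (A⁻¹).1 a b • hyperQ h j b ⟨_, (oneParticle m α β h).unitary_mem oneLor
          (isSymm_oneLor h) A u⟩ : (oneParticle m α β h).dom) : (oneParticle m α β h).Hilb) := by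
  obtain ⟨x, rfl⟩ := (oneParticle m α β h).dvec_surjective u
  rw [hyperQ, GradedForm.unitary_op_der _ _ _ _ (X' := ∑ b, (A⁻¹).1 a b • oneQ j b)
    (fun w => by rw [oneLor_oneQ, LinearMap.sum_apply]; rfl) (hasAdj_oneQ h j a) _ x rfl,
    GradedForm.unitary_dvec]
  simp only [hyperQ, GradedForm.op_dvec _ (hasAdj_oneQ h _ _), map_sum, map_smul,
    LinearMap.sum_apply, LinearMap.smul_apply, ← GradedForm.coe_dvec,
    Submodule.coe_sum, Submodule.coe_smul]

theorem su2_hyperQ (U : SU2) (j a : Fin 2) (u : (oneParticle m α β h).dom) :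
    (oneParticle m α β h).unitary oneSU2 (isSymm_oneSU2 h) U (hyperQ h j a u)
      = ((∑ k, (U⁻¹).1 j k • hyperQ h k a ⟨_, (oneParticle m α β h).unitary_mem oneSU2
          (isSymm_oneSU2 h) U u⟩ : (oneParticle m α β h).dom) : (oneParticle m α β h).Hilb) := by
  obtain ⟨x, rfl⟩ := (oneParticle m α β h).dvec_surjective u
  rw [hyperQ, GradedForm.unitary_op_der _ _ _ _ (X' := ∑ k, (U⁻¹).1 j k • oneQ k a)
    (fun w => by rw [oneSU2_oneQ, LinearMap.sum_apply]; rfl) (hasAdj_oneQ h j a) _ x rfl,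
    GradedForm.unitary_dvec]
  simp only [hyperQ, GradedForm.op_dvec _ (hasAdj_oneQ h _ _), map_sum, map_smul,
    LinearMap.sum_apply, LinearMap.smul_apply, ← GradedForm.coe_dvec,
    Submodule.coe_sum, Submodule.coe_smul]

end

end Hyper

namespace Hyper

noncomputable section

open scoped ComplexConjugate Matrix
open SuperFock

variable {m : ℝ} {α : ℂ} {β : ℝ} (h : ‖α‖ ^ 2 + β ^ 2 ≤ m ^ 2)

/-! ### The action of the charges on the fields -/

variable (j a k b : Fin 2) (F : TestFn)

theorem hyperQ_phi : I • comm (hyperQ h j a) (hyperField h (.phi k) F)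
    = eps j k • hyperField h (.psi a) F := by
  rw [comm_hyperQ h j a _ rfl, hyperField_apply]
  simp only [Comp.adj, oneQ_phi, oneQbar_phiStar, ← GradedForm.opField_smul, conj_I, conj_eps]
  congr 1 <;> match_scalars <;> ring_nf <;> simp only [I_sq] <;> ring1

theorem hyperQbar_phi : I • comm (hyperQbar h j a) (hyperField h (.phi k) F)
    = kron j k • hyperField h (.chiBar a) F := by
  rw [comm_hyperQbar h j a _ rfl, hyperField_apply]
  simp only [Comp.adj, oneQbar_phi, oneQ_phiStar, ← GradedForm.opField_smul, conj_I, conj_kron]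
  congr 1 <;> match_scalars <;> ring_nf <;> simp only [I_sq] <;> ring1

theorem hyperQ_f : comm (hyperQ h j a) (hyperField h (.f k) F)
    = (I * eps j k) • diracBar (fun b => hyperField h (.chiBar b)) a F := by
  rw [comm_hyperQ h j a _ rfl, diracBar_eq]
  simp only [Comp.adj, oneQ_f, oneQbar_fStar, sigmaD_hyperField, ← GradedForm.opField_smul,
    ← GradedForm.opField_sum, map_neg, map_mul, conj_I, conj_eps, Fin.sum_univ_two]
  congr 1 <;> match_scalars <;> ring_nf <;> simp only [I_sq] <;> ring1

theorem hyperQbar_f : comm (hyperQbar h j a) (hyperField h (.f k) F)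
    = (-I * kron j k) • diracUnbar (fun b => hyperField h (.psi b)) a F := by
  rw [comm_hyperQbar h j a _ rfl, diracUnbar_eq]
  simp only [Comp.adj, oneQbar_f, oneQ_fStar, sigmaD_hyperField, ← GradedForm.opField_smul,
    ← GradedForm.opField_sum, map_neg, map_mul, conj_I, conj_eps, conj_kron, Fin.sum_univ_two]
  congr 1 <;> match_scalars <;> ring_nf <;> simp only [I_sq] <;> ring1

theorem hyperQ_psi : acomm (hyperQ h j a) (hyperField h (.psi b) F)
    = (-2 * eps a b) • hyperField h (.f j) F := by
  rw [acomm_hyperQ h j a _ rfl, hyperField_apply, ← GradedForm.opField_smul, map_mul, conj_eps,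
    map_neg, map_ofNat, oneQ_psi]
  simp only [Comp.adj, oneQbar_psiBar]

theorem hyperQ_psiBar : acomm (hyperQ h j a) (hyperField h (.psiBar b) F)
    = ∑ k, (2 * eps j k) • sigmaD a b (hyperField h (.phiStar k)) F := by
  rw [acomm_hyperQ h j a _ rfl]
  simp only [Comp.adj, oneQ_psiBar, oneQbar_psi, sigmaD_hyperField, ← GradedForm.opField_smul,
    ← GradedForm.opField_sum, map_ofNat, map_mul, conj_I, conj_eps, Fin.sum_univ_two]
  congr 1 <;> module

theorem hyperQ_chi : acomm (hyperQ h j a) (hyperField h (.chi b) F)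
    = ∑ k, (2 * eps j k * eps a b) • hyperField h (.fStar k) F := by
  rw [acomm_hyperQ h j a _ rfl]
  simp only [Comp.adj, oneQ_chi, oneQbar_chiBar, hyperField_apply, ← GradedForm.opField_smul,
    ← GradedForm.opField_sum, map_ofNat, map_mul, conj_eps]

theorem hyperQ_chiBar : acomm (hyperQ h j a) (hyperField h (.chiBar b) F)
    = (2 : ℂ) • sigmaD a b (hyperField h (.phi j)) F := by
  rw [acomm_hyperQ h j a _ rfl]
  simp only [Comp.adj, oneQ_chiBar, oneQbar_chi, sigmaD_hyperField, ← GradedForm.opField_smul,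
    map_ofNat, conj_I]
  congr 1 <;> module

theorem hyperZ_phi : I • comm (hyperZ h) (hyperField h (.phi j) F) = hyperField h (.f j) F := by
  rw [comm_hyperZ, hyperField_apply, ← GradedForm.opField_smul, conj_I]
  simp only [Comp.adj, oneZ_phi, oneZ_phiStar]
  congr 1 <;> match_scalars <;> ring_nf <;> simp only [I_sq] <;> ring1

theorem hyperZ_f : I • comm (hyperZ h) (hyperField h (.f j) F)
    = hyperField h (.phi j) (dAlembert F) := by
  rw [comm_hyperZ, hyperField_apply, ← GradedForm.opField_smul, conj_I, conjFn_dAlembert,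
    hat_dAlembert, hat_dAlembert]
  simp only [Comp.adj, oneZ_f, oneZ_fStar, map_neg, map_smul]
  congr 1 <;> match_scalars <;> ring_nf <;> simp only [I_sq] <;> ring1

theorem hyperZ_psi : comm (hyperZ h) (hyperField h (.psi a) F)
    = I • diracBar (fun b => hyperField h (.chiBar b)) a F := by
  rw [comm_hyperZ, diracBar_eq]
  simp only [Comp.adj, oneZ_psi, oneZ_psiBar, sigmaD_hyperField, ← GradedForm.opField_smul,
    ← GradedForm.opField_sum, map_neg, conj_I, conj_eps, Fin.sum_univ_two]
  congr 1 <;> match_scalars <;> ring_nf <;> simp only [I_sq] <;> ring1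

theorem hyperZ_chi : comm (hyperZ h) (hyperField h (.chi a) F)
    = (-I) • diracBar (fun b => hyperField h (.psiBar b)) a F := by
  rw [comm_hyperZ, diracBar_eq]
  simp only [Comp.adj, oneZ_chi, oneZ_chiBar, sigmaD_hyperField, ← GradedForm.opField_smul,
    ← GradedForm.opField_sum, map_neg, conj_I, conj_eps, Fin.sum_univ_two]
  congr 1 <;> match_scalars <;> ring_nf <;> simp only [I_sq] <;> ring1

theorem hyperP_field (μ : Fin 4) (c : Comp) : comm (hyperP h μ) (hyperField h c F)
    = (-I) • dField μ (hyperField h c) F := by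
  rw [comm_hyperP, dField_hyperField, oneP_single, oneP_single, smul_smul, neg_mul, I_mul_I,
    neg_neg, one_smul]

/-- The supersymmetry of the free fields of the hyper-multiplet. -/
def hyperSusy : (hyperFields h).Susy where
  Q := hyperQ h
  Qbar := hyperQbar h
  Z := hyperZ h
  P := hyperP h
  Q_adj j a := (oneParticle m α β h).inner_op ((oneParticle m α β h).form_der (isParity_oneQ h j a)
    (isParity_oneQbar h j a) (oneForm_oneQ α β j a))
  Z_adj := (oneParticle m α β h).inner_op ((oneParticle m α β h).form_der (isParity_oneZ h)
    (isParity_oneZ h) (oneForm_oneZ α β))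
  P_adj μ := (oneParticle m α β h).inner_op ((oneParticle m α β h).form_der (isParity_oneP h μ)
    (isParity_oneP h μ) (oneForm_oneP α β μ))
  Q_vac j a := ((oneParticle m α β h).op_dvec (hasAdj_oneQ h j a) 1).trans
    (by rw [GradedForm.der_one, map_zero]; rfl)
  Qbar_vac j a := ((oneParticle m α β h).op_dvec (hasAdj_oneQbar h j a) 1).trans
    (by rw [GradedForm.der_one, map_zero]; rfl)
  P_vac μ := ((oneParticle m α β h).op_dvec (hasAdj_oneP h μ) 1).trans
    (by rw [GradedForm.der_one, map_zero]; rfl)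
  P_field μ c F := hyperP_field h F μ c
  Q_P j a μ := sub_eq_zero.2 (hyperP_mul_hyperQ h j a μ).symm
  Z_Q j a := sub_eq_zero.2 (hyperZ_mul_hyperQ h j a)
  Z_Qbar j a := sub_eq_zero.2 (hyperZ_mul_hyperQbar h j a)
  Z_P μ := sub_eq_zero.2 (hyperZ_mul_hyperP h μ)
  Q_Q := acomm_hyperQ_hyperQ h
  Q_Qbar := acomm_hyperQ_hyperQbar h
  Q_lor := lor_hyperQ h
  Q_su2 := su2_hyperQ h
  Q_phi := hyperQ_phi h
  Qbar_phi := hyperQbar_phi h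
  Q_f := hyperQ_f h
  Qbar_f := hyperQbar_f h
  Q_psi := hyperQ_psi h
  Q_psiBar := hyperQ_psiBar h
  Q_chi := hyperQ_chi h
  Q_chiBar := hyperQ_chiBar h
  Z_phi := hyperZ_phi h
  Z_f := hyperZ_f h
  Z_psi := hyperZ_psi h
  Z_chi := hyperZ_chi h

end

end Hyper

namespace Hyper

noncomputable section

open scoped ComplexConjugate FourierTransform ContDiff

variable {m : ℝ} {α : ℂ} {β : ℝ}

/-! ### Necessity of the bound -/

/-- The inverse Fourier transform of a bump around a point of the positive shell. The negative shell
lies on the other side of zero energy, so the ball of radius `ω(q) / 2π` misses it. A nonzero `q`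
keeps the energy positive also for `m = 0`. -/
theorem exists_positive_frequency (m : ℝ) : ∃ G : TestFn, (∀ p, shellTransform m (-1) G p = 0)
    ∧ ∃ p, 0 < energy m p ∧ shellTransform m 1 G p ≠ 0 := by
  set q : Mom := EuclideanSpace.single 0 1 with hq
  have hpos : 0 < energy m q := by
    refine lt_of_lt_of_le ?_ (norm_le_energy m q)
    rw [hq, PiLp.norm_single, norm_one]
    exact one_pos
  have hδ : 0 < energy m q / (2 * Real.pi) := by positivity
  let f : ContDiffBump (shellPt m 1 q) :=
    ⟨energy m q / (2 * Real.pi) / 2, energy m q / (2 * Real.pi), half_pos hδ, half_lt_self hδ⟩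
  have hc : HasCompactSupport fun x => ((f x : ℝ) : ℂ) :=
    f.hasCompactSupport.comp_left ofReal_zero
  have hs : ContDiff ℝ ∞ fun x => ((f x : ℝ) : ℂ) := ofRealCLM.contDiff.comp f.contDiff
  have hf : ∀ s p, shellTransform m s (𝓕⁻ (hc.toSchwartzMap hs)) p = (f (shellPt m s p) : ℂ) := by
    intro s p
    rw [shellTransform_eq, FourierTransform.fourier_fourierInv_eq]
    rfl
  refine ⟨𝓕⁻ (hc.toSchwartzMap hs), fun p => ?_, q, hpos, ?_⟩
  · rw [hf, f.zero_of_le_dist, ofReal_zero]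
    change energy m q / (2 * Real.pi) ≤ _
    rw [dist_eq_norm]
    refine le_trans ?_ (PiLp.norm_apply_le _ (0 : Fin 4))
    rw [PiLp.sub_apply, shellPt_apply, shellPt_apply, kcov_zero, kcov_zero, Real.norm_eq_abs]
    refine le_trans ?_ (le_abs_self _)
    rw [← sub_div]
    have := energy_nonneg m p
    gcongr
    linarith
  · rw [hf, f.one_of_mem_closedBall (Metric.mem_closedBall_self (half_pos hδ).le)]
    norm_num

/-- The integrand is positive on the set where neither the energy nor `g` vanishes, which is open
and nonempty. -/
theorem shellInner_self_pos {g : shellFn m} {p : Mom} (hp : 0 < energy m p) (hg : g.1 p ≠ 0) :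
    ∃ n : ℝ, 0 < n ∧ shellInner m g g = n := by
  have e : ∀ p, ((1 / (2 * energy m p) : ℝ) : ℂ) * (conj (g.1 p) * g.1 p)
      = ((1 / (2 * energy m p) * ‖g.1 p‖ ^ 2 : ℝ) : ℂ) := fun p => by
    rw [mul_comm (conj _), Complex.mul_conj, Complex.normSq_eq_norm_sq]
    push_cast
    rfl
  have hi := (integrable_shellMeasure_iff m _).1 (integrable_shellFn_mul g g)
  simp only [e] at hi
  have hi' : Integrable (fun p => 1 / (2 * energy m p) * ‖g.1 p‖ ^ 2) := hi.re
  refine ⟨shellConst * ∫ p, 1 / (2 * energy m p) * ‖g.1 p‖ ^ 2, mul_pos shellConst_pos ?_, ?_⟩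
  · rw [integral_pos_iff_support_of_nonneg (fun p => by
      have := energy_nonneg m p
      positivity) hi']
    have ho : IsOpen {p : Mom | 0 < energy m p ∧ g.1 p ≠ 0} :=
      (isOpen_lt continuous_const (continuous_energy m)).inter
        ((shellFn_continuous g).isOpen_preimage _ isOpen_compl_singleton)
    refine (ho.measure_pos volume ⟨p, hp, hg⟩).trans_le (measure_mono fun p hp => ?_)
    have h1 := hp.1
    have h2 := norm_pos_iff.2 hp.2
    exact ne_of_gt (by positivity)
  · rw [shellInner_apply, integral_shellMeasure]
    simp only [e]
    rw [integral_complex_ofReal]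
    push_cast
    rfl

namespace FreeFields

variable {H : Type} [NormedAddCommGroup H] [InnerProductSpace ℂ H] (S : FreeFields m H)

/-- The adjoint field smeared with the conjugate of `G` annihilates the vacuum by the Fock property,
so only the commutator survives in the vacuum expectation. -/
theorem inner_field_vac {G : TestFn} (hG : ∀ p, shellTransform m (-1) G p = 0) (c d : Comp) {κ : ℂ}
    (h : S.field c.adj (conjFn G) * S.field d G - S.field d G * S.field c.adj (conjFn G) = κ • 1) :
    inner ℂ (S.field c G S.vac : H) (S.field d G S.vac : H) = κ := by
  have h0 : S.field c.adj (conjFn G) S.vac = 0 :=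
    S.fock _ _ fun p => by rw [shellTransform_conjFn, hG, map_zero]
  have h1 := LinearMap.congr_fun h S.vac
  simp only [LinearMap.sub_apply, Module.End.mul_apply, h0, map_zero, sub_zero,
    LinearMap.smul_apply, Module.End.one_apply] at h1
  rw [S.field_adj c G (conjFn G) (fun x => rfl), h1, Submodule.coe_smul, inner_smul_right,
    inner_self_eq_norm_sq_to_K, S.vac_norm]
  simp

/-- Positivity of the Gram matrix of three one-field vectors, built from `f 0`, `phi 0` and `phiStar
1`. The last two are the vectors to which `f 0` is coupled through `β` and `α`. -/
theorem Causal.bound {S : FreeFields m H} (hS : S.Causal α β) : ‖α‖ ^ 2 + β ^ 2 ≤ m ^ 2 := by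
  obtain ⟨G, hG, p, hp, hGp⟩ := exists_positive_frequency m
  obtain ⟨n, hn, hGn⟩ := shellInner_self_pos (g := hat m G) hp hGp
  have h0 : hat m (conjFn G) = 0 := shellFn_ext fun p => by
    rw [hat_apply, shellTransform_conjFn, hG, map_zero]
    rfl
  have hD : pauliJordan m (conjFn G) G = I * n := by
    rw [pauliJordan_eq_shellInner, conjFn_conjFn, h0, hGn, map_zero, sub_zero]
  have hD' : pauliJordan m G (conjFn G) = -(I * n) := by
    rw [pauliJordan_eq_shellInner, conjFn_conjFn, h0, hGn, map_zero, zero_sub, mul_neg]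
  -- For `f 0` and `phi 0` the causal relations put the adjoint field second, whereas
  -- `inner_field_vac` has it first.
  have swap : ∀ {A B : Module.End ℂ S.dom} {κ : ℂ}, comm A B = κ • 1 →
      B * A - A * B = (-κ) • (1 : Module.End ℂ S.dom) := fun {A B κ} h => by
    rw [comm] at h
    rw [← neg_sub, h]
    module
  have k11 := S.inner_field_vac hG (.f 0) (.f 0) (swap (hS.f_fStar 0 0 G (conjFn G)))
  have k12 := S.inner_field_vac hG (.f 0) (.phi 0) (swap (hS.phi_fStar 0 0 G (conjFn G)))
  have k22 := S.inner_field_vac hG (.phi 0) (.phi 0) (swap (hS.phi_phiStar 0 0 G (conjFn G)))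
  have k31 := S.inner_field_vac hG (.phiStar 1) (.f 0) (hS.phi_f 1 0 (conjFn G) G)
  have k32 := S.inner_field_vac hG (.phiStar 1) (.phi 0) (κ := 0)
    (by rw [zero_smul]; exact hS.phi_phi 1 0 (conjFn G) G)
  have k33 := S.inner_field_vac hG (.phiStar 1) (.phiStar 1) (hS.phi_phiStar 1 1 (conjFn G) G)
  set u : H := ((S.field (.f 0) G S.vac : S.dom) : H)
  set v : H := ((S.field (.phi 0) G S.vac : S.dom) : H)
  set w : H := ((S.field (.phiStar 1) G S.vac : S.dom) : H)
  rw [hD'] at k11 k12 k22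
  rw [hD] at k31 k33
  have k21 : inner ℂ v u = conj (inner ℂ u v) := (inner_conj_symm v u).symm
  have k13 : inner ℂ u w = conj (inner ℂ w u) := (inner_conj_symm u w).symm
  have k23 : inner ℂ v w = conj (inner ℂ w v) := (inner_conj_symm v w).symm
  rw [k12] at k21
  rw [k31] at k13
  rw [k32] at k23
  -- The vectors `v` and `w` are orthogonal with squared norm `n`, and their inner products with `u`
  -- are `-iβn` and `-iαn`. The vector chosen is the part of `u` orthogonal to both.
  have key : inner ℂ (u + (I * β) • v + (I * α) • w) (u + (I * β) • v + (I * α) • w)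
      = ((n * (m ^ 2 - (‖α‖ ^ 2 + β ^ 2)) : ℝ) : ℂ) := by
    have hα : conj α * α = (‖α‖ : ℂ) ^ 2 := Complex.conj_mul' α
    simp only [inner_add_left, inner_add_right, inner_smul_left, inner_smul_right, k11, k12, k13,
      k21, k22, k23, k31, k32, k33, map_mul, map_neg, conj_I, conj_ofReal, eps_apply, kron_apply,
      map_one, map_zero]
    push_cast
    rw [← hα]
    ring_nf
    simp only [I_sq, show I ^ 4 = 1 by rw [I_pow_four]]
    ring1
  rw [inner_self_eq_norm_sq_to_K] at key
  have h2 : (‖u + (I * β) • v + (I * α) • w‖ ^ 2 : ℝ) = n * (m ^ 2 - (‖α‖ ^ 2 + β ^ 2)) := by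
    exact Complex.ofReal_injective (by rw [← key]; push_cast; rfl)
  have h3 : 0 ≤ n * (m ^ 2 - (‖α‖ ^ 2 + β ^ 2)) := h2 ▸ sq_nonneg _
  linarith [nonneg_of_mul_nonneg_right h3 hn]

end FreeFields

end

end Hyper

theorem mainTheorem8 (m : ℝ) (hm : 0 ≤ m) (α : ℂ) (β : ℝ) :
    Hyper.HasHilbertSpaceRepresentation m α β ↔ ‖α‖ ^ 2 + β ^ 2 ≤ m ^ 2 :=
  ⟨fun ⟨_, _, _, _, _, hS, _⟩ => hS.bound, fun h =>
    ⟨_, _, _, inferInstance, Hyper.hyperFields h, Hyper.hyperFields_causal h,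
      ⟨Hyper.hyperSusy h⟩⟩⟩
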